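/- **Setting.** For every $n\ge 1$ let $p,d\ge 1$ and $m_0\ge 0$ be integers (all may depend on $n$), put $T=n+d-1$, and let $0=t_0<t_1<\dots<t_{m_0}<t_{m_0+1}=T+1$ be integer break points. Let $(\varepsilon_t)_{t\in\mathbb Z}$ be i.i.d. $N(0,\Sigma_\varepsilon)$ vectors in $\mathbb R^p$, let $\Phi^{(i,j)}\in\mathbb R^{p\times p}$ ($1\le i\le d$, $1\le j\le m_0+1$), and let the observed series satisfy $$y_t=\sum_{i=1}^d\Phi^{(i,j)}y_{t-i}+\varepsilon_t\qquad\text{for } t_{j-1}\le t<t_j,\ j=1,\dots,m_0+1,$$ where $(y_t)_{t<0}$ is the past of the stationary process $y^{(1)}$ of the first regime (see A1). Assume that the segments are long compared with the order: $\min_{1\le j\le m_0+1}(t_j-t_{j-1})/d\to\infty$ as $n\to\infty$ (for fixed $d$: the shortest segment length tends to infinity). Put $\Phi^{(.,j)}=(\Phi^{(1,j)}\ \cdots\ \Phi^{(d,j)})\in\mathbb R^{p\times pd}$. Let $s_{ij}$ be the number of nonzero entries in row $i$ of $\Phi^{(.,j)}$, with $s_{i0}=0$, and $s^\star=\max_{1\le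 i\le p,\,1\le j\le m_0+1}s_{ij}$. **Regression.** Write $\Phi_t=\Phi^{(.,j)}$ for $t_{j-1}\le t<t_j$, and let $\theta_1=\Phi_d$ and $\theta_i=\Phi_{d+i-1}-\Phi_{d+i-2}$ for $2\le i\le n$. (Thus $\theta_1=\Phi^{(.,1)}$ if $t_1>d$, and for $i\ge2$ the block $\theta_i$ is $\Phi^{(.,j+1)}-\Phi^{(.,j)}$ if $d+i-1=t_j$ for some $1\le j\le m_0$, and $0$ otherwise.) Let $\mathcal Y\in\mathbb R^{n\times p}$ have the rows $y_d',\dots,y_T'$; let $\mathcal X\in\mathbb R^{n\times npd}$ be the matrix whose row $r$ has $(y_{d+r-2}',\dots,y_{r-1}')$ in each of the block columns $1,\dots,r$ and $0$ in the other block columns; let $Y=\mathrm{vec}(\mathcal Y)$, $Z=I_p\otimes\mathcal X$, and $\Theta=\mathrm{vec}$ of the stacked matrix $(\theta_1\ \cdots\ \theta_n)'$. The estimator is $$\widehat\Theta\in\operatorname*{argmin}_{\Theta}\ \frac1n\|Y-Z\Theta\|_2^2+\lambda_n\sum_{i=1}^n\|\theta_i\|_1 ,$$ where $\|\theta_i\|_1$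 is the sum of the absolute values of the entries of the block $\theta_i$. **A1.** There are constants $0<\mathfrak m,\mathcal M<\infty$, not depending on $n$, such that for every $n$ and every $j\le m_0+1$ there is a stationary Gaussian process $y^{(j)}_t=\sum_{i=1}^d\Phi^{(i,j)}y^{(j)}_{t-i}+\varepsilon_t$, $t\in\mathbb Z$, in which $\varepsilon_t$ is independent of $(y_s^{(j)})_{s<t}$, whose autocovariances $\Gamma_j(h)=\operatorname{cov}(y^{(j)}_t,y^{(j)}_{t+h})$ are summable over $h\in\mathbb Z$, and whose spectral density $f_j(\theta)=\frac1{2\pi}\sum_{l\in\mathbb Z}\Gamma_j(l)e^{-il\theta}$ satisfies $$\operatorname*{ess\,sup}_{\theta\in[-\pi,\pi]}\Lambda_{\max}(f_j(\theta))\le\mathcal M,\qquad \operatorname*{ess\,inf}_{\theta\in[-\pi,\pi]}\Lambda_{\min}(f_j(\theta))\ge\mathfrak m .$$ **A2.** $s^\star/p\to0$, and there are constants $v,v',M_\Phi>0$, not depending on $n$, with $\max_i\|\Phi_i^{(.,j+1)}\|_2\ge v'\max_i\|\Phi_i^{(.,j)}\|_2$ (rows $\Phi_i$) and $\|\Phi^{(.,j+1)}-\Phi^{(.,j)}\|_2\ge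 v$ (entrywise $\ell^2$ norm) for $1\le j\le m_0$, and all entries of all $\Phi^{(.,j)}$, $1\le j\le m_0+1$, at most $M_\Phi$ in absolute value. Moreover $s^\star\sqrt{\log p/(n\gamma_n)}\to0$ for some positive sequence $\gamma_n\to0$. **Theorem 1.** There is a constant $C_0>0$ depending only on $\mathfrak m$ and $\mathcal M$ such that the following holds for every $C\ge C_0$. Suppose that A1 and A2 hold, let $$\lambda_n=2C\sqrt{\frac{\log n+2\log p+\log d}{n}},$$ and let $m_n\ge1$ be real numbers with $m_0\le m_n$ and $m_n=o(\lambda_n^{-1})$. Then, with probability tending to $1$ as $n\to\infty$, $$\frac1n\big\|Z(\widehat\Theta-\Theta)\big\|_2^2\ \le\ 4C\,m_n\max_{1\le j\le m_0+1}\Big\{\sum_{i=1}^p\big(s_{ij}+s_{i(j-1)}\big)\Big\}\,M_\Phi\,\sqrt{\frac{\log n+2\log p+\log d}{n}} .$$ -/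

import Mathlib

open MeasureTheory ProbabilityTheory Filter Topology Asymptotics Matrix
open scoped ENNReal Kronecker

universe u

noncomputable section

namespace BreakVAR

/-- Parameters of a piecewise VAR(`d`) model in dimension `p` with `m₀` break points
`0 = t₀ < t₁ < ⋯ < t_{m₀} < t_{m₀+1} = T + 1`, where `n = T - d + 1` is the number of rows of the
regression (so that `T + 1 = n + d`).  The regimes `1, …, m₀ + 1` are indexed by `Fin (m₀ + 1)`,
and the lags `1, …, d` by `Fin d`. -/
structure Params (n p d m₀ : ℕ) where
  /-- the break points, `brk 0 = t₀, …, brk (m₀ + 1) = t_{m₀+1}` -/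
  brk : Fin (m₀ + 2) → ℕ
  brk_zero : brk 0 = 0
  brk_last : brk (Fin.last (m₀ + 1)) = n + d
  brk_strictMono : StrictMono brk
  /-- `coeff j i` is the coefficient matrix of regime `j` at lag `i + 1` -/
  coeff : Fin (m₀ + 1) → Fin d → Matrix (Fin p) (Fin p) ℝ
  /-- the covariance matrix of the noise -/
  noiseCov : Matrix (Fin p) (Fin p) ℝ
  noiseCov_posSemidef : noiseCov.PosSemidef

section Processes

variable {Ω : Type u} [MeasurableSpace Ω] {p d : ℕ}

/-- `(ε_t)` is Gaussian white noise with covariance matrix `S`. -/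
structure IsGaussianWhiteNoise (ε : ℤ → Ω → EuclideanSpace ℝ (Fin p))
    (S : Matrix (Fin p) (Fin p) ℝ) (P : Measure Ω) : Prop where
  law : ∀ t, HasLaw (ε t) (multivariateGaussian 0 S) P
  indep : iIndepFun ε P

/-- The autoregressive prediction `∑_{i=1}^d Φ^{(i)} x_{t-i}`. -/
def arPart (Φ : Fin d → Matrix (Fin p) (Fin p) ℝ) (x : ℤ → Ω → EuclideanSpace ℝ (Fin p))
    (t : ℤ) (ω : Ω) : EuclideanSpace ℝ (Fin p) :=
  ∑ i : Fin d, WithLp.toLp 2 (Φ i *ᵥ (x (t - ((i : ℤ) + 1)) ω).ofLp)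

/-- `(x_t)` is a stationary Gaussian VAR process with coefficients `Φ` and innovations `ε`:
a stationary Gaussian process with `x_t = ∑ Φ^{(i)} x_{t-i} + ε_t` in which `ε_t` is independent
of the past `(x_s)_{s < t}`. -/
structure IsStationaryGaussianVAR (Φ : Fin d → Matrix (Fin p) (Fin p) ℝ)
    (ε x : ℤ → Ω → EuclideanSpace ℝ (Fin p)) (P : Measure Ω) : Prop where
  gaussian : IsGaussianProcess x P
  stationary : ∀ h : ℤ, P.map (fun ω (t : ℤ) => x (t + h) ω) = P.map (fun ω (t : ℤ) => x t ω)
  recursion : ∀ t, ∀ᵐ ω ∂P, x t ω = arPart Φ x t ω + ε t ω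
  innovation : ∀ t, IndepFun (ε t) (fun ω (s : Set.Iio t) => x s ω) P

/-- The autocovariance matrix `Γ(h) = cov(x_0, x_h)` of a stationary process. -/
def autocov (x : ℤ → Ω → EuclideanSpace ℝ (Fin p)) (P : Measure Ω) (h : ℤ) :
    Matrix (Fin p) (Fin p) ℝ :=
  Matrix.of fun a b => cov[fun ω => x 0 ω a, fun ω => x h ω b; P]

/-- The autocovariances are summable, so that the series of the spectral density converges. -/
def HasSpectralDensity (x : ℤ → Ω → EuclideanSpace ℝ (Fin p)) (P : Measure Ω) : Prop :=
  ∀ a b, Summable fun h : ℤ => autocov x P h a b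

/-- The spectral density matrix `f(θ) = (1/2π) ∑_l Γ(l) e^{-ilθ}`. -/
def spectralDensity (x : ℤ → Ω → EuclideanSpace ℝ (Fin p)) (P : Measure Ω) (θ : ℝ) :
    Matrix (Fin p) (Fin p) ℂ :=
  Matrix.of fun a b => (1 / (2 * (Real.pi : ℂ))) *
    ∑' l : ℤ, (autocov x P l a b : ℂ) * Complex.exp (-Complex.I * (l : ℂ) * (θ : ℂ))

/-- The largest eigenvalue of a Hermitian matrix. -/
def eigMax (A : Matrix (Fin p) (Fin p) ℂ) : ℝ := sSup (spectrum ℝ A)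

/-- The smallest eigenvalue of a Hermitian matrix. -/
def eigMin (A : Matrix (Fin p) (Fin p) ℂ) : ℝ := sInf (spectrum ℝ A)

/-- The essential supremum over `[-π, π]` of the largest eigenvalue of the spectral density. -/
def specUpper (x : ℤ → Ω → EuclideanSpace ℝ (Fin p)) (P : Measure Ω) : ℝ≥0∞ :=
  essSup (fun θ : ℝ => ENNReal.ofReal (eigMax (spectralDensity x P θ)))
    (volume.restrict (Set.Icc (-Real.pi) Real.pi))

/-- The essential infimum over `[-π, π]` of the smallest eigenvalue of the spectral density. -/
def specLower (x : ℤ → Ω → EuclideanSpace ℝ (Fin p)) (P : Measure Ω) : ℝ≥0∞ :=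
  essInf (fun θ : ℝ => ENNReal.ofReal (eigMin (spectralDensity x P θ)))
    (volume.restrict (Set.Icc (-Real.pi) Real.pi))

end Processes

namespace Params

variable {n p d m₀ : ℕ} (M : Params n p d m₀)

/-- The `p × pd` matrix `Φ^{(.,j)} = (Φ^{(1,j)} ⋯ Φ^{(d,j)})`. -/
def row (j : Fin (m₀ + 1)) : Matrix (Fin p) (Fin d × Fin p) ℝ :=
  Matrix.of fun a lk => M.coeff j lk.1 a lk.2

/-- `Φ^{(.,j)}` for the regime `j` in force at time `t`, i.e. with `t_{j-1} ≤ t < t_j`. -/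
def coeffAt (t : ℕ) : Matrix (Fin p) (Fin d × Fin p) ℝ :=
  ∑ j : Fin (m₀ + 1), if M.brk j.castSucc ≤ t ∧ t < M.brk j.succ then M.row j else 0

/-- The number of nonzero entries in row `a` of `Φ^{(.,j)}`. -/
def rowNnz (a : Fin p) (j : Fin (m₀ + 1)) : ℕ :=
  (Finset.univ.filter fun lk : Fin d × Fin p => M.row j a lk ≠ 0).card

/-- `s_{aj}` for `j = 0, 1, …, m₀ + 1`, with the convention `s_{a0} = 0` (that is,
`Φ^{(.,0)} = 0`). -/
def s (a : Fin p) : Fin (m₀ + 2) → ℕ := Fin.cases 0 (M.rowNnz a)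

/-- `max_{1 ≤ j ≤ m₀+1} ∑_a (s_{aj} + s_{a(j-1)})`. -/
def maxJumpNnz : ℕ :=
  Finset.univ.sup fun j : Fin (m₀ + 1) => ∑ a : Fin p, (M.s a j.succ + M.s a j.castSucc)

/-- `s^⋆`, the largest number of nonzero entries in a row of some `Φ^{(.,j)}`. -/
def sStar : ℕ :=
  Finset.univ.sup fun aj : Fin p × Fin (m₀ + 1) => M.rowNnz aj.1 aj.2

/-- `max_a ‖Φ_a^{(.,j)}‖₂`, the largest Euclidean norm of a row of `Φ^{(.,j)}`. -/
def maxRowNorm (j : Fin (m₀ + 1)) : ℝ :=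
  ⨆ a : Fin p, Real.sqrt (∑ lk : Fin d × Fin p, M.row j a lk ^ 2)

/-- The Euclidean (entrywise `ℓ²`) norm of `Φ^{(.,j)} - Φ^{(.,k)}`. -/
def coeffDist (j k : Fin (m₀ + 1)) : ℝ :=
  Real.sqrt (∑ a : Fin p, ∑ lk : Fin d × Fin p, (M.row j a lk - M.row k a lk) ^ 2)

/-- The length of the shortest segment, `min_{1 ≤ j ≤ m₀+1} (t_j - t_{j-1})`. -/
def minSegment : ℝ :=
  ⨅ j : Fin (m₀ + 1), ((M.brk j.succ : ℝ) - (M.brk j.castSucc : ℝ))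

/-- The matrix `θ(n)` of the regression: its `i`-th block of rows is `θ_i'`, where `θ_1` is the
coefficient matrix in force at time `d`, the time of the first row, and `θ_i` is the change of the
coefficient matrix between the times of rows `i - 1` and `i` (zero unless the time of row `i` is a
break point).  Blocks are numbered from `0` here, and row `r` belongs to time `d + r`. -/
def thetaMat : Matrix (Fin n × Fin d × Fin p) (Fin p) ℝ :=
  Matrix.of fun ilk a =>
    if (ilk.1 : ℕ) = 0 then M.coeffAt d a ilk.2
    else M.coeffAt (d + ilk.1) a ilk.2 - M.coeffAt (d + ilk.1 - 1) a ilk.2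

/-- `Θ = vec θ(n)`. -/
def theta : Fin p × (Fin n × Fin d × Fin p) → ℝ := Matrix.vec M.thetaMat

/-- The observed series `y` follows the piecewise VAR equation
`y_t = ∑ Φ^{(i,j)} y_{t-i} + ε_t` for `t_{j-1} ≤ t < t_j`, `j = 1, …, m₀ + 1`, and starts as the
stationary process `x₁` of the first regime. -/
structure IsSolution {Ω : Type u} [MeasurableSpace Ω] (P : Measure Ω)
    (ε x₁ y : ℤ → Ω → EuclideanSpace ℝ (Fin p)) : Prop where
  initial : ∀ t : ℤ, t < 0 → ∀ᵐ ω ∂P, y t ω = x₁ t ω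
  recursion : ∀ (j : Fin (m₀ + 1)) (t : ℤ), (M.brk j.castSucc : ℤ) ≤ t → t < (M.brk j.succ : ℤ) →
    ∀ᵐ ω ∂P, y t ω = arPart (M.coeff j) y t ω + ε t ω

/-- Stationarity and spectral bounds: for every regime `j` the process `x j` is a stationary
Gaussian VAR process with the coefficients of that regime and with spectral density bounded
above by `Mf` and below by `mf`. -/
structure AssumptionA1 {Ω : Type u} [MeasurableSpace Ω] (P : Measure Ω)
    (ε : ℤ → Ω → EuclideanSpace ℝ (Fin p))
    (x : Fin (m₀ + 1) → ℤ → Ω → EuclideanSpace ℝ (Fin p)) (Mf mf : ℝ) : Prop where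
  stationary : ∀ j, IsStationaryGaussianVAR (M.coeff j) ε (x j) P
  density : ∀ j, HasSpectralDensity (x j) P
  upper : ∀ j, specUpper (x j) P ≤ ENNReal.ofReal Mf
  lower : ∀ j, ENNReal.ofReal mf ≤ specLower (x j) P

end Params

/-- Sparsity, minimal jumps and boundedness of the coefficients, for a sequence of models. -/
structure AssumptionA2 {p d m₀ : ℕ → ℕ} (M : ∀ n, Params n (p n) (d n) (m₀ n))
    (v v' MΦ : ℝ) : Prop where
  sparse : Tendsto (fun n => ((M n).sStar : ℝ) / (p n : ℝ)) atTop (𝓝 0)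
  ratio : ∀ n (j : Fin (m₀ n)),
    v' * (M n).maxRowNorm j.castSucc ≤ (M n).maxRowNorm j.succ
  jump : ∀ n (j : Fin (m₀ n)), v ≤ (M n).coeffDist j.succ j.castSucc
  bounded : ∀ n (j : Fin (m₀ n + 1)) a lk, |(M n).row j a lk| ≤ MΦ
  rate : ∃ γ : ℕ → ℝ, (∀ n, 0 < γ n) ∧ Tendsto γ atTop (𝓝 0) ∧
    Tendsto (fun n => ((M n).sStar : ℝ) * Real.sqrt (Real.log (p n) / (n * γ n))) atTop (𝓝 0)

section Regression

variable (n : ℕ) {p : ℕ} (d : ℕ)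

/-- The `n × p` response matrix with rows `y_d', …, y_T'`. -/
def respMat (y : ℤ → EuclideanSpace ℝ (Fin p)) : Matrix (Fin n) (Fin p) ℝ :=
  Matrix.of fun r a => y ((d : ℤ) + r) a

/-- The `n × npd` design matrix: row `r` has the blocks `(y_{t-1}', …, y_{t-d}')`, with `t` the time
of that row, in the block columns `1, …, r`, and zeros in the other ones. -/
def designMat (y : ℤ → EuclideanSpace ℝ (Fin p)) : Matrix (Fin n) (Fin n × Fin d × Fin p) ℝ :=
  Matrix.of fun r ilk =>
    if ilk.1 ≤ r then y ((d : ℤ) + r - ((ilk.2.1 : ℤ) + 1)) ilk.2.2 else 0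

/-- `Y = vec 𝒴`. -/
def respVec (y : ℤ → EuclideanSpace ℝ (Fin p)) : Fin p × Fin n → ℝ := Matrix.vec (respMat n d y)

/-- `Z = I_p ⊗ 𝒳`. -/
def bigDesign (y : ℤ → EuclideanSpace ℝ (Fin p)) :
    Matrix (Fin p × Fin n) (Fin p × (Fin n × Fin d × Fin p)) ℝ :=
  (1 : Matrix (Fin p) (Fin p) ℝ) ⊗ₖ designMat n d y

variable {n d}

/-- `‖θ_i‖₁`, the sum of the absolute values of the entries of the block `θ_i`. -/
def blockL1 (Θ : Fin p × (Fin n × Fin d × Fin p) → ℝ) (i : Fin n) : ℝ :=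
  ∑ a : Fin p, ∑ lk : Fin d × Fin p, |Θ (a, (i, lk))|

/-- The penalized least squares objective `(1/n) ‖Y - Z Θ‖₂² + lam ∑_i ‖θ_i‖₁`. -/
def objective (y : ℤ → EuclideanSpace ℝ (Fin p)) (lam : ℝ)
    (Θ : Fin p × (Fin n × Fin d × Fin p) → ℝ) : ℝ :=
  1 / (n : ℝ) * ‖WithLp.toLp 2 (respVec n d y - bigDesign n d y *ᵥ Θ)‖ ^ 2
    + lam * ∑ i : Fin n, blockL1 Θ i

/-- `Θ₁` minimizes the penalized least squares objective with tuning parameter `lam`. -/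
def IsEstimate (y : ℤ → EuclideanSpace ℝ (Fin p)) (lam : ℝ)
    (Θ₁ : Fin p × (Fin n × Fin d × Fin p) → ℝ) : Prop :=
  ∀ Θ : Fin p × (Fin n × Fin d × Fin p) → ℝ, objective y lam Θ₁ ≤ objective y lam Θ

/-- The in-sample prediction error `(1/n) ‖Z (Θ₁ - Θ₀)‖₂²`. -/
def predError (y : ℤ → EuclideanSpace ℝ (Fin p))
    (Θ₁ Θ₀ : Fin p × (Fin n × Fin d × Fin p) → ℝ) : ℝ :=
  1 / (n : ℝ) * ‖WithLp.toLp 2 (bigDesign n d y *ᵥ (Θ₁ - Θ₀))‖ ^ 2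

end Regression

/-- The rate `√((log n + 2 log p + log d) / n)`. -/
def rate (n p d : ℕ) : ℝ :=
  Real.sqrt ((Real.log n + 2 * Real.log p + Real.log d) / n)

end BreakVAR

end

/-! The estimator is a lasso with `n p² d` coefficients. Let `e = Y - ZΘ`. If every entry of the
score `Zᵀe` is at most `nλ/2` in absolute value, the first-order condition at the minimizer, taken
in the direction of the true `Θ`, bounds the prediction error by `λ‖Θ‖₁`
(`lasso_prediction_error_le`). The true `Θ` has at most `m₀ + 1 ≤ 2 m_n` nonzero blocks, each of ℓ¹
norm at most `maxJumpNnz * MΦ`. This is the claimed bound, and only the score needs probability.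

An entry of the score is a sum `∑ u_k e_k` in which `u_k` is zero or an observation made before the
innovation `e_k`. On the event `∑ u_k² ≤ V` an exponential supermartingale gives a Gaussian tail
(`measure_abs_martingale_ge_le`). The sum `∑ u_k²` is at most the sum of squares of one coordinate
of the whole observed series, which is of order `n + d` outside an event of exponentially small
probability, provided that linear combinations of the observations have variance at most a constant
times the squared ℓ² norm of their coefficients (`measure_sum_sq_ge_le`). As `exp(n · rate²) = n p²
d`, a union bound over the entries succeeds once `C` is large.

The heart is that variance bound (`norm_comb_sq_le_pieceBound`), with a constant free of `p`, `d`
and the number of breaks. The spectral bounds say that, for the stationary process of a regime, the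
L² norm of a linear combination is comparable to the ℓ² norm of its coefficients. The innovations
inherit both bounds, so the adjoint of the autoregressive operator and its one-sided inverse have
norm at most `√κ`, with `κ = 𝓜/𝔪`. Hence a combination of `y` over a segment is a combination of
innovations plus a combination of the `d` values before the segment, with controlled coefficients.

What is handed back across successive segments must not accumulate. A combination of the last `d`
values of a segment reaches the past only through every one of `k` disjoint windows of length `d`.
Each window must carry a fixed fraction of the squared norm that arrives, while the windows together
carry at most a constant times the squared norm at the start. With `k ≥ 4κ⁴` at most a quarter
arrives, and the recursion over the segments contracts. -/

noncomputable section

namespace BreakVAR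

/-! ### Autoregressive operators on finitely supported coefficient arrays -/

section Coefficients

variable {p d : ℕ}

/-- Finitely supported coefficient arrays, indexed by time and coordinate. -/
abbrev Coef (p : ℕ) := ℤ × Fin p →₀ ℝ

/-- The sum of the squares of the entries. -/
def sqSum (α : Coef p) : ℝ := ∑ i ∈ α.support, α i ^ 2

/-- The part of `α` that lives on the times in `S`. -/
def onTimes (S : Set ℤ) : Coef p →ₗ[ℝ] Coef p := by
  classical
  exact
  { toFun := fun α => α.filter fun i => i.1 ∈ S
    map_add' := fun _ _ => Finsupp.filter_add
    map_smul' := fun _ _ => Finsupp.filter_smul }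

/-- `α` vanishes outside of the times in `S`. -/
def LivesOn (S : Set ℤ) (α : Coef p) : Prop := ∀ i : ℤ × Fin p, i.1 ∉ S → α i = 0

open Classical in
lemma onTimes_apply (S : Set ℤ) (α : Coef p) (i : ℤ × Fin p) :
    onTimes S α i = if i.1 ∈ S then α i else 0 := by
  rw [onTimes]; exact Finsupp.filter_apply _ _ _

lemma onTimes_apply_of_mem {S : Set ℤ} (α : Coef p) {i : ℤ × Fin p} (h : i.1 ∈ S) :
    onTimes S α i = α i := by simp [onTimes_apply, h]

lemma onTimes_apply_of_notMem {S : Set ℤ} (α : Coef p) {i : ℤ × Fin p} (h : i.1 ∉ S) :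
    onTimes S α i = 0 := by simp [onTimes_apply, h]

lemma livesOn_onTimes (S : Set ℤ) (α : Coef p) : LivesOn S (onTimes S α) :=
  fun _ h => onTimes_apply_of_notMem α h

lemma LivesOn.mono {S S' : Set ℤ} {α : Coef p} (h : LivesOn S α) (hS : S ⊆ S') : LivesOn S' α :=
  fun i hi => h i fun hi' => hi (hS hi')

lemma LivesOn.add {S : Set ℤ} {α β : Coef p} (h : LivesOn S α) (h' : LivesOn S β) :
    LivesOn S (α + β) := fun i hi => by simp [h i hi, h' i hi]

lemma LivesOn.neg {S : Set ℤ} {α : Coef p} (h : LivesOn S α) :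
    LivesOn S (-α) := fun i hi => by simp [h i hi]

lemma LivesOn.onTimes {S : Set ℤ} {α : Coef p} (h : LivesOn S α) (S' : Set ℤ) :
    LivesOn S (onTimes S' α) := fun i hi => by simp [onTimes_apply, h i hi]

lemma LivesOn.onTimes_eq {S : Set ℤ} {α : Coef p} (h : LivesOn S α) : BreakVAR.onTimes S α = α := by
  ext i
  by_cases hi : i.1 ∈ S
  · exact onTimes_apply_of_mem α hi
  · rw [onTimes_apply_of_notMem α hi, h i hi]

lemma onTimes_add_onTimes_compl (S : Set ℤ) (α : Coef p) :
    onTimes S α + onTimes Sᶜ α = α := by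
  ext i
  by_cases hi : i.1 ∈ S <;> simp [onTimes_apply, hi]

lemma sqSum_eq_sum {α : Coef p} {s : Finset (ℤ × Fin p)} (hs : α.support ⊆ s) :
    sqSum α = ∑ i ∈ s, α i ^ 2 := by
  refine Finset.sum_subset hs fun i _ hi => ?_
  simp [Finsupp.notMem_support_iff.mp hi]

lemma sqSum_nonneg (α : Coef p) : 0 ≤ sqSum α := Finset.sum_nonneg fun _ _ => sq_nonneg _

@[simp] lemma sqSum_zero : sqSum (0 : Coef p) = 0 := by simp [sqSum]

@[simp] lemma sqSum_neg (α : Coef p) : sqSum (-α) = sqSum α := by simp [sqSum]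

lemma sqSum_add_le (α β : Coef p) : sqSum (α + β) ≤ 2 * (sqSum α + sqSum β) := by
  classical
  rw [sqSum_eq_sum (s := α.support ∪ β.support) Finsupp.support_add,
    sqSum_eq_sum (α := α) (s := α.support ∪ β.support) Finset.subset_union_left,
    sqSum_eq_sum (α := β) (s := α.support ∪ β.support) Finset.subset_union_right,
    ← Finset.sum_add_distrib, Finset.mul_sum]
  refine Finset.sum_le_sum fun i _ => ?_
  simp only [Finsupp.add_apply]
  nlinarith [sq_nonneg (α i - β i)]

lemma support_onTimes_subset (S : Set ℤ) (α : Coef p) : (onTimes S α).support ⊆ α.support := by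
  intro i hi
  simp only [Finsupp.mem_support_iff, onTimes_apply] at hi ⊢
  intro h; simp [h] at hi

/-- Parts that live on disjoint sets of times. -/
lemma sum_sqSum_onTimes_le {κ : Type*} (s : Finset κ) (S : κ → Set ℤ)
    (hS : (s : Set κ).PairwiseDisjoint S) (α : Coef p) :
    ∑ k ∈ s, sqSum (onTimes (S k) α) ≤ sqSum α := by
  classical
  have h : ∀ k, sqSum (onTimes (S k) α) = ∑ i ∈ α.support, if i.1 ∈ S k then α i ^ 2 else 0 := by
    intro k
    rw [sqSum_eq_sum (support_onTimes_subset _ _)]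
    refine Finset.sum_congr rfl fun i _ => ?_
    rw [onTimes_apply]; split_ifs <;> simp
  simp_rw [h]
  rw [Finset.sum_comm]
  refine Finset.sum_le_sum fun i _ => ?_
  by_cases hi : ∃ k ∈ s, i.1 ∈ S k
  · obtain ⟨k, hk, hik⟩ := hi
    rw [Finset.sum_eq_single_of_mem k hk, if_pos hik]
    intro l hl hlk
    rw [if_neg]
    intro hil
    exact Set.disjoint_left.mp (hS hl hk hlk) hil hik
  · push Not at hi
    rw [Finset.sum_eq_zero]
    · positivity
    · intro k hk; rw [if_neg (hi k hk)]

lemma sqSum_onTimes_le (S : Set ℤ) (α : Coef p) : sqSum (onTimes S α) ≤ sqSum α := by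
  simpa using sum_sqSum_onTimes_le {()} (fun _ => S) (by simp) α

lemma sqSum_onTimes_add_compl (S : Set ℤ) (α : Coef p) :
    sqSum (onTimes S α) + sqSum (onTimes Sᶜ α) = sqSum α := by
  rw [sqSum_eq_sum (support_onTimes_subset S α), sqSum_eq_sum (support_onTimes_subset Sᶜ α),
    sqSum, ← Finset.sum_add_distrib]
  refine Finset.sum_congr rfl fun i _ => ?_
  by_cases hi : i.1 ∈ S <;> simp [onTimes_apply, hi]

/-- The adjoint of the operator `z ↦ (z_t - ∑ Φ^{(i)} z_{t-i})_t`. -/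
def adjAR (Φ : Fin d → Matrix (Fin p) (Fin p) ℝ) : Coef p →ₗ[ℝ] Coef p :=
  Finsupp.linearCombination ℝ fun i : ℤ × Fin p =>
    Finsupp.single i (1 : ℝ) -
      ∑ k : Fin d, ∑ b : Fin p, Finsupp.single (i.1 - ((k : ℤ) + 1), b) (Φ k i.2 b)

variable (Φ : Fin d → Matrix (Fin p) (Fin p) ℝ)

lemma adjAR_single (i : ℤ × Fin p) : adjAR Φ (Finsupp.single i 1) =
    Finsupp.single i (1 : ℝ) -
      ∑ k : Fin d, ∑ b : Fin p, Finsupp.single (i.1 - ((k : ℤ) + 1), b) (Φ k i.2 b) := by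
  simp [adjAR]

lemma adjAR_apply (β : Coef p) (s : ℤ) (b : Fin p) :
    adjAR Φ β (s, b) = β (s, b) - ∑ k : Fin d, ∑ a : Fin p, Φ k a b * β (s + ((k : ℤ) + 1), a) := by
  classical
  induction β using Finsupp.induction_linear with
  | zero => simp
  | add f g hf hg =>
    simp only [map_add, Finsupp.add_apply, hf, hg, mul_add, Finset.sum_add_distrib]; ring
  | single i c =>
    have : (Finsupp.single i c : Coef p) = c • Finsupp.single i 1 := by simp
    rw [this, map_smul, adjAR_single]
    obtain ⟨t, a⟩ := i
    simp only [Finsupp.smul_apply, Finsupp.sub_apply, Finsupp.finsetSum_apply, smul_eq_mul,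
      mul_sub, Finset.mul_sum]
    congr 1
    refine Finset.sum_congr rfl fun k _ => ?_
    simp only [Finsupp.single_apply, Prod.mk.injEq]
    by_cases h : t - ((k : ℤ) + 1) = s
    · have h' : t = s + ((k : ℤ) + 1) := by linarith
      simp [h', mul_comm]
    · have h' : ¬ t = s + ((k : ℤ) + 1) := fun h' => h (by linarith)
      simp [h, h']

lemma adjAR_congr {β β' : Coef p} {s : ℤ} (h : ∀ t a, s ≤ t → t ≤ s + d → β (t, a) = β' (t, a))
    (b : Fin p) : adjAR Φ β (s, b) = adjAR Φ β' (s, b) := by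
  rw [adjAR_apply, adjAR_apply, h s b le_rfl (by omega)]
  congr 1
  refine Finset.sum_congr rfl fun k _ => Finset.sum_congr rfl fun a _ => ?_
  rw [h _ _ (by omega) (by omega)]

lemma adjAR_eq_zero {β : Coef p} {s : ℤ} (h : ∀ t a, s ≤ t → t ≤ s + d → β (t, a) = 0)
    (b : Fin p) : adjAR Φ β (s, b) = 0 := by
  rw [adjAR_congr Φ (β' := 0) (by simpa using h) b]; simp

lemma LivesOn.adjAR {β : Coef p} {σ τ : ℤ} (h : LivesOn (Set.Ico σ τ) β) :
    LivesOn (Set.Ico (σ - d) τ) (adjAR Φ β) := by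
  rintro ⟨s, b⟩ hs
  refine adjAR_eq_zero Φ (fun t a h1 h2 => h _ ?_) b
  simp only [Set.mem_Ico, not_and, not_lt] at hs ⊢
  omega

/-- The operator `adjAR Φ` and the causal inverse of its adjoint are bounded, by `√κ`. -/
structure IsBoundedAR (κ : ℝ) : Prop where
  pos : 0 < κ
  upper : ∀ β : Coef p, sqSum (adjAR Φ β) ≤ κ * sqSum β
  lower : ∀ (τ : ℤ) (β : Coef p), LivesOn (Set.Ici τ) β →
    sqSum β ≤ κ * sqSum (onTimes (Set.Ici τ) (adjAR Φ β))

variable {Φ}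

/-- `adjAR` is unit triangular in time: it fixes a unit vector up to terms at strictly earlier
times, and terms before `τ` are cut off. Hence the truncated operator is onto. -/
lemma exists_onTimes_adjAR_eq (Φ : Fin d → Matrix (Fin p) (Fin p) ℝ) {τ τ' : ℤ} {α : Coef p}
    (hα : LivesOn (Set.Ico τ τ') α) :
    ∃ β, LivesOn (Set.Ico τ τ') β ∧ onTimes (Set.Ici τ) (adjAR Φ β) = α := by
  classical
  let U : Submodule ℝ (Coef p) :=
    { carrier := {β | LivesOn (Set.Ico τ τ') β}
      add_mem' := fun h h' => h.add h'
      zero_mem' := fun _ _ => rfl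
      smul_mem' := fun c β h i hi => by simp [h i hi] }
  let W := U.map (onTimes (Set.Ici τ) ∘ₗ adjAR Φ)
  -- Induction on the distance of `t` from `τ`; before `τ` the truncated unit vector is zero.
  have key : ∀ (k : ℕ) (t : ℤ) (a : Fin p), t < τ' → t < τ + k →
      onTimes (Set.Ici τ) (Finsupp.single (t, a) (1 : ℝ)) ∈ W := by
    intro k
    induction k with
    | zero =>
      intro t a _ ht
      convert W.zero_mem
      ext i
      rw [onTimes_apply]
      split_ifs with hi
      · rw [Finsupp.single_apply, if_neg]
        · rfl
        · rintro rfl; simp at hi ht; omega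
      · rfl
    | succ k ih =>
      intro t a ht' ht
      by_cases hτ : t < τ
      · exact ih t a ht' (by omega)
      have h1 : (Finsupp.single (t, a) (1 : ℝ) : Coef p) = adjAR Φ (Finsupp.single (t, a) 1) +
          ∑ k : Fin d, ∑ b : Fin p, Φ k a b • Finsupp.single (t - ((k : ℤ) + 1), b) (1 : ℝ) := by
        rw [adjAR_single]; simp
      rw [h1, map_add, map_sum]
      refine W.add_mem ⟨Finsupp.single (t, a) 1, ?_, rfl⟩ (W.sum_mem fun l _ => ?_)
      · intro i hi
        rw [Finsupp.single_apply, if_neg]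
        rintro rfl
        exact hi ⟨by simpa using hτ, ht'⟩
      · rw [map_sum]
        refine W.sum_mem fun b _ => ?_
        rw [map_smul]
        exact W.smul_mem _ (ih _ _ (by omega) (by push_cast at ht; omega))
  have hW : onTimes (Set.Ici τ) α ∈ W := by
    have h2 : α = ∑ i ∈ α.support, α i • Finsupp.single i (1 : ℝ) := by
      conv_lhs => rw [← Finsupp.sum_single α]
      simp [Finsupp.sum]
    rw [h2, map_sum]
    refine W.sum_mem fun i hi => ?_
    rw [map_smul]
    refine W.smul_mem _ ?_
    have : i.1 ∈ Set.Ico τ τ' := by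
      by_contra h; exact (Finsupp.mem_support_iff.mp hi) (hα i h)
    exact key ((i.1 - τ).toNat + 1) i.1 i.2 this.2 (by have := this.1; push_cast; omega)
  rw [(hα.mono Set.Ico_subset_Ici_self).onTimes_eq] at hW
  obtain ⟨β, hβ, h⟩ := hW
  exact ⟨β, hβ, h⟩

namespace IsBoundedAR

variable {κ : ℝ} (hΦ : IsBoundedAR Φ κ)
include hΦ

/-- Solving the adjoint recursion backwards on `[τ, τ')`: the coefficients that remain live on the
`d` times before `τ`. -/
lemma exists_decomposition {τ τ' : ℤ} {α : Coef p} (hα : LivesOn (Set.Ico τ τ') α) :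
    ∃ β h : Coef p, LivesOn (Set.Ico τ τ') β ∧ LivesOn (Set.Ico (τ - d) τ) h ∧
      α = adjAR Φ β + h ∧ sqSum β ≤ κ * sqSum α ∧ sqSum h ≤ κ * sqSum β := by
  obtain ⟨β, hβ, hβα⟩ := exists_onTimes_adjAR_eq Φ hα
  refine ⟨β, -onTimes (Set.Ici τ)ᶜ (adjAR Φ β), hβ, ?_, ?_, ?_, ?_⟩
  · refine LivesOn.neg fun i hi => ?_
    rw [onTimes_apply]
    split_ifs with h
    · refine hβ.adjAR Φ i ?_
      simp only [Set.mem_Ico, Set.mem_compl_iff, Set.mem_Ici] at hi h ⊢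
      omega
    · rfl
  · rw [← hβα]
    nth_rw 2 [← onTimes_add_onTimes_compl (Set.Ici τ) (adjAR Φ β)]
    abel
  · have := hΦ.lower τ β (hβ.mono Set.Ico_subset_Ici_self)
    rwa [hβα] at this
  · rw [sqSum_neg]
    exact (sqSum_onTimes_le _ _).trans (hΦ.upper β)

/-- The influence of the last `d` times of a long stretch on the past before it is small. -/
lemma sqSum_le_of_long {τ τ' : ℤ} {g β h : Coef p} {k : ℕ} (hk : τ + (k + 1) * d ≤ τ')
    (hg : LivesOn (Set.Ico (τ' - d) τ') g) (hβ : LivesOn (Set.Ico τ τ') β)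
    (hh : LivesOn (Set.Ico (τ - d) τ) h) (hgβ : g = adjAR Φ β + h) (hβg : sqSum β ≤ κ * sqSum g) :
    k * sqSum h ≤ κ ^ 4 * sqSum g := by
  have hκ := hΦ.pos
  have hAβ : adjAR Φ β = g - h := by rw [hgβ]; abel
  -- The recursion has order `d`, so the part of `β` before a window `[σ, σ + d)` is driven only by
  -- its part `w` inside the window. Thus `h` is a function of `w` alone, with squared norm at most
  -- `κ³` times that of `w`. This holds for each of `k` disjoint windows, and summing gives the
  -- factor `k`.
  have step : ∀ j ∈ Finset.range k, sqSum h ≤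
      κ ^ 3 * sqSum (onTimes (Set.Ico (τ' - (j + 1) * d) (τ' - j * d)) β) := by
    intro j hj
    have hjk : ((j : ℤ) + 1) ≤ k := by have := Finset.mem_range.mp hj; omega
    set σ : ℤ := τ' - (j + 1) * d with hσ
    have hjd : τ' - (j : ℤ) * d = σ + d := by rw [hσ]; ring
    have hjd' : σ ≤ τ' - d := by
      rw [hσ]; nlinarith [mul_nonneg (Int.natCast_nonneg j) (Int.natCast_nonneg d)]
    have hjd'' : τ + d ≤ σ := by
      have : ((j : ℤ) + 1) * d ≤ k * d := mul_le_mul_of_nonneg_right hjk (by positivity)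
      rw [hσ]; linarith
    rw [hjd]
    set β₁ := onTimes (Set.Iio σ) β with hβ₁
    set β₂ := onTimes (Set.Iio σ)ᶜ β with hβ₂
    have h12 : β₁ + β₂ = β := onTimes_add_onTimes_compl _ _
    have hA : adjAR Φ β₁ + adjAR Φ β₂ = g - h := by rw [← map_add, h12, hAβ]
    have e1 : ∀ s b, σ ≤ s → adjAR Φ β₁ (s, b) = 0 := fun s b hs =>
      adjAR_eq_zero Φ (fun t a ht _ => onTimes_apply_of_notMem _ (by simp; omega)) b
    set w := onTimes (Set.Ico σ (σ + d)) β with hw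
    set q := onTimes (Set.Iio σ) (adjAR Φ w) with hq
    have hq2 : ∀ s b, s < σ → adjAR Φ β₂ (s, b) = q (s, b) := by
      intro s b hs
      rw [hq, onTimes_apply_of_mem _ (by exact hs)]
      refine adjAR_congr Φ (fun t a _ _ => ?_) b
      rw [hβ₂, hw, onTimes_apply, onTimes_apply]
      congr 1
      simp only [Set.mem_compl_iff, Set.mem_Iio, Set.mem_Ico, eq_iff_iff]
      omega
    have hqlow : ∀ s b, s < σ - d → q (s, b) = 0 := by
      intro s b hs
      rw [← hq2 s b (by omega)]
      exact adjAR_eq_zero Φ (fun t a _ _ => onTimes_apply_of_notMem _ (by simp; omega)) b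
    -- Before `σ` the array `g` vanishes, so `β₁` has to cancel the spill `q` of the window as well
    -- as produce `-h`. The window lies at distance at least `d` from `τ`, which keeps the supports
    -- of `q` and `h` apart: truncating at `τ` separates them.
    have hA1 : adjAR Φ β₁ = -q - h := by
      ext ⟨s, b⟩
      simp only [Finsupp.sub_apply, Finsupp.neg_apply]
      by_cases hs : σ ≤ s
      · rw [e1 s b hs, hq, onTimes_apply_of_notMem _ (by simpa using hs),
          hh _ (by simp only [Set.mem_Ico]; omega)]
        simp
      · have := DFunLike.congr_fun hA (s, b)
        simp only [Finsupp.add_apply, Finsupp.sub_apply] at this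
        rw [hq2 s b (by omega), hg _ (by simp only [Set.mem_Ico]; omega)] at this
        linarith
    have hr : onTimes (Set.Ici τ) (adjAR Φ β₁) = -q := by
      ext ⟨s, b⟩
      by_cases hs : τ ≤ s
      · rw [onTimes_apply_of_mem _ (by exact hs), hA1, Finsupp.sub_apply,
          hh _ (by simp only [Set.mem_Ico]; omega), sub_zero]
      · rw [onTimes_apply_of_notMem _ (by exact hs), Finsupp.neg_apply, hqlow s b (by omega),
          neg_zero]
    have hr' : onTimes (Set.Ici τ)ᶜ (adjAR Φ β₁) = -h := by
      ext ⟨s, b⟩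
      by_cases hs : τ ≤ s
      · rw [onTimes_apply_of_notMem _ (by simpa using hs), Finsupp.neg_apply,
          hh _ (by simp only [Set.mem_Ico]; omega), neg_zero]
      · rw [onTimes_apply_of_mem _ (by simpa using hs), hA1, Finsupp.sub_apply, Finsupp.neg_apply,
          hqlow s b (by omega), Finsupp.neg_apply]
        ring
    have b1 : sqSum h ≤ κ * sqSum β₁ := by
      rw [← sqSum_neg h, ← hr']
      exact (sqSum_onTimes_le _ _).trans (hΦ.upper _)
    have b2 : sqSum β₁ ≤ κ * sqSum q := by
      have := hΦ.lower τ β₁ (((hβ.onTimes _)).mono Set.Ico_subset_Ici_self)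
      rwa [hr, sqSum_neg] at this
    have b3 : sqSum q ≤ κ * sqSum w := (sqSum_onTimes_le _ _).trans (hΦ.upper _)
    calc sqSum h ≤ κ * sqSum β₁ := b1
      _ ≤ κ * (κ * sqSum q) := by gcongr
      _ ≤ κ * (κ * (κ * sqSum w)) := by gcongr
      _ = κ ^ 3 * sqSum w := by ring
  have hsum := Finset.sum_le_sum step
  rw [Finset.sum_const, Finset.card_range, nsmul_eq_mul, ← Finset.mul_sum] at hsum
  have hdisj : ((Finset.range k : Finset ℕ) : Set ℕ).PairwiseDisjoint
      fun j : ℕ => Set.Ico (τ' - ((j : ℤ) + 1) * d) (τ' - j * d) := by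
    have aux : ∀ i j : ℕ, i < j → Disjoint (Set.Ico (τ' - ((i : ℤ) + 1) * d) (τ' - i * d))
        (Set.Ico (τ' - ((j : ℤ) + 1) * d) (τ' - j * d)) := by
      intro i j hij
      rw [Set.disjoint_left]
      rintro t ⟨h1, _⟩ ⟨_, h4⟩
      have : ((i : ℤ) + 1) * d ≤ j * d := mul_le_mul_of_nonneg_right (by omega) (by positivity)
      omega
    intro i _ j _ hij
    rcases lt_or_gt_of_ne hij with hlt | hlt
    · exact aux i j hlt
    · exact (aux j i hlt).symm
  have := sum_sqSum_onTimes_le _ _ hdisj β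
  calc k * sqSum h ≤ κ ^ 3 * _ := hsum
    _ ≤ κ ^ 3 * sqSum β := by gcongr
    _ ≤ κ ^ 3 * (κ * sqSum g) := by gcongr
    _ = κ ^ 4 * sqSum g := by ring

end IsBoundedAR

end Coefficients

end BreakVAR

namespace BreakVAR

/-! ### Stationary and piecewise autoregressions in a Hilbert space -/

section Hilbert

variable {p d : ℕ} {H : Type*} [NormedAddCommGroup H] [InnerProductSpace ℝ H]
  {x ε y : ℤ × Fin p → H}

lemma LivesOn.sqSum_add {S S' : Set ℤ} {α β : Coef p} (hα : LivesOn S α) (hβ : LivesOn S' β)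
    (h : Disjoint S S') : sqSum (α + β) = sqSum α + sqSum β := by
  rw [← sqSum_onTimes_add_compl S (α + β)]
  congr 2
  · ext i
    rw [onTimes_apply, Finsupp.add_apply]
    split_ifs with hi
    · rw [hβ i fun h' => Set.disjoint_left.mp h hi h', add_zero]
    · rw [hα i hi]
  · ext i
    rw [onTimes_apply, Finsupp.add_apply]
    split_ifs with hi
    · rw [hα i hi, zero_add]
    · rw [hβ i fun h' => Set.disjoint_left.mp h (by simpa using hi) h']

/-- The linear combination of the `x i` with coefficients `α`. -/
abbrev comb (x : ℤ × Fin p → H) : Coef p →ₗ[ℝ] H := Finsupp.linearCombination ℝ x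

/-- `x` satisfies the autoregressive equation with coefficients `Φ` and innovations `ε` at the
times in `S`. -/
def SolvesAR (Φ : Fin d → Matrix (Fin p) (Fin p) ℝ) (S : Set ℤ) (x ε : ℤ × Fin p → H) : Prop :=
  ∀ i : ℤ × Fin p, i.1 ∈ S →
    x i = (∑ k : Fin d, ∑ b : Fin p, Φ k i.2 b • x (i.1 - ((k : ℤ) + 1), b)) + ε i

lemma comb_eq_sum_support (x : ℤ × Fin p → H) (α : Coef p) :
    comb x α = ∑ i ∈ α.support, α i • x i := by
  rw [comb, Finsupp.linearCombination_apply, Finsupp.sum]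

/-- Summation by parts moves the recursion onto the coefficients. Only the equations at times where
`β` is nonzero enter, so the identity can be used inside a single regime. -/
lemma SolvesAR.comb_adjAR {Φ : Fin d → Matrix (Fin p) (Fin p) ℝ} {S : Set ℤ}
    (h : SolvesAR Φ S x ε) {β : Coef p} (hβ : LivesOn S β) : comb x (adjAR Φ β) = comb ε β := by
  have hA : adjAR Φ β = ∑ i ∈ β.support, β i • adjAR Φ (Finsupp.single i 1) := by
    simp_rw [adjAR_single]
    rw [adjAR, Finsupp.linearCombination_apply, Finsupp.sum]
  rw [hA, comb_eq_sum_support ε, map_sum]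
  refine Finset.sum_congr rfl fun i hi => ?_
  have hiS : i.1 ∈ S := by
    by_contra h'; exact (Finsupp.mem_support_iff.mp hi) (hβ i h')
  rw [map_smul]
  congr 1
  rw [adjAR_single, map_sub, map_sum]
  simp_rw [map_sum, Finsupp.linearCombination_single, one_smul]
  conv_lhs => rw [h i hiS]
  abel

lemma inner_comb_eq_zero {u w : ℤ × Fin p → H} {α β : Coef p}
    (h : ∀ i ∈ α.support, ∀ j ∈ β.support, inner ℝ (u i) (w j) = 0) :
    inner ℝ (comb u α) (comb w β) = 0 := by
  rw [comb_eq_sum_support, comb_eq_sum_support, sum_inner]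
  refine Finset.sum_eq_zero fun i hi => ?_
  rw [inner_sum]
  refine Finset.sum_eq_zero fun j hj => ?_
  rw [inner_smul_left, inner_smul_right, h i hi j hj]; simp

lemma LivesOn.mem {S : Set ℤ} {α : Coef p} (h : LivesOn S α) {i : ℤ × Fin p}
    (hi : i ∈ α.support) : i.1 ∈ S := by
  by_contra h'; exact (Finsupp.mem_support_iff.mp hi) (h i h')

/-- A stationary autoregressive process in a Hilbert space, with spectrum in `[mf, Mf]`. -/
structure IsRieszAR (Φ : Fin d → Matrix (Fin p) (Fin p) ℝ) (x ε : ℤ × Fin p → H) (mf Mf : ℝ) :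
    Prop where
  solves : SolvesAR Φ Set.univ x ε
  orth : ∀ i j : ℤ × Fin p, j.1 < i.1 → inner ℝ (ε i) (x j) = 0
  lower : ∀ α, mf * sqSum α ≤ ‖comb x α‖ ^ 2
  upper : ∀ α, ‖comb x α‖ ^ 2 ≤ Mf * sqSum α

namespace IsRieszAR

variable {Φ : Fin d → Matrix (Fin p) (Fin p) ℝ} {mf Mf : ℝ} (h : IsRieszAR Φ x ε mf Mf)
include h

lemma comb_adjAR (β : Coef p) : comb x (adjAR Φ β) = comb ε β :=
  h.solves.comb_adjAR fun _ hi => absurd (Set.mem_univ _) hi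

lemma inner_innovation_eq_zero {i j : ℤ × Fin p} (hij : i.1 ≠ j.1) : inner ℝ (ε i) (ε j) = 0 := by
  have aux : ∀ i j : ℤ × Fin p, j.1 < i.1 → inner ℝ (ε i) (ε j) = 0 := by
    intro i j hij
    have := h.solves j (Set.mem_univ _)
    rw [← sub_eq_iff_eq_add'] at this
    rw [← this, inner_sub_right, h.orth i j hij, inner_sum]
    simp_rw [inner_sum, inner_smul_right]
    rw [Finset.sum_eq_zero, sub_zero]
    intro k _
    refine Finset.sum_eq_zero fun b _ => ?_
    rw [h.orth _ _ (by simp only; omega), mul_zero]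
  rcases lt_or_gt_of_ne hij with hlt | hlt
  · rw [real_inner_comm]; exact aux j i hlt
  · exact aux i j hlt

lemma inner_comb_innovation_past {τ : ℤ} {β α : Coef p} (hβ : LivesOn (Set.Ici τ) β)
    (hα : LivesOn (Set.Iio τ) α) : inner ℝ (comb ε β) (comb x α) = 0 :=
  inner_comb_eq_zero fun _ hi _ hj => h.orth _ _ (lt_of_lt_of_le (hα.mem hj) (hβ.mem hi))

/-- Upper bound: `x_t` is `ε_t` plus a combination of the past, which is orthogonal to `ε_t`. Lower
bound: `ε_t` is a combination of `x` whose coefficients at time `t` are still `β`. -/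
lemma innovation_bounds_of_livesOn_singleton (hmf : 0 ≤ mf) {t : ℤ} {β : Coef p}
    (hβ : LivesOn {t} β) :
    mf * sqSum β ≤ ‖comb ε β‖ ^ 2 ∧ ‖comb ε β‖ ^ 2 ≤ Mf * sqSum β := by
  have hrest : ∀ s b, t ≤ s → adjAR Φ β (s, b) = β (s, b) := by
    intro s b hs
    rw [adjAR_apply, sub_eq_self]
    refine Finset.sum_eq_zero fun k _ => Finset.sum_eq_zero fun a _ => ?_
    rw [hβ _ (by simp only [Set.mem_singleton_iff]; omega), mul_zero]
  constructor
  · rw [← h.comb_adjAR]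
    refine le_trans (mul_le_mul_of_nonneg_left ?_ hmf) (h.lower _)
    have : onTimes {t} (adjAR Φ β) = β := by
      ext ⟨s, b⟩
      by_cases hs : s = t
      · rw [onTimes_apply_of_mem _ (by simpa using hs), hrest s b hs.ge]
      · rw [onTimes_apply_of_notMem _ (by simpa using hs), hβ _ (by simpa using hs)]
    calc sqSum β = sqSum (onTimes {t} (adjAR Φ β)) := by rw [this]
      _ ≤ _ := sqSum_onTimes_le _ _
  · refine le_trans ?_ (h.upper β)
    have hsplit : comb x β = comb ε β + comb x (β - adjAR Φ β) := by
      rw [← h.comb_adjAR, ← map_add]; congr 1; abel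
    have horth : inner ℝ (comb ε β) (comb x (β - adjAR Φ β)) = 0 := by
      refine h.inner_comb_innovation_past (τ := t) (hβ.mono (by simp)) ?_
      rintro ⟨s, b⟩ hs
      rw [Finsupp.sub_apply, hrest s b (by simpa using hs), sub_self]
    rw [hsplit, norm_add_sq_real, horth]
    nlinarith [sq_nonneg ‖comb x (β - adjAR Φ β)‖]

lemma innovation_bounds (hmf : 0 ≤ mf) (β : Coef p) :
    mf * sqSum β ≤ ‖comb ε β‖ ^ 2 ∧ ‖comb ε β‖ ^ 2 ≤ Mf * sqSum β := by
  classical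
  have key : ∀ T : Finset ℤ, mf * sqSum (onTimes (T : Set ℤ) β) ≤ ‖comb ε (onTimes (T : Set ℤ) β)‖ ^ 2 ∧
      ‖comb ε (onTimes (T : Set ℤ) β)‖ ^ 2 ≤ Mf * sqSum (onTimes (T : Set ℤ) β) := by
    intro T
    induction T using Finset.induction_on with
    | empty =>
      have : onTimes ((∅ : Finset ℤ) : Set ℤ) β = 0 := by
        ext i; rw [onTimes_apply_of_notMem _ (by simp)]; rfl
      rw [this]; simp
    | insert t T ht ih =>
      have hadd : onTimes ((insert t T : Finset ℤ) : Set ℤ) β =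
          onTimes {t} β + onTimes (T : Set ℤ) β := by
        ext i
        simp only [onTimes_apply, Finsupp.add_apply, Finset.coe_insert, Set.mem_insert_iff,
          Set.mem_singleton_iff, Finset.mem_coe]
        by_cases hit : i.1 = t
        · simp [hit, ht]
        · simp [hit]
      obtain ⟨l1, u1⟩ := h.innovation_bounds_of_livesOn_singleton hmf (livesOn_onTimes {t} β)
      have horth : inner ℝ (comb ε (onTimes {t} β)) (comb ε (onTimes (T : Set ℤ) β)) = 0 := by
        refine inner_comb_eq_zero fun i hi j hj => h.inner_innovation_eq_zero ?_
        have h1 := (livesOn_onTimes {t} β).mem hi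
        have h2 := (livesOn_onTimes (T : Set ℤ) β).mem hj
        rintro hij
        rw [Set.mem_singleton_iff] at h1
        rw [← hij, h1] at h2
        exact ht h2
      rw [hadd, (livesOn_onTimes {t} β).sqSum_add (livesOn_onTimes (T : Set ℤ) β) (by simpa using ht),
        map_add, norm_add_sq_real, horth]
      constructor <;> linarith [ih.1, ih.2]
  have : onTimes ((β.support.image Prod.fst : Finset ℤ) : Set ℤ) β = β := by
    refine LivesOn.onTimes_eq fun i hi => ?_
    by_contra h'
    exact hi (by simpa using ⟨i.2, h'⟩)
  simpa only [this] using key (β.support.image Prod.fst)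

/-- The array `adjAR Φ β` represents `comb ε β` in terms of `x`, so the two-sided bounds for `x` and
`ε` compare its norm with that of `β`. For the lower bound, cutting it off at `τ` subtracts a
combination of `x` before `τ`; this is orthogonal to the innovations from `τ` on, so the norm cannot
drop. -/
lemma isBoundedAR (hmf : 0 < mf) (hMf : 0 < Mf) : IsBoundedAR Φ (Mf / mf) where
  pos := div_pos hMf hmf
  upper β := by
    rw [div_mul_eq_mul_div, le_div_iff₀ hmf, mul_comm]
    refine (h.lower _).trans ?_
    rw [h.comb_adjAR]
    exact (h.innovation_bounds hmf.le β).2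
  lower τ β hβ := by
    rw [div_mul_eq_mul_div, le_div_iff₀ hmf, mul_comm]
    refine (h.innovation_bounds hmf.le β).1.trans (le_trans ?_ (h.upper _))
    have hsplit : comb x (onTimes (Set.Ici τ) (adjAR Φ β)) =
        comb ε β - comb x (onTimes (Set.Ici τ)ᶜ (adjAR Φ β)) := by
      rw [← h.comb_adjAR, ← map_sub]; congr 1
      rw [eq_sub_iff_add_eq]; exact onTimes_add_onTimes_compl _ _
    have horth : inner ℝ (comb ε β) (comb x (onTimes (Set.Ici τ)ᶜ (adjAR Φ β))) = 0 := by
      refine h.inner_comb_innovation_past hβ ?_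
      simpa using livesOn_onTimes (Set.Ici τ)ᶜ (adjAR Φ β)
    rw [hsplit, norm_sub_sq_real, horth]
    nlinarith [sq_nonneg ‖comb x (onTimes (Set.Ici τ)ᶜ (adjAR Φ β))‖]

end IsRieszAR

/-- A bounded autoregressive operator has no unit root at frequency zero. -/
lemma IsBoundedAR.eq_zero_of_fixed {Φ : Fin d → Matrix (Fin p) (Fin p) ℝ} {κ : ℝ}
    (hΦ : IsBoundedAR Φ κ) {μ : Fin p → ℝ} (hμ : ∀ a, μ a = ∑ k : Fin d, ∑ b, Φ k a b * μ b) :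
    μ = 0 := by
  classical
  by_contra hne
  set q : ℝ := ∑ a, μ a ^ 2 with hq
  have hqpos : 0 < q := by
    obtain ⟨a, ha⟩ := Function.ne_iff.mp hne
    exact Finset.sum_pos' (fun _ _ => sq_nonneg _) ⟨a, Finset.mem_univ _, by
      have : μ a ≠ 0 := ha
      positivity⟩
  have hsol : SolvesAR Φ Set.univ (fun i : ℤ × Fin p => μ i.2) (fun _ => (0 : ℝ)) := by
    intro i _
    simpa using hμ i.2
  -- The constant sequence `μ` solves the homogeneous recursion, so pairing with it annihilates
  -- `adjAR Φ β`. The pairing `N q` of `μ` with its own restriction to `[0, N)` is then carried by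
  -- `h`, which lives on only `d` times. Cauchy–Schwarz and `sqSum h ≤ κ² N q` bound `N`.
  have key : ∀ N : ℕ, (N : ℝ) ≤ κ ^ 2 * d := by
    intro N
    rcases Nat.eq_zero_or_pos N with rfl | hN
    · have := hΦ.pos; simpa using by positivity
    let α : Coef p := Finsupp.indicator (Finset.Ico (0 : ℤ) N ×ˢ Finset.univ) fun i _ => μ i.2
    have hαval : ∀ i ∈ Finset.Ico (0 : ℤ) N ×ˢ (Finset.univ : Finset (Fin p)), α i = μ i.2 :=
      fun i hi => Finsupp.indicator_of_mem hi _
    have hαsupp : α.support ⊆ Finset.Ico (0 : ℤ) N ×ˢ Finset.univ := Finsupp.support_indicator_subset _ _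
    have hα : LivesOn (Set.Ico 0 (N : ℤ)) α := fun i hi =>
      Finsupp.indicator_of_notMem (by simpa using hi) _
    have hαsq : sqSum α = N * q := by
      rw [sqSum_eq_sum hαsupp, Finset.sum_congr rfl fun i hi => by rw [hαval i hi],
        Finset.sum_product]
      simp [hq]
    have hαcomb : comb (fun i : ℤ × Fin p => μ i.2) α = N * q := by
      rw [comb, Finsupp.linearCombination_apply, Finsupp.sum_of_support_subset _ hαsupp _ (by simp),
        Finset.sum_congr rfl fun i hi => by rw [hαval i hi], Finset.sum_product]
      simp [hq, pow_two]
    obtain ⟨β, h, hβ, hh, hdec, b1, b2⟩ := hΦ.exists_decomposition hα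
    have hcomb : comb (fun i : ℤ × Fin p => μ i.2) h = N * q := by
      have h0 : comb (fun i : ℤ × Fin p => μ i.2) (adjAR Φ β) = 0 := by
        rw [hsol.comb_adjAR fun _ hi => absurd (Set.mem_univ _) hi]
        simp [comb_eq_sum_support]
      rw [← hαcomb, hdec, map_add, h0, zero_add]
    have hhsupp : h.support ⊆ Finset.Ico (0 - d : ℤ) 0 ×ˢ Finset.univ := by
      intro i hi; simpa using hh.mem hi
    have hCS : (N * q) ^ 2 ≤ sqSum h * (d * q) := by
      rw [← hcomb, comb, Finsupp.linearCombination_apply,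
        Finsupp.sum_of_support_subset _ hhsupp _ (by simp), sqSum_eq_sum hhsupp]
      refine (Finset.sum_mul_sq_le_sq_mul_sq _ _ _).trans (le_of_eq ?_)
      congr 1
      rw [Finset.sum_product]
      simp [hq]
    have hκ := hΦ.pos
    have hh2 : sqSum h ≤ κ ^ 2 * (N * q) := by
      calc sqSum h ≤ κ * sqSum β := b2
        _ ≤ κ * (κ * sqSum α) := by gcongr
        _ = _ := by rw [hαsq]; ring
    have h3 : (N * q) ^ 2 ≤ κ ^ 2 * (N * q) * (d * q) := hCS.trans (by gcongr)
    have hNpos : (0 : ℝ) < N := by exact_mod_cast hN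
    have hpos : 0 < N * q ^ 2 := by positivity
    refine le_of_mul_le_mul_right ?_ hpos
    nlinarith
  obtain ⟨N, hN⟩ := exists_nat_gt (κ ^ 2 * d)
  exact absurd (key N) (not_le.mpr hN)

/-- The bound on the variances of linear combinations of a piecewise autoregressive series. -/
def pieceBound (Mf κ : ℝ) : ℝ :=
  2 * Mf * κ + 2 * Mf + 2 * κ ^ 2 * (4 * Mf * κ + 2 * Mf)

/-- The coefficients are swept backwards through the segments. Each segment turns its own
coefficients into innovations, which are orthogonal to everything earlier, and hands an array on `d`
times to the segment before it. -/
theorem norm_comb_sq_le_pieceBound {m₀ k : ℕ} {brk : Fin (m₀ + 2) → ℕ} (hbrk : brk 0 = 0)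
    {Φ : Fin (m₀ + 1) → Fin d → Matrix (Fin p) (Fin p) ℝ} {κ Mf : ℝ} (hMf : 0 < Mf)
    (hΦ : ∀ j, IsBoundedAR (Φ j) κ) (hk : 4 * κ ^ 4 ≤ k) (hk0 : 0 < k)
    (hlong : ∀ j : Fin (m₀ + 1), brk j.castSucc + (k + 1) * d ≤ brk j.succ)
    (hy : ∀ j : Fin (m₀ + 1), SolvesAR (Φ j) (Set.Ico (brk j.castSucc : ℤ) (brk j.succ)) y ε)
    (hε : ∀ β, ‖comb ε β‖ ^ 2 ≤ Mf * sqSum β)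
    (horth : ∀ i j : ℤ × Fin p, 0 ≤ i.1 → i.1 < brk (Fin.last _) → j.1 < i.1 →
      inner ℝ (ε i) (y j) = 0)
    (hbrk' : Monotone brk)
    (hpast : ∀ α, LivesOn (Set.Iio 0) α → ‖comb y α‖ ^ 2 ≤ Mf * sqSum α)
    (α : Coef p) (hα : LivesOn (Set.Iio (brk (Fin.last _) : ℤ)) α) :
    ‖comb y α‖ ^ 2 ≤ pieceBound Mf κ * sqSum α := by
  have hκ := (hΦ 0).pos
  set K₂ : ℝ := 4 * Mf * κ + 2 * Mf with hK₂
  have hK₂pos : 0 < K₂ := by positivity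
  -- The array `g` is what the later segments hand down. It gets a constant `K₂` of its own, because
  -- the bound for it has to reproduce itself from one segment to the next.
  have key : ∀ (j : Fin (m₀ + 2)) (α g : Coef p), LivesOn (Set.Iio (brk j : ℤ)) α →
      LivesOn (Set.Ico (brk j - d : ℤ) (brk j)) g →
      ‖comb y (α + g)‖ ^ 2 ≤ pieceBound Mf κ * sqSum α + K₂ * sqSum g := by
    intro j
    induction j using Fin.induction with
    | zero =>
      intro α g hα hg
      rw [hbrk] at hα hg
      refine (hpast _ (hα.add (hg.mono fun t ht => ht.2))).trans ?_
      have h1 := mul_le_mul_of_nonneg_left (sqSum_add_le α g) hMf.le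
      have h2 := sqSum_nonneg α
      have h3 := sqSum_nonneg g
      have h4 : 2 * Mf ≤ pieceBound Mf κ := by
        have : 0 ≤ 2 * Mf * κ := by positivity
        have : 0 ≤ 2 * κ ^ 2 * (4 * Mf * κ + 2 * Mf) := by positivity
        rw [pieceBound]; linarith
      have h5 : 2 * Mf ≤ K₂ := by
        have : 0 ≤ 4 * Mf * κ := by positivity
        rw [hK₂]; linarith
      nlinarith
    | succ j ih =>
      intro α g hα hg
      set τ : ℤ := (brk j.castSucc : ℤ) with hτ
      set τ' : ℤ := (brk j.succ : ℤ) with hτ'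
      have hlen : τ + (k + 1) * d ≤ τ' := by rw [hτ, hτ']; exact_mod_cast hlong j
      have hd : τ ≤ τ' - d := by
        have : (0 : ℤ) ≤ k * d := by positivity
        linarith
      set α₁ := onTimes (Set.Iio τ) α with hα₁
      set α₂ := onTimes (Set.Iio τ)ᶜ α with hα₂
      have hsplit : α₁ + α₂ = α := onTimes_add_onTimes_compl _ _
      have hα₂' : LivesOn (Set.Ico τ τ') α₂ := by
        intro i hi
        rw [hα₂, onTimes_apply]
        split_ifs with h
        · refine hα i ?_
          simp only [Set.mem_compl_iff, Set.mem_Iio, Set.mem_Ico] at hi h ⊢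
          omega
        · rfl
      obtain ⟨β₁, h₁, hβ₁, hh₁, e₁, b₁, c₁⟩ := (hΦ j).exists_decomposition hα₂'
      obtain ⟨β₂, h₂, hβ₂, hh₂, e₂, b₂, c₂⟩ := (hΦ j).exists_decomposition
        (hg.mono (Set.Ico_subset_Ico_left hd))
      have hlongbd := (hΦ j).sqSum_le_of_long hlen hg hβ₂ hh₂ e₂ b₂
      -- The requirement `4 κ⁴ ≤ k` enters here. The quarter becomes a half when `h₂` is added to
      -- `h₁`, and this half leaves room for the new innovations.
      have hdecay : sqSum h₂ ≤ sqSum g / 4 := by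
        have hk0' : (0 : ℝ) < k := by exact_mod_cast hk0
        have := mul_le_mul_of_nonneg_right hk (sqSum_nonneg g)
        refine le_of_mul_le_mul_left ?_ hk0'
        linarith
      have hc : comb y (α + g) = comb ε (β₁ + β₂) + comb y (α₁ + (h₁ + h₂)) := by
        rw [← (hy j).comb_adjAR (hβ₁.add hβ₂), ← map_add]
        congr 1
        rw [← hsplit, map_add]
        nth_rw 1 [e₁, e₂]
        abel
      have ho : inner ℝ (comb ε (β₁ + β₂)) (comb y (α₁ + (h₁ + h₂))) = 0 := by
        refine inner_comb_eq_zero fun i hi l hl => horth i l ?_ ?_ ?_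
        · have := ((hβ₁.add hβ₂).mem hi).1
          omega
        · have h1 := ((hβ₁.add hβ₂).mem hi).2
          have h2 : brk j.succ ≤ brk (Fin.last _) := hbrk' (Fin.le_last _)
          omega
        · have h1 := ((hβ₁.add hβ₂).mem hi).1
          have h2 : LivesOn (Set.Iio τ) (α₁ + (h₁ + h₂)) :=
            (livesOn_onTimes _ _).add ((hh₁.add hh₂).mono fun t ht => ht.2)
          have h3 : l.1 < τ := h2.mem hl
          omega
      have hN : sqSum α = sqSum α₁ + sqSum α₂ := (sqSum_onTimes_add_compl _ _).symm
      have ihb := ih α₁ (h₁ + h₂) (livesOn_onTimes _ _) (hh₁.add hh₂)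
      have hβbd : sqSum (β₁ + β₂) ≤ 2 * κ * (sqSum α₂ + sqSum g) := by
        refine (sqSum_add_le _ _).trans ?_
        nlinarith
      have hhbd : sqSum (h₁ + h₂) ≤ 2 * κ ^ 2 * sqSum α₂ + sqSum g / 2 := by
        refine (sqSum_add_le _ _).trans ?_
        have : sqSum h₁ ≤ κ * (κ * sqSum α₂) := c₁.trans (by gcongr)
        nlinarith
      have hεbd := (hε (β₁ + β₂)).trans (mul_le_mul_of_nonneg_left hβbd hMf.le)
      have hhbd' := mul_le_mul_of_nonneg_left hhbd hK₂pos.le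
      rw [hc, norm_add_sq_real, ho, hN, mul_add (pieceBound Mf κ)]
      have hα₂n := sqSum_nonneg α₂
      have hgn := sqSum_nonneg g
      -- `K₂` is chosen so that the innovations use at most `K₂ / 2` of the allowance for `g`, and
      -- the array handed back uses the other half. In `pieceBound` the term `2 Mf κ` pays for the
      -- innovations of `α₂`, the term `2 κ² K₂` for what `α₂` hands back, and `2 Mf` for the base
      -- case.
      have f1 : Mf * (2 * κ * (sqSum α₂ + sqSum g)) + K₂ * (2 * κ ^ 2 * sqSum α₂ + sqSum g / 2) ≤
          pieceBound Mf κ * sqSum α₂ + K₂ * sqSum g := by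
        rw [pieceBound, ← hK₂]
        have g1 : 0 ≤ Mf * sqSum α₂ := by positivity
        have g2 : (2 * Mf * κ) * sqSum g ≤ K₂ / 2 * sqSum g := by
          refine mul_le_mul_of_nonneg_right ?_ hgn
          rw [hK₂]; linarith
        linarith
      linarith
  have := key (Fin.last _) α 0 hα (fun _ _ => rfl)
  simpa using this

/-- Every time before the last break point and not before the first one is in some regime. -/
lemma exists_regime {m₀ : ℕ} {brk : Fin (m₀ + 2) → ℕ} (h0 : brk 0 = 0) {t : ℕ}
    (ht : t < brk (Fin.last _)) :
    ∃ j : Fin (m₀ + 1), brk j.castSucc ≤ t ∧ t < brk j.succ := by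
  by_contra hcon
  push Not at hcon
  have : ∀ j : Fin (m₀ + 2), brk j ≤ t := by
    intro j
    induction j using Fin.induction with
    | zero => omega
    | succ j ih => exact hcon j ih
  exact absurd (this (Fin.last _)) (not_le.mpr ht)

end Hilbert

end BreakVAR

namespace BreakVAR

/-! ### Spectral densities and quadratic forms of autocovariances -/

section Spectral

open scoped MatrixOrder ComplexOrder

variable {p : ℕ}

lemma isSelfAdjoint_of_isHermitian {A : Matrix (Fin p) (Fin p) ℂ} (hA : A.IsHermitian) :
    IsSelfAdjoint A := hA

lemma finite_spectrum_real {A : Matrix (Fin p) (Fin p) ℂ} (hA : A.IsHermitian) :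
    (spectrum ℝ A).Finite := by
  rw [hA.spectrum_real_eq_range_eigenvalues]; exact Set.finite_range _

lemma eigMin_mul_le {A : Matrix (Fin p) (Fin p) ℂ} (hA : A.IsHermitian) {c : ℝ} (hc : c ≤ eigMin A)
    (v : Fin p → ℂ) : c * (star v ⬝ᵥ v).re ≤ (star v ⬝ᵥ A *ᵥ v).re := by
  have h1 : algebraMap ℝ (Matrix (Fin p) (Fin p) ℂ) c ≤ A :=
    algebraMap_le_of_le_spectrum (fun x hx => hc.trans (csInf_le (finite_spectrum_real hA).bddBelow hx))
      (isSelfAdjoint_of_isHermitian hA)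
  have h2 := (Matrix.le_iff.mp h1).dotProduct_mulVec_nonneg v
  have h3 := (Complex.le_def.mp h2).1
  rw [Matrix.sub_mulVec, dotProduct_sub, Complex.sub_re, Algebra.algebraMap_eq_smul_one,
    Matrix.smul_mulVec, Matrix.one_mulVec, dotProduct_smul, Complex.smul_re] at h3
  simp only [Complex.zero_re, smul_eq_mul] at h3
  linarith

lemma le_eigMax_mul {A : Matrix (Fin p) (Fin p) ℂ} (hA : A.IsHermitian) {c : ℝ} (hc : eigMax A ≤ c)
    (v : Fin p → ℂ) : (star v ⬝ᵥ A *ᵥ v).re ≤ c * (star v ⬝ᵥ v).re := by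
  have h1 : A ≤ algebraMap ℝ (Matrix (Fin p) (Fin p) ℂ) c :=
    le_algebraMap_of_spectrum_le (fun x hx => (le_csSup (finite_spectrum_real hA).bddAbove hx).trans hc)
      (isSelfAdjoint_of_isHermitian hA)
  have h2 := (Matrix.le_iff.mp h1).dotProduct_mulVec_nonneg v
  have h3 := (Complex.le_def.mp h2).1
  rw [Matrix.sub_mulVec, dotProduct_sub, Complex.sub_re, Algebra.algebraMap_eq_smul_one,
    Matrix.smul_mulVec, Matrix.one_mulVec, dotProduct_smul, Complex.smul_re] at h3
  simp only [Complex.zero_re, smul_eq_mul] at h3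
  linarith

lemma integral_exp_int (k : ℤ) :
    ∫ θ in -Real.pi..Real.pi, Complex.exp (Complex.I * k * θ) =
      if k = 0 then 2 * (Real.pi : ℂ) else 0 := by
  split_ifs with hk
  · subst hk
    simp
    ring
  · have hne : Complex.I * (k : ℂ) ≠ 0 := mul_ne_zero Complex.I_ne_zero (by exact_mod_cast hk)
    rw [integral_exp_mul_complex hne]
    have : Complex.exp (Complex.I * k * (Real.pi : ℝ)) =
        Complex.exp (Complex.I * k * ((-Real.pi : ℝ) : ℂ)) := by
      rw [Complex.exp_eq_exp_iff_exists_int]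
      exact ⟨k, by push_cast; ring⟩
    rw [this]; simp

/-- The Fourier series `∑ c_l e^{-ilθ}`. -/
lemma continuous_fourierSeries {c : ℤ → ℝ} (hc : Summable c) :
    Continuous fun θ : ℝ => ∑' l : ℤ, (c l : ℂ) * Complex.exp (-Complex.I * l * θ) := by
  refine continuous_tsum (fun l => by fun_prop) hc.abs fun l θ => ?_
  rw [norm_mul, Complex.norm_real, Real.norm_eq_abs]
  have : -Complex.I * (l : ℂ) * (θ : ℂ) = ((-(l * θ) : ℝ) : ℂ) * Complex.I := by push_cast; ring
  rw [this, Complex.norm_exp_ofReal_mul_I, mul_one]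

lemma integral_exp_mul_fourierSeries {c : ℤ → ℝ} (hc : Summable c) (h : ℤ) :
    ∫ θ in -Real.pi..Real.pi, Complex.exp (Complex.I * h * θ) *
      ∑' l : ℤ, (c l : ℂ) * Complex.exp (-Complex.I * l * θ) = 2 * Real.pi * c h := by
  let f : ℤ → C(ℝ, ℂ) := fun l =>
    ⟨fun θ => (c l : ℂ) * Complex.exp (Complex.I * (h - l : ℤ) * θ), by fun_prop⟩
  have hf : ∀ l (θ : ℝ), ‖f l θ‖ = |c l| := by
    intro l θ
    simp only [f, ContinuousMap.coe_mk, norm_mul, Complex.norm_real, Real.norm_eq_abs]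
    have : Complex.I * ((h - l : ℤ) : ℂ) * (θ : ℂ) = (((h - l : ℤ) * θ : ℝ) : ℂ) * Complex.I := by
      push_cast; ring
    rw [this, Complex.norm_exp_ofReal_mul_I, mul_one]
  have hsum : Summable fun l => ‖(f l).restrict
      (⟨Set.uIcc (-Real.pi) Real.pi, isCompact_uIcc⟩ : TopologicalSpace.Compacts ℝ)‖ := by
    refine Summable.of_nonneg_of_le (fun _ => norm_nonneg _) (fun l => ?_) hc.abs
    rw [ContinuousMap.norm_le _ (abs_nonneg _)]
    intro θ
    exact (hf l θ).le
  have h1 := (intervalIntegral.hasSum_intervalIntegral_of_summable_norm hsum).tsum_eq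
  have h2 : ∀ θ : ℝ, Complex.exp (Complex.I * h * θ) *
      ∑' l : ℤ, (c l : ℂ) * Complex.exp (-Complex.I * l * θ) = ∑' l, f l θ := by
    intro θ
    rw [← tsum_mul_left]
    refine tsum_congr fun l => ?_
    simp only [f, ContinuousMap.coe_mk]
    rw [mul_left_comm, ← Complex.exp_add]
    congr 2; push_cast; ring
  simp_rw [h2]
  rw [← h1]
  have h3 : ∀ l, ∫ θ in -Real.pi..Real.pi, f l θ =
      if l = h then 2 * (Real.pi : ℂ) * c h else 0 := by
    intro l
    simp only [f, ContinuousMap.coe_mk]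
    rw [intervalIntegral.integral_const_mul, integral_exp_int]
    by_cases hl : l = h
    · subst hl; simp; ring
    · have : ¬ h - l = 0 := fun h' => hl (by omega)
      simp [this, hl]
  simp_rw [h3]
  exact tsum_ite_eq h fun _ => 2 * (Real.pi : ℂ) * c h

/-- The trigonometric polynomial with coefficients `α`. -/
def trigPoly (α : Coef p) (θ : ℝ) (a : Fin p) : ℂ :=
  ∑ i ∈ α.support, if i.2 = a then (α i : ℂ) * Complex.exp (Complex.I * i.1 * θ) else 0

/-- In the form of a trigonometric polynomial the pair `(i, j)` carries the frequency `j.1 - i.1`.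
Integration against the spectral density therefore picks out the autocovariance at exactly that lag.
-/
lemma star_trigPoly_dotProduct (α : Coef p) (θ : ℝ) (A : Matrix (Fin p) (Fin p) ℂ) :
    star (trigPoly α θ) ⬝ᵥ A *ᵥ trigPoly α θ = ∑ i ∈ α.support, ∑ j ∈ α.support,
      ((α i * α j : ℝ) : ℂ) * (Complex.exp (Complex.I * (j.1 - i.1 : ℤ) * θ) * A i.2 j.2) := by
  have h1 : ∀ a, (A *ᵥ trigPoly α θ) a =
      ∑ j ∈ α.support, A a j.2 * ((α j : ℂ) * Complex.exp (Complex.I * j.1 * θ)) := by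
    intro a
    simp only [Matrix.mulVec, dotProduct, trigPoly, Finset.mul_sum]
    rw [Finset.sum_comm]
    refine Finset.sum_congr rfl fun j _ => ?_
    simp
  have h2 : ∀ u : Fin p → ℂ, star (trigPoly α θ) ⬝ᵥ u =
      ∑ i ∈ α.support, (α i : ℂ) * Complex.exp (-(Complex.I * i.1 * θ)) * u i.2 := by
    intro u
    simp only [dotProduct, Pi.star_apply, trigPoly, star_sum, Finset.sum_mul]
    rw [Finset.sum_comm]
    refine Finset.sum_congr rfl fun j _ => ?_
    rw [Finset.sum_eq_single j.2]
    · simp [← Complex.exp_conj]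
    · intro b _ hb; rw [if_neg hb.symm]; simp
    · simp
  rw [h2]
  refine Finset.sum_congr rfl fun i _ => ?_
  rw [h1, Finset.mul_sum]
  refine Finset.sum_congr rfl fun j _ => ?_
  have : Complex.exp (Complex.I * (j.1 - i.1 : ℤ) * θ) =
      Complex.exp (-(Complex.I * i.1 * θ)) * Complex.exp (Complex.I * j.1 * θ) := by
    rw [← Complex.exp_add]; congr 1; push_cast; ring
  rw [this]; push_cast; ring

lemma integral_star_trigPoly_dotProduct_self (α : Coef p) :
    ∫ θ in -Real.pi..Real.pi, (star (trigPoly α θ) ⬝ᵥ trigPoly α θ).re =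
      2 * Real.pi * sqSum α := by
  have h0 : ∀ θ, star (trigPoly α θ) ⬝ᵥ trigPoly α θ = ∑ i ∈ α.support, ∑ j ∈ α.support,
      ((α i * α j : ℝ) : ℂ) * (Complex.exp (Complex.I * (j.1 - i.1 : ℤ) * θ) *
        (1 : Matrix (Fin p) (Fin p) ℂ) i.2 j.2) := by
    intro θ
    rw [← star_trigPoly_dotProduct, Matrix.one_mulVec]
  have hcont : Continuous fun θ : ℝ => star (trigPoly α θ) ⬝ᵥ trigPoly α θ := by
    simp_rw [h0]; fun_prop
  have h1 := Complex.reCLM.intervalIntegral_comp_comm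
    (hcont.intervalIntegrable (μ := volume) (-Real.pi) Real.pi)
  simp only [Complex.reCLM_apply] at h1
  rw [h1]
  have h2 : ∫ θ in -Real.pi..Real.pi, star (trigPoly α θ) ⬝ᵥ trigPoly α θ =
      ((2 * Real.pi * sqSum α : ℝ) : ℂ) := by
    simp_rw [h0]
    rw [intervalIntegral.integral_finsetSum]
    swap
    · intro i _; apply Continuous.intervalIntegrable; fun_prop
    rw [sqSum, Finset.mul_sum, Complex.ofReal_sum]
    refine Finset.sum_congr rfl fun i hi => ?_
    rw [intervalIntegral.integral_finsetSum]
    swap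
    · intro i _; apply Continuous.intervalIntegrable; fun_prop
    rw [Finset.sum_eq_single_of_mem i hi]
    · rw [intervalIntegral.integral_const_mul, intervalIntegral.integral_mul_const,
        integral_exp_int]
      simp; ring
    · intro j _ hji
      rw [intervalIntegral.integral_const_mul, intervalIntegral.integral_mul_const,
        integral_exp_int]
      by_cases h : j.1 - i.1 = 0
      · have : i.2 ≠ j.2 := fun h2 => hji (Prod.ext (by omega) h2.symm)
        rw [Matrix.one_apply_ne this]; simp
      · rw [if_neg h]; simp
  rw [h2, Complex.ofReal_re]

/-- The spectral density matrix of an autocovariance sequence. -/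
def specMat (Γ : ℤ → Matrix (Fin p) (Fin p) ℝ) (θ : ℝ) : Matrix (Fin p) (Fin p) ℂ :=
  Matrix.of fun a b => (1 / (2 * (Real.pi : ℂ))) *
    ∑' l : ℤ, (Γ l a b : ℂ) * Complex.exp (-Complex.I * (l : ℂ) * (θ : ℂ))

variable {Γ : ℤ → Matrix (Fin p) (Fin p) ℝ}

lemma isHermitian_specMat (hΓ : ∀ l, Γ (-l) = (Γ l)ᵀ) (θ : ℝ) : (specMat Γ θ).IsHermitian := by
  ext a b
  simp only [specMat, Matrix.conjTranspose_apply, Matrix.of_apply, star_mul']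
  congr 1
  · simp
  · change (starRingEnd ℂ) _ = _
    rw [Complex.conj_tsum, ← (Equiv.neg ℤ).tsum_eq]
    refine tsum_congr fun l => ?_
    rw [Equiv.neg_apply, hΓ, map_mul, ← Complex.exp_conj]
    simp

lemma continuous_specMat (hsum : ∀ a b, Summable fun l => Γ l a b) (a b : Fin p) :
    Continuous fun θ => specMat Γ θ a b := by
  simp only [specMat, Matrix.of_apply]
  exact continuous_const.mul (continuous_fourierSeries (hsum a b))

/-- Fourier inversion, term by term: the autocovariances are summable, so the series can be
integrated termwise. The factor `1 / 2π` of the density cancels the length of the interval. -/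
lemma integral_star_trigPoly_specMat (hsum : ∀ a b, Summable fun l => Γ l a b) (α : Coef p) :
    ∫ θ in -Real.pi..Real.pi, (star (trigPoly α θ) ⬝ᵥ specMat Γ θ *ᵥ trigPoly α θ).re =
      ∑ i ∈ α.support, ∑ j ∈ α.support, α i * α j * Γ (j.1 - i.1) i.2 j.2 := by
  have hc := continuous_specMat hsum
  have hcont : Continuous fun θ : ℝ => star (trigPoly α θ) ⬝ᵥ specMat Γ θ *ᵥ trigPoly α θ := by
    simp_rw [star_trigPoly_dotProduct]
    fun_prop
  have h1 := Complex.reCLM.intervalIntegral_comp_comm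
    (hcont.intervalIntegrable (μ := volume) (-Real.pi) Real.pi)
  simp only [Complex.reCLM_apply] at h1
  rw [h1]
  have h2 : ∫ θ in -Real.pi..Real.pi, star (trigPoly α θ) ⬝ᵥ specMat Γ θ *ᵥ trigPoly α θ =
      ((∑ i ∈ α.support, ∑ j ∈ α.support, α i * α j * Γ (j.1 - i.1) i.2 j.2 : ℝ) : ℂ) := by
    simp_rw [star_trigPoly_dotProduct]
    rw [intervalIntegral.integral_finsetSum]
    swap
    · intro i _; apply Continuous.intervalIntegrable; fun_prop
    rw [Complex.ofReal_sum]
    refine Finset.sum_congr rfl fun i hi => ?_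
    rw [intervalIntegral.integral_finsetSum]
    swap
    · intro i _; apply Continuous.intervalIntegrable; fun_prop
    rw [Complex.ofReal_sum]
    refine Finset.sum_congr rfl fun j hj => ?_
    rw [intervalIntegral.integral_const_mul]
    have h3 : ∀ θ : ℝ, Complex.exp (Complex.I * (j.1 - i.1 : ℤ) * θ) * specMat Γ θ i.2 j.2 =
        (1 / (2 * (Real.pi : ℂ))) * (Complex.exp (Complex.I * (j.1 - i.1 : ℤ) * θ) *
          ∑' l : ℤ, (Γ l i.2 j.2 : ℂ) * Complex.exp (-Complex.I * (l : ℂ) * (θ : ℂ))) := by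
      intro θ; simp only [specMat, Matrix.of_apply]; ring
    simp_rw [h3]
    rw [intervalIntegral.integral_const_mul, integral_exp_mul_fourierSeries (hsum _ _)]
    have hpi : (Real.pi : ℂ) ≠ 0 := by exact_mod_cast Real.pi_ne_zero
    push_cast
    field_simp
  rw [h2, Complex.ofReal_re]

/-- The quadratic form of the autocovariances lies between the bounds of the spectrum. -/
lemma quadForm_autocov_bounds (hΓ : ∀ l, Γ (-l) = (Γ l)ᵀ)
    (hsum : ∀ a b, Summable fun l => Γ l a b) {mf Mf : ℝ}
    (hmin : ∀ᵐ θ ∂(volume.restrict (Set.Icc (-Real.pi) Real.pi)), mf ≤ eigMin (specMat Γ θ))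
    (hmax : ∀ᵐ θ ∂(volume.restrict (Set.Icc (-Real.pi) Real.pi)), eigMax (specMat Γ θ) ≤ Mf)
    (α : Coef p) :
    2 * Real.pi * mf * sqSum α ≤
        ∑ i ∈ α.support, ∑ j ∈ α.support, α i * α j * Γ (j.1 - i.1) i.2 j.2 ∧
      ∑ i ∈ α.support, ∑ j ∈ α.support, α i * α j * Γ (j.1 - i.1) i.2 j.2 ≤
        2 * Real.pi * Mf * sqSum α := by
  have hc := continuous_specMat hsum
  have hcont : Continuous fun θ : ℝ =>
      (star (trigPoly α θ) ⬝ᵥ specMat Γ θ *ᵥ trigPoly α θ).re := by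
    refine Complex.continuous_re.comp ?_
    simp_rw [star_trigPoly_dotProduct]
    fun_prop
  have hcont' : Continuous fun θ : ℝ => (star (trigPoly α θ) ⬝ᵥ trigPoly α θ).re := by
    refine Complex.continuous_re.comp ?_
    have : ∀ θ, star (trigPoly α θ) ⬝ᵥ trigPoly α θ =
        star (trigPoly α θ) ⬝ᵥ (1 : Matrix (Fin p) (Fin p) ℂ) *ᵥ trigPoly α θ := by
      intro θ; rw [Matrix.one_mulVec]
    simp_rw [this, star_trigPoly_dotProduct]
    fun_prop
  have hpi : -Real.pi ≤ Real.pi := by linarith [Real.pi_pos]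
  rw [← integral_star_trigPoly_specMat hsum]
  have key : ∀ c : ℝ, 2 * Real.pi * c * sqSum α =
      ∫ θ in -Real.pi..Real.pi, c * (star (trigPoly α θ) ⬝ᵥ trigPoly α θ).re := by
    intro c
    rw [intervalIntegral.integral_const_mul, integral_star_trigPoly_dotProduct_self]; ring
  rw [key, key]
  constructor
  · refine intervalIntegral.integral_mono_ae_restrict hpi
      ((continuous_const.mul hcont').intervalIntegrable _ _) (hcont.intervalIntegrable _ _) ?_
    filter_upwards [hmin] with θ hθ
    exact eigMin_mul_le (isHermitian_specMat hΓ θ) hθ _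
  · refine intervalIntegral.integral_mono_ae_restrict hpi (hcont.intervalIntegrable _ _)
      ((continuous_const.mul hcont').intervalIntegrable _ _) ?_
    filter_upwards [hmax] with θ hθ
    exact le_eigMax_mul (isHermitian_specMat hΓ θ) hθ _

end Spectral

end BreakVAR

namespace BreakVAR

/-! ### Gaussian vector autoregressions as vectors of L² -/

section L2

variable {Ω : Type u} [MeasurableSpace Ω] {P : Measure Ω} {p d : ℕ}

/-- A family of square-integrable random variables as vectors of `L²`. -/
def lpVec {ι : Type*} (f : ι → Ω → ℝ) (hf : ∀ i, MemLp (f i) 2 P) (i : ι) : Lp ℝ 2 P :=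
  (hf i).toLp (f i)

lemma coeFn_sum_smul_lpVec {ι : Type*} {f : ι → Ω → ℝ} (hf : ∀ i, MemLp (f i) 2 P) (s : Finset ι)
    (c : ι → ℝ) :
    ⇑(∑ i ∈ s, c i • lpVec f hf i) =ᵐ[P] fun ω => ∑ i ∈ s, c i * f i ω := by
  classical
  induction s using Finset.induction_on with
  | empty =>
    simp only [Finset.sum_empty]
    exact Lp.coeFn_zero ℝ 2 P
  | insert i s hi ih =>
    rw [Finset.sum_insert hi]
    filter_upwards [Lp.coeFn_add (c i • lpVec f hf i) (∑ i ∈ s, c i • lpVec f hf i), ih,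
      Lp.coeFn_smul (c i) (lpVec f hf i), (hf i).coeFn_toLp] with ω h1 h2 h3 h4
    rw [h1, Pi.add_apply, h2, h3, Finset.sum_insert hi, Pi.smul_apply, lpVec, h4, smul_eq_mul]

lemma inner_lpVec {ι κ : Type*} {f : ι → Ω → ℝ} {g : κ → Ω → ℝ} (hf : ∀ i, MemLp (f i) 2 P)
    (hg : ∀ i, MemLp (g i) 2 P) (i : ι) (j : κ) :
    inner ℝ (lpVec f hf i) (lpVec g hg j) = ∫ ω, f i ω * g j ω ∂P := by
  rw [L2.inner_def]
  refine integral_congr_ae ?_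
  filter_upwards [(hf i).coeFn_toLp, (hg j).coeFn_toLp] with ω h1 h2
  rw [lpVec, lpVec, h1, h2]
  simp [mul_comm]

/-- Linear combinations of random variables. -/
def funComb (f : ℤ × Fin p → Ω → ℝ) (α : Coef p) (ω : Ω) : ℝ := ∑ i ∈ α.support, α i * f i ω

lemma coeFn_comb {f : ℤ × Fin p → Ω → ℝ} (hf : ∀ i, MemLp (f i) 2 P) (α : Coef p) :
    ⇑(comb (lpVec f hf) α) =ᵐ[P] funComb f α := by
  rw [comb_eq_sum_support]
  exact coeFn_sum_smul_lpVec hf _ _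

lemma memLp_funComb {f : ℤ × Fin p → Ω → ℝ} (hf : ∀ i, MemLp (f i) 2 P) (α : Coef p) :
    MemLp (funComb f α) 2 P :=
  (memLp_congr_ae (coeFn_comb hf α)).mp (Lp.memLp _)

lemma norm_comb_sq {f : ℤ × Fin p → Ω → ℝ} (hf : ∀ i, MemLp (f i) 2 P) (α : Coef p) :
    ‖comb (lpVec f hf) α‖ ^ 2 = ∫ ω, funComb f α ω ^ 2 ∂P := by
  rw [← real_inner_self_eq_norm_sq, L2.inner_def]
  refine integral_congr_ae ?_
  filter_upwards [coeFn_comb hf α] with ω h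
  rw [h]; simp [pow_two]

lemma solvesAR_lpVec {Φ : Fin d → Matrix (Fin p) (Fin p) ℝ} {S : Set ℤ}
    {f g : ℤ × Fin p → Ω → ℝ} (hf : ∀ i, MemLp (f i) 2 P) (hg : ∀ i, MemLp (g i) 2 P)
    (h : ∀ i : ℤ × Fin p, i.1 ∈ S → ∀ᵐ ω ∂P,
      f i ω = (∑ k : Fin d, ∑ b : Fin p, Φ k i.2 b * f (i.1 - ((k : ℤ) + 1), b) ω) + g i ω) :
    SolvesAR Φ S (lpVec f hf) (lpVec g hg) := by
  intro i hi
  let F : Fin d × Fin p → Ω → ℝ := fun kb => f (i.1 - ((kb.1 : ℤ) + 1), kb.2)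
  have hsum : ∑ k : Fin d, ∑ b : Fin p, Φ k i.2 b • lpVec f hf (i.1 - ((k : ℤ) + 1), b) =
      ∑ kb : Fin d × Fin p, Φ kb.1 i.2 kb.2 • lpVec F (fun _ => hf _) kb := by
    rw [Fintype.sum_prod_type]; rfl
  rw [hsum]
  refine Lp.ext ?_
  filter_upwards [h i hi, (hf i).coeFn_toLp, (hg i).coeFn_toLp,
    coeFn_sum_smul_lpVec (f := F) (fun _ => hf _) Finset.univ (fun kb => Φ kb.1 i.2 kb.2),
    Lp.coeFn_add (∑ kb : Fin d × Fin p, Φ kb.1 i.2 kb.2 • lpVec F (fun _ => hf _) kb) (lpVec g hg i)]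
    with ω h1 h2 h3 h4 h5
  rw [h5, Pi.add_apply, h4, lpVec, lpVec, h2, h3, h1, Fintype.sum_prod_type]

/-- The coordinates of a vector-valued process. -/
def coord (z : ℤ → Ω → EuclideanSpace ℝ (Fin p)) (i : ℤ × Fin p) (ω : Ω) : ℝ := z i.1 ω i.2

omit [MeasurableSpace Ω] in
lemma coord_arPart (Φ : Fin d → Matrix (Fin p) (Fin p) ℝ) (z : ℤ → Ω → EuclideanSpace ℝ (Fin p))
    (t : ℤ) (a : Fin p) (ω : Ω) : arPart Φ z t ω a =
      ∑ k : Fin d, ∑ b : Fin p, Φ k a b * coord z (t - ((k : ℤ) + 1), b) ω := by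
  simp [arPart, coord, Matrix.mulVec, dotProduct]

lemma ae_coord_eq {Φ : Fin d → Matrix (Fin p) (Fin p) ℝ}
    {z ε : ℤ → Ω → EuclideanSpace ℝ (Fin p)} {t : ℤ}
    (h : ∀ᵐ ω ∂P, z t ω = arPart Φ z t ω + ε t ω) (a : Fin p) : ∀ᵐ ω ∂P, coord z (t, a) ω =
      (∑ k : Fin d, ∑ b : Fin p, Φ k a b * coord z (t - ((k : ℤ) + 1), b) ω) + coord ε (t, a) ω := by
  filter_upwards [h] with ω hω
  rw [← coord_arPart, coord, hω]; rfl

lemma hasGaussianLaw_coord {Z : Ω → EuclideanSpace ℝ (Fin p)} (h : HasGaussianLaw Z P)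
    (a : Fin p) : HasGaussianLaw (fun ω => Z ω a) P :=
  h.map_fun (EuclideanSpace.proj a : EuclideanSpace ℝ (Fin p) →L[ℝ] ℝ)

namespace IsGaussianWhiteNoise

variable {ε : ℤ → Ω → EuclideanSpace ℝ (Fin p)} {S : Matrix (Fin p) (Fin p) ℝ}
  (hε : IsGaussianWhiteNoise ε S P)
include hε

lemma memLp_coord (i : ℤ × Fin p) : MemLp (coord ε i) 2 P :=
  (hasGaussianLaw_coord (hε.law i.1).hasGaussianLaw i.2).memLp_two

lemma integral_coord (i : ℤ × Fin p) : ∫ ω, coord ε i ω ∂P = 0 := by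
  have h1 := (hε.law i.1).integral_comp (f := fun v : EuclideanSpace ℝ (Fin p) => v i.2)
    (by fun_prop)
  have h2 : ∫ v, v i.2 ∂(multivariateGaussian 0 S) = 0 := by
    have := (EuclideanSpace.proj i.2 : EuclideanSpace ℝ (Fin p) →L[ℝ] ℝ).integral_comp_comm
      (IsGaussian.integrable_fun_id (μ := multivariateGaussian (0 : EuclideanSpace ℝ (Fin p)) S))
    simpa using this
  rw [← h2, ← h1]; rfl

end IsGaussianWhiteNoise

namespace IsStationaryGaussianVAR

variable {Φ : Fin d → Matrix (Fin p) (Fin p) ℝ} {ε x : ℤ → Ω → EuclideanSpace ℝ (Fin p)}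
  (hx : IsStationaryGaussianVAR Φ ε x P)
include hx

lemma memLp_coord (i : ℤ × Fin p) : MemLp (coord x i) 2 P :=
  (hasGaussianLaw_coord (hx.gaussian.hasGaussianLaw_eval i.1) i.2).memLp_two

lemma aemeasurable_path (h : ℤ) : AEMeasurable (fun ω (t : ℤ) => x (t + h) ω) P :=
  aemeasurable_pi_lambda _ fun t => hx.gaussian.aemeasurable (t + h)

lemma integral_coord_shift (t h : ℤ) (a : Fin p) :
    ∫ ω, coord x (t + h, a) ω ∂P = ∫ ω, coord x (t, a) ω ∂P := by
  have h1 := hx.stationary h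
  have hm : Measurable fun z : ℤ → EuclideanSpace ℝ (Fin p) => z t a := by fun_prop
  have h2 := integral_map (hx.aemeasurable_path h) hm.aestronglyMeasurable
  have h3 := integral_map (φ := fun ω (t : ℤ) => x t ω) (by simpa using hx.aemeasurable_path 0)
    (hm.aestronglyMeasurable (μ := P.map fun ω (t : ℤ) => x t ω))
  rw [h1] at h2
  exact h2.symm.trans h3

lemma covariance_coord_shift (s t h : ℤ) (a b : Fin p) :
    cov[coord x (s + h, a), coord x (t + h, b); P] = cov[coord x (s, a), coord x (t, b); P] := by
  have h1 := hx.stationary h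
  have hm : ∀ t (a : Fin p), Measurable fun z : ℤ → EuclideanSpace ℝ (Fin p) => z t a := by
    intro t a; fun_prop
  have h2 := covariance_map_fun (Z := fun ω (t : ℤ) => x (t + h) ω) (μ := P)
    (hm s a).aestronglyMeasurable (hm t b).aestronglyMeasurable (hx.aemeasurable_path h)
  have h3 := covariance_map_fun (Z := fun ω (t : ℤ) => x t ω) (μ := P)
    (hm s a).aestronglyMeasurable (hm t b).aestronglyMeasurable
    (by simpa using hx.aemeasurable_path 0)
  rw [h1] at h2
  exact h2.symm.trans h3

lemma covariance_coord (i j : ℤ × Fin p) :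
    cov[coord x i, coord x j; P] = autocov x P (j.1 - i.1) i.2 j.2 := by
  have := hx.covariance_coord_shift 0 (j.1 - i.1) i.1 i.2 j.2
  simp only [zero_add, sub_add_cancel] at this
  exact this

lemma autocov_neg (l : ℤ) : autocov x P (-l) = (autocov x P l)ᵀ := by
  ext a b
  have h1 := hx.covariance_coord (l, a) (0, b)
  have h2 := hx.covariance_coord (0, b) (l, a)
  simp only [zero_sub, sub_zero] at h1 h2
  rw [Matrix.transpose_apply, ← h1, ← h2, covariance_comm]

variable {S : Matrix (Fin p) (Fin p) ℝ} (hε : IsGaussianWhiteNoise ε S P) [IsProbabilityMeasure P]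
include hε

lemma integral_coord_eq (i : ℤ × Fin p) : ∫ ω, coord x i ω ∂P =
    ∑ k : Fin d, ∑ b : Fin p, Φ k i.2 b * ∫ ω, coord x (i.1 - ((k : ℤ) + 1), b) ω ∂P := by
  have hint : ∀ j, Integrable (coord x j) P := fun j => (hx.memLp_coord j).integrable one_le_two
  rw [integral_congr_ae (ae_coord_eq (hx.recursion i.1) i.2), integral_add, hε.integral_coord,
    add_zero, integral_finsetSum]
  · refine Finset.sum_congr rfl fun k _ => ?_
    rw [integral_finsetSum]
    · exact Finset.sum_congr rfl fun b _ => integral_const_mul _ _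
    · exact fun b _ => (hint _).const_mul _
  · exact fun k _ => integrable_finsetSum _ fun b _ => (hint _).const_mul _
  · exact integrable_finsetSum _ fun k _ => integrable_finsetSum _ fun b _ => (hint _).const_mul _
  · exact (hε.memLp_coord _).integrable one_le_two

/-- The centred coordinates. -/
lemma isRieszAR_centered (hsum : HasSpectralDensity x P) {mf Mf : ℝ} (hmf : 0 < mf) (hMf : 0 < Mf)
    (hupper : specUpper x P ≤ ENNReal.ofReal Mf) (hlower : ENNReal.ofReal mf ≤ specLower x P)
    (hxc : ∀ i, MemLp (fun ω => coord x i ω - ∫ ω, coord x i ω ∂P) 2 P) :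
    IsRieszAR Φ (lpVec (fun i ω => coord x i ω - ∫ ω, coord x i ω ∂P) hxc)
      (lpVec (coord ε) hε.memLp_coord) (2 * Real.pi * mf) (2 * Real.pi * Mf) := by
  have hbound := fun α => quadForm_autocov_bounds hx.autocov_neg hsum (mf := mf) (Mf := Mf) (by
    filter_upwards [ae_essInf_le (μ := volume.restrict (Set.Icc (-Real.pi) Real.pi))
      (f := fun θ : ℝ => ENNReal.ofReal (eigMin (spectralDensity x P θ)))] with θ hθ
    have := hlower.trans hθ
    -- `ENNReal.ofReal` clips negative eigenvalues to zero; positivity of `mf` excludes that case.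
    rcases (ENNReal.ofReal_le_ofReal_iff'.mp this) with h | h
    · exact h
    · exact absurd h (not_le.mpr hmf)) (by
    filter_upwards [ENNReal.ae_le_essSup (μ := volume.restrict (Set.Icc (-Real.pi) Real.pi))
      (fun θ : ℝ => ENNReal.ofReal (eigMax (spectralDensity x P θ)))] with θ hθ
    exact (ENNReal.ofReal_le_ofReal_iff hMf.le).mp (hθ.trans hupper)) α
  have hform : ∀ α : Coef p, ‖comb (lpVec (fun i ω => coord x i ω - ∫ ω, coord x i ω ∂P) hxc) α‖ ^ 2 =
      ∑ i ∈ α.support, ∑ j ∈ α.support, α i * α j * autocov x P (j.1 - i.1) i.2 j.2 := by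
    intro α
    rw [← real_inner_self_eq_norm_sq, comb_eq_sum_support, sum_inner]
    refine Finset.sum_congr rfl fun i _ => ?_
    rw [inner_sum]
    refine Finset.sum_congr rfl fun j _ => ?_
    rw [real_inner_smul_left, real_inner_smul_right, inner_lpVec, ← hx.covariance_coord, ← mul_assoc]
    rfl
  refine ⟨solvesAR_lpVec _ _ fun i _ => ?_, fun i j hij => ?_, fun α => ?_, fun α => ?_⟩
  · filter_upwards [ae_coord_eq (hx.recursion i.1) i.2] with ω hω
    have := hx.integral_coord_eq hε i
    simp only [mul_sub, Finset.sum_sub_distrib]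
    rw [← this, show coord x i ω = coord x (i.1, i.2) ω from rfl, hω]
    ring
  · rw [inner_lpVec]
    have hind : IndepFun (coord ε i) (fun ω => coord x j ω - ∫ ω, coord x j ω ∂P) P := by
      have hg : Measurable fun z : Set.Iio i.1 → EuclideanSpace ℝ (Fin p) =>
          z ⟨j.1, hij⟩ j.2 - ∫ ω, coord x j ω ∂P := by fun_prop
      have hf : Measurable fun v : EuclideanSpace ℝ (Fin p) => v i.2 := by fun_prop
      exact (hx.innovation i.1).comp hf hg
    rw [hind.integral_fun_mul_eq_mul_integral (hε.memLp_coord i).1 (hxc j).1, hε.integral_coord,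
      zero_mul]
  · rw [hform]; exact (hbound α).1
  · rw [hform]; exact (hbound α).2

/-- The spectral density sees covariances only, so the two-sided bounds come first for the centred
process. They make the autoregressive operator bounded, hence without a unit root at frequency zero.
The stationary mean is a fixed vector of the recursion and must vanish, so the centring can be
dropped. -/
lemma isBoundedAR_and_centered (hsum : HasSpectralDensity x P) {mf Mf : ℝ} (hmf : 0 < mf)
    (hMf : 0 < Mf) (hupper : specUpper x P ≤ ENNReal.ofReal Mf)
    (hlower : ENNReal.ofReal mf ≤ specLower x P) :
    IsBoundedAR Φ (Mf / mf) ∧ (∀ i, ∫ ω, coord x i ω ∂P = 0) ∧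
      IsRieszAR Φ (lpVec (coord x) hx.memLp_coord) (lpVec (coord ε) hε.memLp_coord)
        (2 * Real.pi * mf) (2 * Real.pi * Mf) := by
  have hxc : ∀ i, MemLp (fun ω => coord x i ω - ∫ ω, coord x i ω ∂P) 2 P :=
    fun i => (hx.memLp_coord i).sub (memLp_const _)
  have hR := hx.isRieszAR_centered hε hsum hmf hMf hupper hlower hxc
  have hpi := Real.pi_pos
  have hB : IsBoundedAR Φ (Mf / mf) := by
    have := hR.isBoundedAR (by positivity) (by positivity)
    rwa [mul_div_mul_left _ _ (by positivity)] at this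
  have hconst : ∀ t a, ∫ ω, coord x (t, a) ω ∂P = ∫ ω, coord x (0, a) ω ∂P := by
    intro t a
    simpa using hx.integral_coord_shift 0 t a
  have hmean : (fun a => ∫ ω, coord x (0, a) ω ∂P) = 0 := by
    refine hB.eq_zero_of_fixed fun a => ?_
    rw [hx.integral_coord_eq hε (0, a)]
    refine Finset.sum_congr rfl fun k _ => Finset.sum_congr rfl fun b _ => ?_
    rw [hconst]
  have hmean' : ∀ i, ∫ ω, coord x i ω ∂P = 0 := fun i => by
    rw [show i = (i.1, i.2) from rfl, hconst]; exact congrFun hmean i.2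
  refine ⟨hB, hmean', ?_⟩
  have heq : lpVec (fun i ω => coord x i ω - ∫ ω, coord x i ω ∂P) hxc =
      lpVec (coord x) hx.memLp_coord := by
    funext i
    simp only [lpVec]
    congr 1
    funext ω
    rw [hmean' i, sub_zero]
  rwa [heq] at hR

omit hε [IsProbabilityMeasure P] in
lemma hasGaussianLaw_funComb (α : Coef p) : HasGaussianLaw (funComb (coord x) α) P := by
  classical
  let I : Finset ℤ := α.support.image Prod.fst
  have h1 := hx.gaussian.hasGaussianLaw I
  let L : (I → EuclideanSpace ℝ (Fin p)) →L[ℝ] ℝ :=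
    ∑ i ∈ α.support.attach, α i.1 •
      ((EuclideanSpace.proj i.1.2 : EuclideanSpace ℝ (Fin p) →L[ℝ] ℝ) ∘L
        ContinuousLinearMap.proj (⟨i.1.1, Finset.mem_image_of_mem _ i.2⟩ : I))
  have h2 := h1.map_fun L
  have h3 : funComb (coord x) α = fun ω => L (I.restrict (x · ω)) := by
    funext ω
    simp only [L, _root_.sum_apply, funComb]
    rw [← Finset.sum_attach]
    rfl
  rwa [h3]

end IsStationaryGaussianVAR

end L2

end BreakVAR

namespace BreakVAR

/-! ### Tail bounds for Gaussian square sums and martingale transforms -/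

section Tails

open scoped NNReal

variable {Ω : Type u} [MeasurableSpace Ω] {P : Measure Ω}

lemma lintegral_pi_ofReal_prod {ι : Type*} [Fintype ι] {f : ι → ℝ → ℝ} {μ : Measure ℝ} [SigmaFinite μ]
    (hf : ∀ i, Integrable (f i) μ) (h0 : ∀ i x, 0 ≤ f i x) :
    ∫⁻ g : ι → ℝ, ENNReal.ofReal (∏ i, f i (g i)) ∂(Measure.pi fun _ => μ) =
      ENNReal.ofReal (∏ i, ∫ x, f i x ∂μ) := by
  rw [← integral_fintype_prod_eq_prod, ofReal_integral_eq_lintegral_ofReal]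
  · exact Integrable.fintype_prod hf
  · exact ae_of_all _ fun g => Finset.prod_nonneg fun i _ => h0 i _

lemma lintegral_exp_mul_of_gaussian {Z : Ω → ℝ} {v : ℝ≥0} (hZ : P.map Z = gaussianReal 0 v)
    (t : ℝ) : ∫⁻ ω, ENNReal.ofReal (Real.exp (t * Z ω)) ∂P =
      ENNReal.ofReal (Real.exp (v * t ^ 2 / 2)) := by
  have h1 := mgf_gaussianReal hZ t
  rw [zero_mul, zero_add] at h1
  -- A function that is not integrable has Bochner integral zero, while this one has a positive
  -- integral.
  have h2 : Integrable (fun ω => Real.exp (t * Z ω)) P := by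
    by_contra h
    rw [mgf, integral_undef h] at h1
    exact (Real.exp_pos _).ne h1
  rw [← h1, mgf, ofReal_integral_eq_lintegral_ofReal h2 (ae_of_all _ fun _ => (Real.exp_pos _).le)]

lemma gaussianPDFReal_mul_exp_sq (x : ℝ) :
    gaussianPDFReal 0 1 x * Real.exp (x ^ 2 / 4) = (√(2 * Real.pi))⁻¹ * Real.exp (-(1 / 4) * x ^ 2) := by
  rw [gaussianPDFReal_def]
  simp only [NNReal.coe_one, mul_one, sub_zero]
  rw [mul_assoc, ← Real.exp_add]
  congr 2; ring

lemma integral_exp_sq_gaussianReal :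
    ∫ x, Real.exp (x ^ 2 / 4) ∂(gaussianReal 0 1) = √2 := by
  rw [integral_gaussianReal_eq_integral_smul one_ne_zero]
  simp_rw [smul_eq_mul, gaussianPDFReal_mul_exp_sq]
  rw [integral_const_mul, integral_gaussian, ← Real.sqrt_inv, ← Real.sqrt_mul (by positivity)]
  congr 1
  have := Real.pi_ne_zero
  field_simp
  norm_num

lemma integrable_exp_sq_gaussianReal :
    Integrable (fun x => Real.exp (x ^ 2 / 4)) (gaussianReal 0 1) := by
  by_contra h
  have := integral_exp_sq_gaussianReal
  rw [integral_undef h] at this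
  exact (Real.sqrt_pos.mpr two_pos).ne this

/-- A tail bound for the sum of squares of jointly Gaussian variables with bounded covariance. -/
lemma measure_sum_sq_ge_le [IsProbabilityMeasure P] {ι : Type*} [Fintype ι] {Y : ι → Ω → ℝ}
    (hY : ∀ i, AEMeasurable (Y i) P) {K : ℝ} (hK : 0 < K)
    (hlaw : ∀ c : ι → ℝ, ∃ v : ℝ≥0, (v : ℝ) ≤ K * ∑ i, c i ^ 2 ∧
      P.map (fun ω => ∑ i, c i * Y i ω) = gaussianReal 0 v) :
    P {ω | 4 * K * Fintype.card ι ≤ ∑ i, Y i ω ^ 2} ≤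
      ENNReal.ofReal (Real.exp (-(Fintype.card ι) / 2)) := by
  -- Then `s² = 1 / (2K)`. For fixed `g` the expectation over `Y` is at most `exp(|g|²/4)`, which is
  -- still integrable under the standard Gaussian law.
  set s : ℝ := √(2 * (1 / (4 * K))) with hs
  have hs2 : s ^ 2 = 1 / (2 * K) := by
    rw [hs, Real.sq_sqrt (by positivity)]; field_simp; norm_num
  set ν : Measure (ι → ℝ) := Measure.pi fun _ => gaussianReal 0 1 with hν
  set f : Ω → ℝ≥0∞ := fun ω => ENNReal.ofReal (Real.exp (1 / (4 * K) * ∑ i, Y i ω ^ 2)) with hf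
  -- The square is linearized by independent standard normal `g`: `exp(s²Y²/2)` is the mean of
  -- `exp(sYg)`. After the integrals are exchanged only linear combinations of the `Y i` occur, and
  -- their laws are known.
  have step1 : ∀ ω, f ω = ∫⁻ g, ENNReal.ofReal (∏ i, Real.exp (s * Y i ω * g i)) ∂ν := by
    intro ω
    have h := lintegral_pi_ofReal_prod (ι := ι) (μ := gaussianReal 0 1)
      (f := fun i x => Real.exp (s * Y i ω * x)) (fun i => integrable_exp_mul_gaussianReal _)
      (fun i x => (Real.exp_pos _).le)
    rw [h, hf]
    have hm : ∀ i, ∫ x, Real.exp (s * Y i ω * x) ∂(gaussianReal 0 1) =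
        Real.exp (1 / (4 * K) * Y i ω ^ 2) := by
      intro i
      have := congrFun (mgf_fun_id_gaussianReal (μ := 0) (v := 1)) (s * Y i ω)
      rw [mgf] at this
      rw [this]
      congr 1
      rw [mul_pow, hs2]
      simp only [zero_mul, NNReal.coe_one, one_mul, zero_add]
      field_simp
      ring
    simp_rw [hm]
    rw [← Real.exp_sum, Finset.mul_sum]
  have step3 : ∀ g : ι → ℝ, ∫⁻ ω, ENNReal.ofReal (∏ i, Real.exp (s * Y i ω * g i)) ∂P ≤
      ENNReal.ofReal (∏ i, Real.exp (g i ^ 2 / 4)) := by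
    intro g
    obtain ⟨v, hv, hl⟩ := hlaw g
    have h1 : ∀ ω, ∏ i, Real.exp (s * Y i ω * g i) = Real.exp (s * ∑ i, g i * Y i ω) := by
      intro ω
      rw [← Real.exp_sum, Finset.mul_sum]
      congr 1
      exact Finset.sum_congr rfl fun i _ => by ring
    simp_rw [h1]
    rw [lintegral_exp_mul_of_gaussian hl, ← Real.exp_sum]
    refine ENNReal.ofReal_le_ofReal (Real.exp_le_exp.mpr ?_)
    rw [hs2, ← Finset.sum_div]
    have h2 : (v : ℝ) * (1 / (2 * K)) ≤ K * (∑ i, g i ^ 2) * (1 / (2 * K)) := by gcongr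
    have h3 : K * (∑ i, g i ^ 2) * (1 / (2 * K)) = (∑ i, g i ^ 2) / 2 := by field_simp
    linarith
  have hmeas : AEMeasurable (Function.uncurry fun ω (g : ι → ℝ) =>
      ENNReal.ofReal (∏ i, Real.exp (s * Y i ω * g i))) (P.prod ν) := by
    refine ENNReal.measurable_ofReal.comp_aemeasurable ?_
    refine Finset.aemeasurable_fun_prod _ fun i _ => Real.measurable_exp.comp_aemeasurable ?_
    refine AEMeasurable.mul ?_ ?_
    · exact (((hY i).comp_fst (ν := ν)).const_mul s)
    · exact (by fun_prop : Measurable fun z : Ω × (ι → ℝ) => z.2 i).aemeasurable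
  have hE : ∫⁻ ω, f ω ∂P ≤ ENNReal.ofReal (√2 ^ Fintype.card ι) := by
    simp_rw [step1]
    rw [lintegral_lintegral_swap hmeas]
    refine (lintegral_mono step3).trans (le_of_eq ?_)
    rw [lintegral_pi_ofReal_prod (f := fun _ x => Real.exp (x ^ 2 / 4))
      (fun _ => integrable_exp_sq_gaussianReal) (fun _ _ => (Real.exp_pos _).le)]
    simp [integral_exp_sq_gaussianReal]
  have hfm : AEMeasurable f P := by
    refine ENNReal.measurable_ofReal.comp_aemeasurable (Real.measurable_exp.comp_aemeasurable ?_)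
    exact (Finset.aemeasurable_fun_sum _ fun i _ => (hY i).pow_const 2).const_mul _
  have hmarkov := mul_meas_ge_le_lintegral₀ hfm (ENNReal.ofReal (Real.exp (Fintype.card ι)))
  have hsub : {ω | 4 * K * Fintype.card ι ≤ ∑ i, Y i ω ^ 2} ⊆
      {ω | ENNReal.ofReal (Real.exp (Fintype.card ι)) ≤ f ω} := by
    intro ω hω
    simp only [Set.mem_ofPred_eq] at hω ⊢
    refine ENNReal.ofReal_le_ofReal (Real.exp_le_exp.mpr ?_)
    rw [div_mul_eq_mul_div, one_mul, le_div_iff₀ (by positivity)]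
    linarith
  refine (measure_mono hsub).trans ?_
  have h5 : P {ω | ENNReal.ofReal (Real.exp (Fintype.card ι)) ≤ f ω} ≤
      ENNReal.ofReal (√2 ^ Fintype.card ι) / ENNReal.ofReal (Real.exp (Fintype.card ι)) := by
    rw [ENNReal.le_div_iff_mul_le (Or.inl (by simp [Real.exp_pos])) (Or.inl ENNReal.ofReal_ne_top),
      mul_comm]
    exact hmarkov.trans hE
  refine h5.trans ?_
  rw [← ENNReal.ofReal_div_of_pos (Real.exp_pos _)]
  refine ENNReal.ofReal_le_ofReal ?_
  rw [div_le_iff₀ (Real.exp_pos _), ← Real.exp_add]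
  -- Since `2 ≤ e`, the factor `√2` per variable costs at most half of the Markov exponent.
  have h6 : √2 ≤ Real.exp (1 / 2) := by
    rw [Real.sqrt_le_left (Real.exp_pos _).le, ← Real.exp_nat_mul]
    have := Real.add_one_le_exp (1 : ℝ)
    norm_num at this ⊢
    exact this
  calc √2 ^ Fintype.card ι ≤ Real.exp (1 / 2) ^ Fintype.card ι := by gcongr
    _ = Real.exp (Fintype.card ι * (1 / 2)) := by rw [Real.exp_nat_mul]
    _ = _ := by congr 1; ring

/-- The exponential supermartingale of a Gaussian martingale transform. -/
lemma lintegral_exp_martingale_le_one [IsProbabilityMeasure P] {u e : ℕ → Ω → ℝ} {N : ℕ} {σ2 : ℝ}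
    (hu : ∀ k, AEMeasurable (u k) P) (he : ∀ k, AEMeasurable (e k) P)
    (hlaw : ∀ k < N, ∃ v : ℝ≥0, (v : ℝ) ≤ σ2 ∧ P.map (e k) = gaussianReal 0 v)
    (hind : ∀ k < N, IndepFun (fun ω => ((fun i : Fin k => (u i ω, e i ω)), u k ω)) (e k) P)
    (c : ℝ) :
    ∫⁻ ω, ENNReal.ofReal (Real.exp
      (∑ k ∈ Finset.range N, (c * (u k ω * e k ω) - c ^ 2 * σ2 / 2 * u k ω ^ 2))) ∂P ≤ 1 := by
  induction N with
  | zero => simp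
  | succ N ih =>
    have ih := ih (fun k hk => hlaw k (by omega)) (fun k hk => hind k (by omega))
    obtain ⟨v, hv, hl⟩ := hlaw N (by omega)
    -- The last innovation is independent of all earlier pairs together with `u N`. Fubini
    -- integrates it out with these frozen, and its Gaussian moment generating function is absorbed
    -- by the compensator `c² σ² u² / 2`.
    let G : (Fin N → ℝ × ℝ) × ℝ → ℝ := fun w =>
      ∑ k : Fin N, (c * ((w.1 k).1 * (w.1 k).2) - c ^ 2 * σ2 / 2 * (w.1 k).1 ^ 2)
    have hG : Measurable G := by fun_prop
    let F : ((Fin N → ℝ × ℝ) × ℝ) × ℝ → ℝ≥0∞ := fun z =>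
      ENNReal.ofReal (Real.exp (G z.1 - c ^ 2 * σ2 / 2 * z.1.2 ^ 2)) *
        ENNReal.ofReal (Real.exp (c * z.1.2 * z.2))
    have hF : Measurable F := by fun_prop
    set W : Ω → (Fin N → ℝ × ℝ) × ℝ := fun ω => ((fun i : Fin N => (u i ω, e i ω)), u N ω) with hW
    have hpairs : AEMeasurable (fun ω (i : Fin N) => (u i ω, e i ω)) P :=
      aemeasurable_pi_lambda _ fun i => (hu i).prodMk (he i)
    have hWm : AEMeasurable W P := hpairs.prodMk (hu N)
    have hprod := (hind N (by omega)).map_prod_eq_prod_map_map hWm (he N)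
    have hsumG : ∀ ω, ∑ k ∈ Finset.range N, (c * (u k ω * e k ω) - c ^ 2 * σ2 / 2 * u k ω ^ 2) =
        G (W ω) := by
      intro ω
      rw [Finset.sum_range]
    have h1 : ∀ ω, ENNReal.ofReal (Real.exp (∑ k ∈ Finset.range (N + 1),
        (c * (u k ω * e k ω) - c ^ 2 * σ2 / 2 * u k ω ^ 2))) = F (W ω, e N ω) := by
      intro ω
      rw [Finset.sum_range_succ, hsumG]
      simp only [F, W]
      rw [← ENNReal.ofReal_mul (Real.exp_pos _).le, ← Real.exp_add]
      congr 2
      ring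
    simp_rw [h1]
    have hWe : AEMeasurable (fun ω => (W ω, e N ω)) P := hWm.prodMk (he N)
    rw [← lintegral_map' (f := F) hF.aemeasurable hWe, hprod, hl,
      lintegral_prod _ hF.aemeasurable]
    have h2 : ∀ w, ∫⁻ x, F (w, x) ∂(gaussianReal 0 v) ≤ ENNReal.ofReal (Real.exp (G w)) := by
      intro w
      simp only [F]
      rw [lintegral_const_mul _ (by fun_prop),
        lintegral_exp_mul_of_gaussian (Z := fun x => x) (v := v) (by simp),
        ← ENNReal.ofReal_mul (Real.exp_pos _).le, ← Real.exp_add]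
      refine ENNReal.ofReal_le_ofReal (Real.exp_le_exp.mpr ?_)
      have : (v : ℝ) * (c * w.2) ^ 2 ≤ σ2 * (c * w.2) ^ 2 := by gcongr
      nlinarith
    refine (lintegral_mono h2).trans ?_
    rw [lintegral_map' (by fun_prop) hWm]
    simp_rw [← hsumG]
    exact ih

lemma measure_martingale_ge_le [IsProbabilityMeasure P] {u e : ℕ → Ω → ℝ} {N : ℕ} {σ2 : ℝ}
    (hσ : 0 < σ2) (hu : ∀ k, AEMeasurable (u k) P) (he : ∀ k, AEMeasurable (e k) P)
    (hlaw : ∀ k < N, ∃ v : ℝ≥0, (v : ℝ) ≤ σ2 ∧ P.map (e k) = gaussianReal 0 v)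
    (hind : ∀ k < N, IndepFun (fun ω => ((fun i : Fin k => (u i ω, e i ω)), u k ω)) (e k) P)
    {A V : ℝ} (hA : 0 ≤ A) (hV : 0 < V) :
    P {ω | A ≤ ∑ k ∈ Finset.range N, u k ω * e k ω ∧ ∑ k ∈ Finset.range N, u k ω ^ 2 ≤ V} ≤
      ENNReal.ofReal (Real.exp (-(A ^ 2 / (2 * σ2 * V)))) := by
  -- The maximizer of `c A - c² σ² V / 2`.
  set c : ℝ := A / (σ2 * V) with hc
  have hc0 : 0 ≤ c := by positivity
  have hE := lintegral_exp_martingale_le_one hu he hlaw hind c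
  have hm : AEMeasurable (fun ω => ENNReal.ofReal (Real.exp
      (∑ k ∈ Finset.range N, (c * (u k ω * e k ω) - c ^ 2 * σ2 / 2 * u k ω ^ 2)))) P := by
    refine ENNReal.measurable_ofReal.comp_aemeasurable (Real.measurable_exp.comp_aemeasurable ?_)
    exact Finset.aemeasurable_fun_sum _ fun k _ =>
      (((hu k).mul (he k)).const_mul c).sub (((hu k).pow_const 2).const_mul _)
  have hmarkov := mul_meas_ge_le_lintegral₀ hm (ENNReal.ofReal (Real.exp (A ^ 2 / (2 * σ2 * V))))
  have hsub : {ω | A ≤ ∑ k ∈ Finset.range N, u k ω * e k ω ∧ ∑ k ∈ Finset.range N, u k ω ^ 2 ≤ V} ⊆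
      {ω | ENNReal.ofReal (Real.exp (A ^ 2 / (2 * σ2 * V))) ≤ ENNReal.ofReal (Real.exp
        (∑ k ∈ Finset.range N, (c * (u k ω * e k ω) - c ^ 2 * σ2 / 2 * u k ω ^ 2)))} := by
    rintro ω ⟨h1, h2⟩
    refine ENNReal.ofReal_le_ofReal (Real.exp_le_exp.mpr ?_)
    rw [Finset.sum_sub_distrib, ← Finset.mul_sum, ← Finset.mul_sum]
    have e1 : c * A ≤ c * ∑ k ∈ Finset.range N, u k ω * e k ω := by gcongr
    have e2 : c ^ 2 * σ2 / 2 * ∑ k ∈ Finset.range N, u k ω ^ 2 ≤ c ^ 2 * σ2 / 2 * V := by gcongr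
    have e3 : A ^ 2 / (2 * σ2 * V) = c * A - c ^ 2 * σ2 / 2 * V := by
      rw [hc]; field_simp; ring
    linarith
  refine (measure_mono hsub).trans ?_
  rw [Real.exp_neg, ENNReal.ofReal_inv_of_pos (Real.exp_pos _), ← one_div,
    ENNReal.le_div_iff_mul_le (Or.inl (by simp [Real.exp_pos])) (Or.inl ENNReal.ofReal_ne_top),
    mul_comm]
  exact hmarkov.trans hE

/-- A two-sided tail bound for a Gaussian martingale transform with controlled bracket. -/
lemma measure_abs_martingale_ge_le [IsProbabilityMeasure P] {u e : ℕ → Ω → ℝ} {N : ℕ} {σ2 : ℝ}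
    (hσ : 0 < σ2) (hu : ∀ k, AEMeasurable (u k) P) (he : ∀ k, AEMeasurable (e k) P)
    (hlaw : ∀ k < N, ∃ v : ℝ≥0, (v : ℝ) ≤ σ2 ∧ P.map (e k) = gaussianReal 0 v)
    (hind : ∀ k < N, IndepFun (fun ω => ((fun i : Fin k => (u i ω, e i ω)), u k ω)) (e k) P)
    {A V : ℝ} (hA : 0 ≤ A) (hV : 0 < V) :
    P {ω | A ≤ |∑ k ∈ Finset.range N, u k ω * e k ω| ∧ ∑ k ∈ Finset.range N, u k ω ^ 2 ≤ V} ≤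
      2 * ENNReal.ofReal (Real.exp (-(A ^ 2 / (2 * σ2 * V)))) := by
  have h1 := measure_martingale_ge_le hσ hu he hlaw hind hA hV
  have h2 := measure_martingale_ge_le (u := fun k ω => -u k ω) hσ (fun k => (hu k).neg) he hlaw
    (fun k hk => (hind k hk).comp
      (φ := fun w : (Fin k → ℝ × ℝ) × ℝ => ((fun i => (-(w.1 i).1, (w.1 i).2)), -w.2)) (ψ := id)
      (by fun_prop) measurable_id) hA hV
  rw [two_mul]
  refine le_trans (measure_mono ?_) ((measure_union_le _ _).trans (add_le_add h1 h2))
  rintro ω ⟨h3, h4⟩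
  rcases le_abs.mp h3 with h | h
  · exact Or.inl ⟨h, h4⟩
  · refine Or.inr ⟨?_, by simpa using h4⟩
    simpa [Finset.sum_neg_distrib] using h

end Tails

end BreakVAR

namespace BreakVAR

/-! ### The oracle inequality and the ℓ¹ norm of the true parameter -/

section Regression

variable {n p d m₀ : ℕ}

/-- The sum of the absolute values of the entries is the sum over the blocks. -/
lemma sum_blockL1 (Θ : Fin p × (Fin n × Fin d × Fin p) → ℝ) :
    ∑ i : Fin n, blockL1 Θ i = ∑ q, |Θ q| := by
  simp only [blockL1]
  rw [Fintype.sum_prod_type, Finset.sum_comm]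
  refine Finset.sum_congr rfl fun a _ => ?_
  rw [Fintype.sum_prod_type]

lemma norm_toLp_sq {ι : Type*} [Fintype ι] (v : ι → ℝ) : ‖WithLp.toLp 2 v‖ ^ 2 = v ⬝ᵥ v := by
  rw [EuclideanSpace.norm_sq_eq]
  simp [dotProduct, pow_two]

/-- The oracle inequality of the lasso, with the gain from the curvature at the minimizer. -/
lemma lasso_prediction_error_le {ι κ : Type*} [Fintype ι] [Fintype κ] {Y : ι → ℝ}
    {Z : Matrix ι κ ℝ} {ν lam : ℝ} (hν : 0 < ν) {Θ₁ θ : κ → ℝ}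
    (hmin : ∀ Θ : κ → ℝ, 1 / ν * ((Y - Z *ᵥ Θ₁) ⬝ᵥ (Y - Z *ᵥ Θ₁)) + lam * ∑ q, |Θ₁ q| ≤
      1 / ν * ((Y - Z *ᵥ Θ) ⬝ᵥ (Y - Z *ᵥ Θ)) + lam * ∑ q, |Θ q|)
    (hlam : 0 ≤ lam)
    (hnoise : ∀ q, |(Zᵀ *ᵥ (Y - Z *ᵥ θ)) q| ≤ ν * (lam / 2)) :
    1 / ν * ((Z *ᵥ (Θ₁ - θ)) ⬝ᵥ (Z *ᵥ (Θ₁ - θ))) ≤ lam * ∑ q, |θ q| := by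
  set e : ι → ℝ := Y - Z *ᵥ θ with he
  set δ : κ → ℝ := θ - Θ₁ with hδ
  set w : ι → ℝ := Z *ᵥ δ with hw
  have hw' : Z *ᵥ (Θ₁ - θ) = -w := by rw [hw, hδ, ← Matrix.mulVec_neg, neg_sub]
  have hR : Y - Z *ᵥ Θ₁ = e + w := by rw [he, hw, hδ, Matrix.mulVec_sub]; abel
  -- Comparison along the segment from `Θ₁` to `θ`, divided by `t`. Letting `t → 0` removes the
  -- quadratic term on the right, whereas `t = 1` alone would leave `(w ⬝ᵥ w) / ν` there. This gains
  -- a factor of two in the final bound.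
  have hstep : ∀ t : ℝ, 0 < t → t ≤ 1 →
      2 / ν * ((e + w) ⬝ᵥ w) ≤ t / ν * (w ⬝ᵥ w) + lam * (∑ q, |θ q| - ∑ q, |Θ₁ q|) := by
    intro t ht ht1
    have h := hmin (Θ₁ + t • δ)
    have h1 : Y - Z *ᵥ (Θ₁ + t • δ) = (e + w) - t • w := by
      rw [Matrix.mulVec_add, Matrix.mulVec_smul, ← hR, ← hw]; abel
    have h2 : ∑ q, |(Θ₁ + t • δ) q| ≤ (1 - t) * ∑ q, |Θ₁ q| + t * ∑ q, |θ q| := by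
      rw [Finset.mul_sum, Finset.mul_sum, ← Finset.sum_add_distrib]
      refine Finset.sum_le_sum fun q _ => ?_
      have : (Θ₁ + t • δ) q = (1 - t) * Θ₁ q + t * θ q := by
        simp only [hδ, Pi.add_apply, Pi.smul_apply, Pi.sub_apply, smul_eq_mul]; ring
      rw [this]
      refine (abs_add_le _ _).trans (le_of_eq ?_)
      rw [abs_mul, abs_mul, abs_of_pos ht, abs_of_nonneg (by linarith : 0 ≤ 1 - t)]
    have h3 : ((e + w) - t • w) ⬝ᵥ ((e + w) - t • w) =
        (e + w) ⬝ᵥ (e + w) - 2 * t * ((e + w) ⬝ᵥ w) + t ^ 2 * (w ⬝ᵥ w) := by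
      simp only [sub_dotProduct, dotProduct_sub, smul_dotProduct, dotProduct_smul, smul_eq_mul,
        dotProduct_comm w (e + w)]
      ring
    rw [h1, h3, hR] at h
    have h4 := mul_le_mul_of_nonneg_left h2 hlam
    have h5 : t * (2 / ν * ((e + w) ⬝ᵥ w)) ≤
        t * (t / ν * (w ⬝ᵥ w) + lam * (∑ q, |θ q| - ∑ q, |Θ₁ q|)) := by
      have e1 : 1 / ν * ((e + w) ⬝ᵥ (e + w) - 2 * t * ((e + w) ⬝ᵥ w) + t ^ 2 * (w ⬝ᵥ w)) =
        1 / ν * ((e + w) ⬝ᵥ (e + w)) - t * (2 / ν * ((e + w) ⬝ᵥ w)) + t * (t / ν * (w ⬝ᵥ w)) := by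
        ring
      rw [e1] at h
      linarith
    exact le_of_mul_le_mul_left h5 ht
  have hlim : 2 / ν * ((e + w) ⬝ᵥ w) ≤ lam * (∑ q, |θ q| - ∑ q, |Θ₁ q|) := by
    have hww : 0 ≤ 1 / ν * (w ⬝ᵥ w) :=
      mul_nonneg (by positivity) (Finset.sum_nonneg fun i _ => mul_self_nonneg _)
    refine le_of_forall_pos_le_add fun η hη => ?_
    set t : ℝ := min 1 (η / (1 / ν * (w ⬝ᵥ w) + 1)) with htdef
    have ht : 0 < t := lt_min one_pos (by positivity)
    have h := hstep t ht (min_le_left _ _)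
    have h6 : t * (1 / ν * (w ⬝ᵥ w)) ≤ η := by
      have : t ≤ η / (1 / ν * (w ⬝ᵥ w) + 1) := min_le_right _ _
      rw [le_div_iff₀ (by positivity)] at this
      linarith
    have h7 : t / ν * (w ⬝ᵥ w) = t * (1 / ν * (w ⬝ᵥ w)) := by ring
    linarith
  have hcross : -(e ⬝ᵥ w) ≤ ν * (lam / 2) * (∑ q, |θ q| + ∑ q, |Θ₁ q|) := by
    have h8 : e ⬝ᵥ w = (Zᵀ *ᵥ e) ⬝ᵥ δ := by
      rw [hw, Matrix.dotProduct_mulVec, Matrix.mulVec_transpose]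
    have h9 : -(e ⬝ᵥ w) ≤ ∑ q, |(Zᵀ *ᵥ e) q| * |δ q| := by
      rw [h8]
      refine (neg_le_abs _).trans ?_
      rw [dotProduct]
      refine (Finset.abs_sum_le_sum_abs _ _).trans (le_of_eq ?_)
      simp_rw [abs_mul]
    refine h9.trans ?_
    rw [← Finset.sum_add_distrib, Finset.mul_sum]
    refine Finset.sum_le_sum fun q _ => ?_
    have : |δ q| ≤ |θ q| + |Θ₁ q| := abs_sub _ _
    exact mul_le_mul (hnoise q) this (abs_nonneg _) (by positivity)
  rw [hw', neg_dotProduct_neg]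
  rw [add_dotProduct] at hlim
  have e2 : 2 / ν * (e ⬝ᵥ w + w ⬝ᵥ w) = 2 * (1 / ν * (w ⬝ᵥ w)) - 2 / ν * (-(e ⬝ᵥ w)) := by ring
  rw [e2] at hlim
  have e3 : 2 / ν * (-(e ⬝ᵥ w)) ≤ lam * (∑ q, |θ q| + ∑ q, |Θ₁ q|) := by
    calc 2 / ν * (-(e ⬝ᵥ w)) ≤ 2 / ν * (ν * (lam / 2) * (∑ q, |θ q| + ∑ q, |Θ₁ q|)) := by gcongr
      _ = _ := by field_simp
  linarith

namespace Params

variable (M : Params n p d m₀)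

lemma regime_unique {t : ℕ} {j k : Fin (m₀ + 1)} (hj : M.brk j.castSucc ≤ t ∧ t < M.brk j.succ)
    (hk : M.brk k.castSucc ≤ t ∧ t < M.brk k.succ) : j = k := by
  have aux : ∀ j k : Fin (m₀ + 1), M.brk j.castSucc ≤ t ∧ t < M.brk j.succ →
      M.brk k.castSucc ≤ t ∧ t < M.brk k.succ → ¬ j < k := by
    intro j k hj hk hlt
    have : M.brk j.succ ≤ M.brk k.castSucc := M.brk_strictMono.monotone (by
      rw [Fin.le_def]; simpa using hlt)
    omega
  exact le_antisymm (not_lt.mp (aux k j hk hj)) (not_lt.mp (aux j k hj hk))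

lemma coeffAt_eq_row {t : ℕ} {j : Fin (m₀ + 1)} (hj : M.brk j.castSucc ≤ t ∧ t < M.brk j.succ) :
    M.coeffAt t = M.row j := by
  rw [coeffAt, Finset.sum_eq_single j, if_pos hj]
  · intro k _ hk
    rw [if_neg fun h => hk (M.regime_unique h hj)]
  · simp

/-- The blocks are the increments in time of the coefficient matrix, so their partial sums
telescope. -/
lemma sum_thetaMat_le (r : Fin n) (lk : Fin d × Fin p) (a : Fin p) :
    ∑ i : Fin n, (if i ≤ r then M.thetaMat (i, lk) a else 0) = M.coeffAt (d + r) a lk := by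
  let g : ℕ → ℝ := fun k => if k = 0 then M.coeffAt d a lk
    else M.coeffAt (d + k) a lk - M.coeffAt (d + k - 1) a lk
  have h1 : ∀ i : Fin n, M.thetaMat (i, lk) a = g i := fun i => rfl
  have h2 : ∀ m : ℕ, ∑ k ∈ Finset.range (m + 1), g k = M.coeffAt (d + m) a lk := by
    intro m
    induction m with
    | zero => simp [g]
    | succ m ih =>
      rw [Finset.sum_range_succ, ih]
      simp only [g, Nat.succ_ne_zero, if_false]
      rw [show d + (m + 1) - 1 = d + m by omega]
      ring
  rw [← h2, ← Finset.sum_filter]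
  simp_rw [h1]
  refine Finset.sum_bij (fun i _ => (i : ℕ)) ?_ ?_ ?_ ?_
  · intro i hi
    have : i ≤ r := by simpa using hi
    rw [Fin.le_def] at this
    simp only [Finset.mem_range]
    omega
  · intro i _ j _ hij; exact Fin.ext hij
  · intro k hk
    have hk' := Finset.mem_range.mp hk
    have hkr : k ≤ (r : ℕ) := by omega
    exact ⟨⟨k, by omega⟩, Finset.mem_filter.mpr ⟨Finset.mem_univ _, hkr⟩, rfl⟩
  · intro i _; rfl

lemma designMat_mulVec_thetaMat (y : ℤ → EuclideanSpace ℝ (Fin p)) (r : Fin n) (a : Fin p) :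
    ∑ ilk, designMat n d y r ilk * M.thetaMat ilk a = ∑ lk : Fin d × Fin p,
      M.coeffAt (d + r) a lk * y ((d : ℤ) + r - ((lk.1 : ℤ) + 1)) lk.2 := by
  rw [Fintype.sum_prod_type, Finset.sum_comm]
  refine Finset.sum_congr rfl fun lk _ => ?_
  rw [← M.sum_thetaMat_le, Finset.sum_mul]
  refine Finset.sum_congr rfl fun i _ => ?_
  simp only [designMat, Matrix.of_apply]
  split_ifs <;> ring

end Params

lemma bigDesign_mulVec_apply (y : ℤ → EuclideanSpace ℝ (Fin p))
    (Θ : Fin p × (Fin n × Fin d × Fin p) → ℝ) (a : Fin p) (r : Fin n) :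
    (bigDesign n d y *ᵥ Θ) (a, r) = ∑ ilk, designMat n d y r ilk * Θ (a, ilk) := by
  simp only [bigDesign, Matrix.mulVec, dotProduct, Matrix.kroneckerMap_apply]
  rw [Fintype.sum_prod_type, Finset.sum_eq_single a]
  · simp
  · intro b _ hb; simp [Matrix.one_apply_ne hb.symm]
  · simp

lemma bigDesign_transpose_mulVec_apply (y : ℤ → EuclideanSpace ℝ (Fin p))
    (v : Fin p × Fin n → ℝ) (a : Fin p) (q : Fin n × Fin d × Fin p) :
    ((bigDesign n d y)ᵀ *ᵥ v) (a, q) = ∑ r, designMat n d y r q * v (a, r) := by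
  simp only [bigDesign, Matrix.mulVec, dotProduct, Matrix.transpose_apply, Matrix.kroneckerMap_apply]
  rw [Fintype.sum_prod_type, Finset.sum_eq_single a]
  · simp
  · intro b _ hb; simp [Matrix.one_apply_ne hb]
  · simp

/-- On the event where the noise is dominated by the penalty, the prediction error is at most the
penalty of the true parameter. -/
lemma predError_le (M : Params n p d m₀) (hn : 0 < n) {y e : ℤ → EuclideanSpace ℝ (Fin p)}
    {lam : ℝ} (hlam : 0 ≤ lam) {Θ₁ : Fin p × (Fin n × Fin d × Fin p) → ℝ}
    (hest : IsEstimate y lam Θ₁)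
    (hrec : ∀ (r : Fin n) (a : Fin p), y ((d : ℤ) + r) a = (∑ lk : Fin d × Fin p,
      M.coeffAt (d + r) a lk * y ((d : ℤ) + r - ((lk.1 : ℤ) + 1)) lk.2) + e ((d : ℤ) + r) a)
    (hnoise : ∀ (a : Fin p) (q : Fin n × Fin d × Fin p),
      |∑ r : Fin n, designMat n d y r q * e ((d : ℤ) + r) a| ≤ n * (lam / 2)) :
    predError y Θ₁ M.theta ≤ lam * ∑ i : Fin n, blockL1 M.theta i := by
  rw [sum_blockL1, predError, norm_toLp_sq]
  have hres : ∀ a r, (respVec n d y - bigDesign n d y *ᵥ M.theta) (a, r) = e ((d : ℤ) + r) a := by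
    intro a r
    rw [Pi.sub_apply, bigDesign_mulVec_apply]
    have h1 : ∀ ilk, M.theta (a, ilk) = M.thetaMat ilk a := fun _ => rfl
    simp_rw [h1]
    rw [M.designMat_mulVec_thetaMat]
    change y ((d : ℤ) + r) a - _ = _
    rw [hrec]; ring
  refine lasso_prediction_error_le (Y := respVec n d y) (by exact_mod_cast hn) (fun Θ => ?_) hlam ?_
  · have := hest Θ
    simp only [objective, norm_toLp_sq, sum_blockL1] at this
    exact this
  · rintro ⟨a, q⟩
    rw [bigDesign_transpose_mulVec_apply]
    simp_rw [hres]
    exact hnoise a q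

namespace Params

variable (M : Params n p d m₀)

lemma sum_abs_row_le {MΦ : ℝ} (hb : ∀ j a lk, |M.row j a lk| ≤ MΦ) (j : Fin (m₀ + 1)) (a : Fin p) :
    ∑ lk, |M.row j a lk| ≤ M.rowNnz a j * MΦ := by
  classical
  rw [rowNnz, ← nsmul_eq_mul]
  rw [← Finset.sum_filter_add_sum_filter_not Finset.univ fun lk => M.row j a lk ≠ 0]
  have h0 : ∑ lk with ¬ M.row j a lk ≠ 0, |M.row j a lk| = 0 :=
    Finset.sum_eq_zero fun lk hlk => by
      have : M.row j a lk = 0 := by simpa using hlk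
      simp [this]
  rw [h0, add_zero]
  convert! Finset.sum_le_card_nsmul _ _ MΦ fun lk _ => hb j a lk

lemma jump_le_maxJumpNnz (j : Fin (m₀ + 1)) :
    ∑ a : Fin p, (M.s a j.succ + M.s a j.castSucc) ≤ M.maxJumpNnz :=
  Finset.le_sup (f := fun j : Fin (m₀ + 1) => ∑ a : Fin p, (M.s a j.succ + M.s a j.castSucc))
    (Finset.mem_univ j)

lemma sum_abs_row_le_maxJumpNnz {MΦ : ℝ} (hM : 0 ≤ MΦ) (hb : ∀ j a lk, |M.row j a lk| ≤ MΦ)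
    (j : Fin (m₀ + 1)) : ∑ a, ∑ lk, |M.row j a lk| ≤ M.maxJumpNnz * MΦ := by
  have h1 : ∑ a, M.rowNnz a j ≤ M.maxJumpNnz := by
    refine le_trans (Finset.sum_le_sum fun a _ => ?_) (M.jump_le_maxJumpNnz j)
    exact Nat.le_add_right (M.s a j.succ) _
  calc ∑ a, ∑ lk, |M.row j a lk| ≤ ∑ a, M.rowNnz a j * MΦ :=
        Finset.sum_le_sum fun a _ => M.sum_abs_row_le hb j a
    _ = ((∑ a, M.rowNnz a j : ℕ) : ℝ) * MΦ := by push_cast; rw [Finset.sum_mul]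
    _ ≤ _ := by gcongr

lemma sum_abs_jump_le_maxJumpNnz {MΦ : ℝ} (hM : 0 ≤ MΦ) (hb : ∀ j a lk, |M.row j a lk| ≤ MΦ)
    (j : Fin m₀) :
    ∑ a, ∑ lk, |M.row j.succ a lk - M.row j.castSucc a lk| ≤ M.maxJumpNnz * MΦ := by
  have h1 : ∑ a, (M.rowNnz a j.succ + M.rowNnz a j.castSucc) ≤ M.maxJumpNnz :=
    M.jump_le_maxJumpNnz j.succ
  calc ∑ a, ∑ lk, |M.row j.succ a lk - M.row j.castSucc a lk|
      ≤ ∑ a, (∑ lk, |M.row j.succ a lk| + ∑ lk, |M.row j.castSucc a lk|) := by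
        refine Finset.sum_le_sum fun a _ => ?_
        rw [← Finset.sum_add_distrib]
        exact Finset.sum_le_sum fun lk _ => abs_sub _ _
    _ ≤ ∑ a, (M.rowNnz a j.succ * MΦ + M.rowNnz a j.castSucc * MΦ) :=
        Finset.sum_le_sum fun a _ =>
          add_le_add (M.sum_abs_row_le hb j.succ a) (M.sum_abs_row_le hb j.castSucc a)
    _ = ((∑ a, (M.rowNnz a j.succ + M.rowNnz a j.castSucc) : ℕ) : ℝ) * MΦ := by
        push_cast; rw [Finset.sum_mul]; exact Finset.sum_congr rfl fun a _ => by ring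
    _ ≤ _ := by gcongr

/-- A block after the first vanishes unless its time is one of the inner break points `t₁, …,
t_{m₀}`; the first is a full coefficient matrix. The indicator form lets the sum over `i` count each
break point at most once. -/
lemma blockL1_theta_le {MΦ : ℝ} (hM : 0 ≤ MΦ) (hb : ∀ j a lk, |M.row j a lk| ≤ MΦ) (i : Fin n) :
    blockL1 M.theta i ≤ (if (i : ℕ) = 0 then M.maxJumpNnz * MΦ else 0) +
      ∑ j : Fin m₀, if M.brk j.succ.castSucc = d + i then M.maxJumpNnz * MΦ else 0 := by
  have hJ : 0 ≤ (M.maxJumpNnz : ℝ) * MΦ := by positivity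
  have hsum : 0 ≤ ∑ j : Fin m₀, if M.brk j.succ.castSucc = d + i then M.maxJumpNnz * MΦ else 0 :=
    Finset.sum_nonneg fun j _ => by split_ifs <;> simp [hJ]
  have hlast : d + (i : ℕ) < M.brk (Fin.last _) := by rw [M.brk_last]; omega
  by_cases hi : (i : ℕ) = 0
  · obtain ⟨j, hj⟩ := exists_regime M.brk_zero hlast
    rw [if_pos hi]
    have h1 : blockL1 M.theta i = ∑ a, ∑ lk, |M.row j a lk| := by
      refine Finset.sum_congr rfl fun a _ => Finset.sum_congr rfl fun lk _ => ?_
      rw [hi, add_zero] at hj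
      rw [← M.coeffAt_eq_row hj]
      simp [theta, Matrix.vec, thetaMat, hi]
    rw [h1]
    linarith [M.sum_abs_row_le_maxJumpNnz hM hb j]
  · rw [if_neg hi, zero_add]
    obtain ⟨j, hj⟩ := exists_regime M.brk_zero hlast
    have hth : ∀ a lk, M.theta (a, (i, lk)) =
        M.row j a lk - M.coeffAt (d + i - 1) a lk := by
      intro a lk
      rw [← M.coeffAt_eq_row hj]
      simp [theta, Matrix.vec, thetaMat, hi]
    by_cases hprev : M.brk j.castSucc ≤ d + i - 1
    · have h1 : blockL1 M.theta i = 0 := by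
        refine Finset.sum_eq_zero fun a _ => Finset.sum_eq_zero fun lk _ => ?_
        rw [hth, M.coeffAt_eq_row (j := j) ⟨hprev, by omega⟩, sub_self, abs_zero]
      rw [h1]; exact hsum
    · have hbrk : M.brk j.castSucc = d + i := by omega
      obtain rfl | ⟨j', rfl⟩ := Fin.eq_zero_or_eq_succ j
      · rw [Fin.castSucc_zero, M.brk_zero] at hbrk; omega
      · have hlt : M.brk j'.castSucc.castSucc < M.brk j'.succ.castSucc :=
          M.brk_strictMono (by simp [Fin.lt_def])
        have heq : M.brk j'.castSucc.succ = M.brk j'.succ.castSucc := by rw [Fin.succ_castSucc]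
        have h1 : blockL1 M.theta i =
            ∑ a, ∑ lk, |M.row j'.succ a lk - M.row j'.castSucc a lk| := by
          refine Finset.sum_congr rfl fun a _ => Finset.sum_congr rfl fun lk _ => ?_
          rw [hth, M.coeffAt_eq_row (j := j'.castSucc) ⟨by omega, by omega⟩]
        rw [h1]
        refine (M.sum_abs_jump_le_maxJumpNnz hM hb j').trans ?_
        have := Finset.single_le_sum (f := fun j : Fin m₀ =>
          if M.brk j.succ.castSucc = d + i then (M.maxJumpNnz : ℝ) * MΦ else 0)
          (fun j _ => by split_ifs <;> simp [hJ]) (Finset.mem_univ j')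
        rwa [if_pos hbrk] at this

lemma sum_blockL1_theta_le {MΦ : ℝ} (hM : 0 ≤ MΦ) (hb : ∀ j a lk, |M.row j a lk| ≤ MΦ) :
    ∑ i : Fin n, blockL1 M.theta i ≤ (m₀ + 1) * (M.maxJumpNnz * MΦ) := by
  have hJ : 0 ≤ (M.maxJumpNnz : ℝ) * MΦ := by positivity
  have hone : ∀ (c : ℕ), ∑ i : Fin n, (if c = d + i then (M.maxJumpNnz : ℝ) * MΦ else 0) ≤
      M.maxJumpNnz * MΦ := by
    intro c
    by_cases h : ∃ i : Fin n, c = d + i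
    · obtain ⟨i, hi⟩ := h
      rw [Finset.sum_eq_single i, if_pos hi]
      · intro k _ hk
        rw [if_neg fun h => hk (Fin.ext (by omega))]
      · simp
    · push Not at h
      rw [Finset.sum_eq_zero fun i _ => if_neg (h i)]
      exact hJ
  refine (Finset.sum_le_sum fun i _ => M.blockL1_theta_le hM hb i).trans ?_
  rw [Finset.sum_add_distrib, Finset.sum_comm]
  have h1 : ∑ i : Fin n, (if (i : ℕ) = 0 then (M.maxJumpNnz : ℝ) * MΦ else 0) ≤
      M.maxJumpNnz * MΦ := by
    refine le_trans (le_of_eq (Finset.sum_congr rfl fun i _ => ?_)) (hone d)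
    congr 1; simp
  have h2 : ∑ j : Fin m₀, ∑ i : Fin n,
      (if M.brk j.succ.castSucc = d + i then (M.maxJumpNnz : ℝ) * MΦ else 0) ≤
      m₀ * (M.maxJumpNnz * MΦ) := by
    refine (Finset.sum_le_sum fun j _ => hone _).trans (le_of_eq ?_)
    simp
  linarith

end Params

end Regression

end BreakVAR

namespace BreakVAR

/-! ### The observed series inside the span of the first stationary process -/

section Observed

open scoped NNReal

variable {Ω : Type u} [MeasurableSpace Ω] {P : Measure Ω} {p d : ℕ}

omit [MeasurableSpace Ω] in
lemma funComb_eq_sum {f : ℤ × Fin p → Ω → ℝ} {α : Coef p} {s : Finset (ℤ × Fin p)}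
    (hs : α.support ⊆ s) (ω : Ω) : funComb f α ω = ∑ i ∈ s, α i * f i ω := by
  refine Finset.sum_subset hs fun i _ hi => ?_
  simp [Finsupp.notMem_support_iff.mp hi]

omit [MeasurableSpace Ω] in
lemma funComb_add (f : ℤ × Fin p → Ω → ℝ) (α β : Coef p) (ω : Ω) :
    funComb f (α + β) ω = funComb f α ω + funComb f β ω := by
  classical
  rw [funComb_eq_sum (s := α.support ∪ β.support) Finsupp.support_add,
    funComb_eq_sum (α := α) (s := α.support ∪ β.support) Finset.subset_union_left,
    funComb_eq_sum (α := β) (s := α.support ∪ β.support) Finset.subset_union_right,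
    ← Finset.sum_add_distrib]
  exact Finset.sum_congr rfl fun i _ => by rw [Finsupp.add_apply, add_mul]

omit [MeasurableSpace Ω] in
lemma funComb_smul (f : ℤ × Fin p → Ω → ℝ) (c : ℝ) (α : Coef p) (ω : Ω) :
    funComb f (c • α) ω = c * funComb f α ω := by
  rw [funComb_eq_sum (s := α.support) Finsupp.support_smul, funComb, Finset.mul_sum]
  exact Finset.sum_congr rfl fun i _ => by rw [Finsupp.smul_apply, smul_eq_mul, mul_assoc]

/-- The random variables that are almost surely linear combinations of the coordinates of
`x_s`, `s ≤ t`. -/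
def pastSpan (x : ℤ → Ω → EuclideanSpace ℝ (Fin p)) (P : Measure Ω) (t : ℤ) :
    Submodule ℝ (Ω → ℝ) where
  carrier := {g | ∃ α : Coef p, LivesOn (Set.Iic t) α ∧ g =ᵐ[P] funComb (coord x) α}
  zero_mem' := ⟨0, fun _ _ => rfl, by
    refine Eventually.of_forall fun ω => ?_
    simp [funComb]⟩
  add_mem' := by
    rintro g g' ⟨α, hα, h⟩ ⟨α', hα', h'⟩
    refine ⟨α + α', hα.add hα', ?_⟩
    filter_upwards [h, h'] with ω h1 h2
    rw [Pi.add_apply, h1, h2, funComb_add]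
  smul_mem' := by
    rintro c g ⟨α, hα, h⟩
    refine ⟨c • α, fun i hi => by simp [hα i hi], ?_⟩
    filter_upwards [h] with ω h1
    rw [Pi.smul_apply, h1, funComb_smul, smul_eq_mul]

variable {x ε : ℤ → Ω → EuclideanSpace ℝ (Fin p)}

lemma pastSpan_mono {s t : ℤ} (h : s ≤ t) : pastSpan x P s ≤ pastSpan x P t := by
  rintro g ⟨α, hα, hg⟩
  exact ⟨α, hα.mono fun r hr => le_trans hr h, hg⟩

lemma pastSpan_congr {t : ℤ} {g g' : Ω → ℝ} (h : g ∈ pastSpan x P t) (hgg : g' =ᵐ[P] g) :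
    g' ∈ pastSpan x P t := by
  obtain ⟨α, hα, hg⟩ := h
  exact ⟨α, hα, hgg.trans hg⟩

lemma coord_mem_pastSpan {i : ℤ × Fin p} {t : ℤ} (h : i.1 ≤ t) : coord x i ∈ pastSpan x P t := by
  refine ⟨Finsupp.single i 1, fun j hj => ?_, Eventually.of_forall fun ω => ?_⟩
  · rw [Finsupp.single_apply, if_neg]
    rintro rfl
    exact hj h
  · rw [funComb_eq_sum (s := {i}) Finsupp.support_single_subset]
    simp

/-- A linear recursion stays in the span. -/
lemma sum_add_mem_pastSpan {Φ : Fin d → Matrix (Fin p) (Fin p) ℝ} {f : ℤ × Fin p → Ω → ℝ}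
    {t : ℤ} (a : Fin p) (hf : ∀ s b, s < t → f (s, b) ∈ pastSpan x P t) :
    (fun ω => ∑ k : Fin d, ∑ b : Fin p, Φ k a b * f (t - ((k : ℤ) + 1), b) ω) ∈ pastSpan x P t := by
  have h : (fun ω => ∑ k : Fin d, ∑ b : Fin p, Φ k a b * f (t - ((k : ℤ) + 1), b) ω) =
      ∑ k : Fin d, ∑ b : Fin p, Φ k a b • f (t - ((k : ℤ) + 1), b) := by
    funext ω
    simp [Finset.sum_apply]
  rw [h]
  exact Submodule.sum_mem _ fun k _ => Submodule.sum_mem _ fun b _ =>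
    Submodule.smul_mem _ _ (hf _ _ (by omega))

namespace IsStationaryGaussianVAR

variable {Φ : Fin d → Matrix (Fin p) (Fin p) ℝ} (hx : IsStationaryGaussianVAR Φ ε x P)
include hx

lemma innovation_mem_pastSpan (i : ℤ × Fin p) : coord ε i ∈ pastSpan x P i.1 := by
  have h1 : coord x i - (fun ω => ∑ k : Fin d, ∑ b : Fin p,
      Φ k i.2 b * coord x (i.1 - ((k : ℤ) + 1), b) ω) ∈ pastSpan x P i.1 :=
    Submodule.sub_mem _ (coord_mem_pastSpan le_rfl)
      (sum_add_mem_pastSpan i.2 fun s b hs => coord_mem_pastSpan hs.le)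
  refine pastSpan_congr h1 ?_
  filter_upwards [ae_coord_eq (hx.recursion i.1) i.2] with ω hω
  rw [Pi.sub_apply, show coord x i ω = coord x (i.1, i.2) ω from rfl, hω]
  ring_nf

lemma memLp_of_mem_pastSpan {t : ℤ} {g : Ω → ℝ} (hg : g ∈ pastSpan x P t) : MemLp g 2 P := by
  obtain ⟨α, -, h⟩ := hg
  exact (memLp_congr_ae h).mpr (memLp_funComb hx.memLp_coord α)

lemma law_of_mem_pastSpan (hmean : ∀ i, ∫ ω, coord x i ω ∂P = 0) {t : ℤ} {g : Ω → ℝ}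
    (hg : g ∈ pastSpan x P t) :
    P.map g = gaussianReal 0 (∫ ω, g ω ^ 2 ∂P).toNNReal := by
  have hgm := hx.memLp_of_mem_pastSpan hg
  obtain ⟨α, -, h⟩ := hg
  have hG : HasGaussianLaw g P := (hx.hasGaussianLaw_funComb α).congr h.symm
  have := hG.isProbabilityMeasure
  have h0 : ∫ ω, g ω ∂P = 0 := by
    rw [integral_congr_ae h]
    simp only [funComb]
    rw [integral_finsetSum]
    · refine Finset.sum_eq_zero fun i _ => ?_
      rw [integral_const_mul, hmean, mul_zero]
    · exact fun i _ => ((hx.memLp_coord i).integrable one_le_two).const_mul _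
  rw [hG.map_eq_gaussianReal, h0, variance_of_integral_eq_zero hgm.1.aemeasurable h0]

/-- Members of the span are almost surely functions of the path of `x` before time `t`, of which the
innovation is independent. The family is treated jointly because the martingale inequality needs
independence from the whole past at once. -/
lemma indepFun_innovation {ι : Type*} [Countable ι] {t : ℤ} {g : ι → Ω → ℝ}
    (hg : ∀ i, g i ∈ pastSpan x P (t - 1)) (a : Fin p) :
    IndepFun (fun ω i => g i ω) (coord ε (t, a)) P := by
  classical
  choose α hα h using hg
  let ext : (Set.Iio t → EuclideanSpace ℝ (Fin p)) → ℤ × Fin p → ℝ := fun z i =>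
    if hi : i.1 < t then z ⟨i.1, hi⟩ i.2 else 0
  have hext : ∀ i, Measurable fun z => ext z i := by
    intro i
    by_cases hi : i.1 < t
    · simp only [ext, hi, dif_pos]
      fun_prop
    · simp only [ext, hi, dif_neg, not_false_eq_true]
      fun_prop
  let φ : (Set.Iio t → EuclideanSpace ℝ (Fin p)) → ι → ℝ := fun z i =>
    ∑ j ∈ (α i).support, α i j * ext z j
  have hφ : Measurable φ := by
    refine measurable_pi_lambda _ fun i => ?_
    exact Finset.measurable_fun_sum _ fun j _ => (hext j).const_mul _
  have hcoord : Measurable fun v : EuclideanSpace ℝ (Fin p) => v a := by fun_prop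
  have h1 := ((hx.innovation t).comp hcoord hφ).symm
  refine h1.congr ?_ (Eventually.of_forall fun _ => rfl)
  filter_upwards [ae_all_iff.mpr h] with ω hω
  funext i
  rw [hω i]
  simp only [Function.comp_apply, φ, funComb]
  refine Finset.sum_congr rfl fun j hj => ?_
  have hjt : j.1 < t := by
    have : j.1 ≤ t - 1 := (hα i).mem hj
    omega
  simp [ext, hjt, coord]

end IsStationaryGaussianVAR

namespace Params

variable {n m₀ : ℕ} {M : Params n p d m₀} {y : ℤ → Ω → EuclideanSpace ℝ (Fin p)}

/-- The coordinates of the observed series, up to the last observation. -/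
def obs (n d : ℕ) (y : ℤ → Ω → EuclideanSpace ℝ (Fin p)) (i : ℤ × Fin p) : Ω → ℝ :=
  if i.1 < (n + d : ℕ) then coord y i else 0

omit [MeasurableSpace Ω] in
lemma obs_of_lt {i : ℤ × Fin p} (h : i.1 < (n + d : ℕ)) : obs n d y i = coord y i := if_pos h

/-- The series starts as the first stationary process, and every innovation is itself a combination
of that process, so all regimes stay in its span. Gaussianity, centring and independence of later
innovations all follow from this. The model does not describe `y` after the last observation, which
is why `obs` is cut off there. -/
lemma obs_mem_pastSpan {Φ : Fin d → Matrix (Fin p) (Fin p) ℝ}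
    (hx : IsStationaryGaussianVAR Φ ε x P) (hsol : M.IsSolution P ε x y) (i : ℤ × Fin p) :
    obs n d y i ∈ pastSpan x P i.1 := by
  have key : ∀ (k : ℕ) (t : ℤ) (a : Fin p), t < k → t < (n + d : ℕ) →
      coord y (t, a) ∈ pastSpan x P t := by
    intro k
    induction k with
    | zero =>
      intro t a ht _
      refine pastSpan_congr (coord_mem_pastSpan (i := (t, a)) le_rfl) ?_
      filter_upwards [hsol.initial t (by simpa using ht)] with ω hω
      simp only [coord, hω]
    | succ k ih =>
      intro t a htk ht
      by_cases ht0 : t < 0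
      · refine pastSpan_congr (coord_mem_pastSpan (i := (t, a)) le_rfl) ?_
        filter_upwards [hsol.initial t ht0] with ω hω
        simp only [coord, hω]
      lift t to ℕ using by omega
      obtain ⟨j, hj1, hj2⟩ := exists_regime M.brk_zero (t := t)
        (by rw [M.brk_last]; exact_mod_cast ht)
      have hmem := Submodule.add_mem _
        (sum_add_mem_pastSpan (Φ := M.coeff j) (f := coord y) (x := x) (P := P) (t := t) a
          fun s b hs => pastSpan_mono hs.le (ih s b (by push_cast at htk; omega) (by omega)))
        (hx.innovation_mem_pastSpan ((t : ℤ), a))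
      refine pastSpan_congr hmem ?_
      filter_upwards [ae_coord_eq (hsol.recursion j t (by exact_mod_cast hj1)
        (by exact_mod_cast hj2)) a] with ω hω
      rw [hω]; rfl
  obtain ⟨t, a⟩ := i
  by_cases ht : t < (n + d : ℕ)
  · rw [obs_of_lt ht]
    exact key (t.toNat + 1) t a (by push_cast; omega) ht
  · rw [obs, if_neg ht]
    exact Submodule.zero_mem _

variable {xs : Fin (m₀ + 1) → ℤ → Ω → EuclideanSpace ℝ (Fin p)} {mf Mf : ℝ}

/-- The variance of a linear combination of the observations is bounded by a constant times the sum
of the squares of its coefficients. -/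
lemma integral_funComb_obs_sq_le [IsProbabilityMeasure P]
    (hε : IsGaussianWhiteNoise ε M.noiseCov P) (hsol : M.IsSolution P ε (xs 0) y)
    (hA : M.AssumptionA1 P ε xs Mf mf) (hmf : 0 < mf) (hMf : 0 < Mf) {k : ℕ}
    (hk : 4 * (Mf / mf) ^ 4 ≤ k) (hk0 : 0 < k)
    (hlong : ∀ j : Fin (m₀ + 1), M.brk j.castSucc + (k + 1) * d ≤ M.brk j.succ)
    (α : Coef p) (hα : LivesOn (Set.Iio ((n + d : ℕ) : ℤ)) α) :
    ∫ ω, funComb (obs n d y) α ω ^ 2 ∂P ≤ pieceBound (2 * Real.pi * Mf) (Mf / mf) * sqSum α := by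
  have hpi := Real.pi_pos
  have hst := hA.stationary
  have hB := fun j => (hst j).isBoundedAR_and_centered hε (hA.density j) hmf hMf (hA.upper j)
    (hA.lower j)
  have hR := (hB 0).2.2
  have hmem := fun i => obs_mem_pastSpan (hst 0) hsol i
  have hLp : ∀ i, MemLp (obs n d y i) 2 P := fun i => (hst 0).memLp_of_mem_pastSpan (hmem i)
  have hsolve : ∀ j : Fin (m₀ + 1), SolvesAR (M.coeff j)
      (Set.Ico (M.brk j.castSucc : ℤ) (M.brk j.succ)) (lpVec (obs n d y) hLp)
      (lpVec (coord ε) hε.memLp_coord) := by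
    intro j
    refine solvesAR_lpVec _ _ fun i hi => ?_
    have hlt : i.1 < (n + d : ℕ) := by
      have h1 := hi.2
      have h2 : M.brk j.succ ≤ M.brk (Fin.last _) := M.brk_strictMono.monotone (Fin.le_last _)
      rw [M.brk_last] at h2
      omega
    filter_upwards [ae_coord_eq (hsol.recursion j i.1 hi.1 hi.2) i.2] with ω hω
    rw [obs_of_lt hlt, show coord y i ω = coord y (i.1, i.2) ω from rfl, hω]
    congr 1
    refine Finset.sum_congr rfl fun k _ => Finset.sum_congr rfl fun b _ => ?_
    rw [obs_of_lt (by simp only; omega)]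
  have hspan : ∀ i : ℤ × Fin p, ∃ α : Coef p, LivesOn (Set.Iic i.1) α ∧
      lpVec (obs n d y) hLp i = comb (lpVec (coord (xs 0)) (hst 0).memLp_coord) α := by
    intro i
    obtain ⟨α, hα, h⟩ := hmem i
    refine ⟨α, hα, Lp.ext ?_⟩
    exact ((hLp i).coeFn_toLp.trans h).trans (coeFn_comb _ α).symm
  -- Whatever the regime, an observation is a combination of the first stationary process up to its
  -- own time and inherits orthogonality to later innovations.
  have horth : ∀ i j : ℤ × Fin p, 0 ≤ i.1 → i.1 < M.brk (Fin.last _) → j.1 < i.1 →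
      inner ℝ (lpVec (coord ε) hε.memLp_coord i) (lpVec (obs n d y) hLp j) = 0 := by
    intro i j _ _ hij
    obtain ⟨α, hα, h⟩ := hspan j
    rw [h, comb_eq_sum_support, inner_sum]
    refine Finset.sum_eq_zero fun l hl => ?_
    rw [inner_smul_right, hR.orth i l (lt_of_le_of_lt (hα.mem hl) hij), mul_zero]
  have hpast : ∀ α : Coef p, LivesOn (Set.Iio 0) α →
      ‖comb (lpVec (obs n d y) hLp) α‖ ^ 2 ≤ 2 * Real.pi * Mf * sqSum α := by
    intro α hα
    refine le_trans (le_of_eq ?_) (hR.upper α)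
    rw [comb_eq_sum_support, comb_eq_sum_support]
    congr 2
    refine Finset.sum_congr rfl fun i hi => ?_
    congr 1
    have hi0 : i.1 < 0 := hα.mem hi
    refine (MemLp.toLp_eq_toLp_iff _ _).mpr ?_
    rw [obs_of_lt (by omega)]
    filter_upwards [hsol.initial i.1 hi0] with ω hω
    simp only [coord, hω]
  rw [← norm_comb_sq hLp]
  exact norm_comb_sq_le_pieceBound M.brk_zero (by positivity) (fun j => (hB j).1) hk hk0 hlong
    hsolve (fun β => (hR.innovation_bounds (by positivity) β).2) horth M.brk_strictMono.monotone
    hpast α (by rw [M.brk_last]; exact hα)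

/-- The innovations have variance at most `2πMf`. -/
lemma law_innovation [IsProbabilityMeasure P]
    (hε : IsGaussianWhiteNoise ε M.noiseCov P)
    (hA : M.AssumptionA1 P ε xs Mf mf) (hmf : 0 < mf) (hMf : 0 < Mf) (i : ℤ × Fin p) :
    ∃ v : ℝ≥0, (v : ℝ) ≤ 2 * Real.pi * Mf ∧ P.map (coord ε i) = gaussianReal 0 v := by
  have hpi := Real.pi_pos
  obtain ⟨-, hmean, hR⟩ := (hA.stationary 0).isBoundedAR_and_centered hε (hA.density 0) hmf hMf
    (hA.upper 0) (hA.lower 0)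
  refine ⟨_, ?_, (hA.stationary 0).law_of_mem_pastSpan hmean
    ((hA.stationary 0).innovation_mem_pastSpan i)⟩
  rw [Real.coe_toNNReal _ (integral_nonneg fun _ => sq_nonneg _)]
  have h1 := (hR.innovation_bounds (by positivity) (Finsupp.single i 1)).2
  rw [norm_comb_sq] at h1
  have h2 : sqSum (Finsupp.single i (1 : ℝ) : Coef p) = 1 := by
    rw [sqSum_eq_sum (s := {i}) Finsupp.support_single_subset]; simp
  have h3 : ∀ ω, funComb (coord ε) (Finsupp.single i 1) ω = coord ε i ω := by
    intro ω
    rw [funComb_eq_sum (s := {i}) Finsupp.support_single_subset]; simp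
  simp_rw [h3] at h1
  rwa [h2, mul_one] at h1

/-- The observations of one coordinate are jointly Gaussian with bounded covariance. -/
lemma law_sum_obs [IsProbabilityMeasure P]
    (hε : IsGaussianWhiteNoise ε M.noiseCov P) (hsol : M.IsSolution P ε (xs 0) y)
    (hA : M.AssumptionA1 P ε xs Mf mf) (hmf : 0 < mf) (hMf : 0 < Mf) {k : ℕ}
    (hk : 4 * (Mf / mf) ^ 4 ≤ k) (hk0 : 0 < k)
    (hlong : ∀ j : Fin (m₀ + 1), M.brk j.castSucc + (k + 1) * d ≤ M.brk j.succ)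
    (b : Fin p) (c : Fin (n + d) → ℝ) :
    ∃ v : ℝ≥0, (v : ℝ) ≤ pieceBound (2 * Real.pi * Mf) (Mf / mf) * ∑ t, c t ^ 2 ∧
      P.map (fun ω => ∑ t, c t * obs n d y ((t : ℕ), b) ω) = gaussianReal 0 v := by
  classical
  have hmean := ((hA.stationary 0).isBoundedAR_and_centered hε (hA.density 0) hmf hMf
    (hA.upper 0) (hA.lower 0)).2.1
  have hmem : (fun ω => ∑ t, c t * obs n d y (((t : ℕ) : ℤ), b) ω) ∈
      pastSpan (xs 0) P ((n + d : ℕ) : ℤ) := by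
    have h : (fun ω => ∑ t, c t * obs n d y (((t : ℕ) : ℤ), b) ω) =
        ∑ t, c t • obs n d y (((t : ℕ) : ℤ), b) := by
      funext ω; simp [Finset.sum_apply]
    rw [h]
    refine Submodule.sum_mem _ fun t _ => Submodule.smul_mem _ _ ?_
    have h := obs_mem_pastSpan (n := n) (hA.stationary 0) hsol (((t : ℕ) : ℤ), b)
    exact pastSpan_mono (Int.ofNat_le.mpr t.2.le) h
  refine ⟨_, ?_, (hA.stationary 0).law_of_mem_pastSpan hmean hmem⟩
  rw [Real.coe_toNNReal _ (integral_nonneg fun _ => sq_nonneg _)]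
  let emb : Fin (n + d) ↪ ℤ × Fin p := ⟨fun t => (((t : ℕ) : ℤ), b), fun s t hst => by
    simp only [Prod.mk.injEq, Nat.cast_inj, and_true] at hst
    exact Fin.ext hst⟩
  let α : Coef p := Finsupp.embDomain emb (Finsupp.equivFunOnFinite.symm c)
  have hαsupp : α.support ⊆ Finset.univ.map emb := by
    rw [Finsupp.support_embDomain]
    exact Finset.map_subset_map.mpr (Finset.subset_univ _)
  have hαval : ∀ t, α (emb t) = c t := fun t => by
    simp [α, Finsupp.embDomain_apply_self]
  have hα : LivesOn (Set.Iio ((n + d : ℕ) : ℤ)) α := by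
    intro i hi
    by_contra hne
    obtain ⟨t, -, rfl⟩ := Finset.mem_map.mp (hαsupp (Finsupp.mem_support_iff.mpr hne))
    apply hi
    change ((t : ℕ) : ℤ) < ((n + d : ℕ) : ℤ)
    exact_mod_cast t.2
  have h1 := integral_funComb_obs_sq_le hε hsol hA hmf hMf hk hk0 hlong α hα
  have h2 : sqSum α = ∑ t, c t ^ 2 := by
    rw [sqSum_eq_sum hαsupp, Finset.sum_map]
    simp_rw [hαval]
  have h3 : ∀ ω, funComb (obs n d y) α ω = ∑ t, c t * obs n d y (((t : ℕ) : ℤ), b) ω := by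
    intro ω
    rw [funComb_eq_sum hαsupp, Finset.sum_map]
    simp_rw [hαval]
    rfl
  simp_rw [h3] at h1
  rwa [h2] at h1

end Params

end Observed

end BreakVAR

namespace BreakVAR

/-! ### The deviation bound for the score -/

section Deviation

variable {Ω : Type u} [MeasurableSpace Ω] {P : Measure Ω} {n p d m₀ : ℕ}

lemma pieceBound_pos {Mf κ : ℝ} (hMf : 0 < Mf) (hκ : 0 < κ) : 0 < pieceBound Mf κ := by
  rw [pieceBound]; positivity

/-- The entries of the design as they enter the score, extended to all rows. -/
def scoreFactor (n d : ℕ) (y : ℤ → Ω → EuclideanSpace ℝ (Fin p)) (q : Fin n × Fin d × Fin p) (k : ℕ) :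
    Ω → ℝ :=
  if (q.1 : ℕ) ≤ k then Params.obs n d y ((d : ℤ) + k - ((q.2.1 : ℤ) + 1), q.2.2) else 0

omit [MeasurableSpace Ω] in
lemma designMat_eq_scoreFactor (y : ℤ → Ω → EuclideanSpace ℝ (Fin p)) (q : Fin n × Fin d × Fin p)
    (r : Fin n) (ω : Ω) : designMat n d (fun t => y t ω) r q = scoreFactor n d y q r ω := by
  simp only [designMat, Matrix.of_apply, scoreFactor, Fin.le_def]
  split_ifs with h
  · rw [Params.obs_of_lt (by simp only; push_cast; omega)]
    rfl
  · rfl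

-- Each column of the design runs through a stretch of a single coordinate of the series. Thus `p`
-- events control the square sums of all columns.
omit [MeasurableSpace Ω] in
lemma sum_scoreFactor_sq_le (y : ℤ → Ω → EuclideanSpace ℝ (Fin p)) (q : Fin n × Fin d × Fin p)
    (ω : Ω) : ∑ k ∈ Finset.range n, scoreFactor n d y q k ω ^ 2 ≤
      ∑ t : Fin (n + d), Params.obs n d y (((t : ℕ) : ℤ), q.2.2) ω ^ 2 := by
  let g : ℕ → ℝ := fun t => Params.obs n d y ((t : ℤ), q.2.2) ω ^ 2
  -- Row `k` reads the time `d + k - (l + 1) = c + k`, where `l` is the lag index counted from zero;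
  -- the rows cover `[c, c + n)`, inside `[0, n + d)`.
  set c : ℕ := d - 1 - q.2.1 with hc
  have hl := q.2.1.2
  have h1 : ∀ k ∈ Finset.range n, scoreFactor n d y q k ω ^ 2 ≤ g (c + k) := by
    intro k _
    simp only [scoreFactor, g]
    split_ifs with h
    · rw [show (d : ℤ) + k - ((q.2.1 : ℤ) + 1) = ((c + k : ℕ) : ℤ) by omega]
    · rw [Pi.zero_apply, zero_pow two_ne_zero]
      positivity
  refine (Finset.sum_le_sum h1).trans ?_
  have h2 := Finset.sum_Ico_eq_sum_range g c (c + n)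
  rw [Nat.add_sub_cancel_left] at h2
  rw [← h2, ← Finset.sum_range (fun t => g t)]
  refine Finset.sum_le_sum_of_subset_of_nonneg (fun t ht => ?_) fun t _ _ => sq_nonneg _
  rw [Finset.mem_Ico] at ht
  rw [Finset.mem_range]
  omega

namespace Params

variable {M : Params n p d m₀} {y ε : ℤ → Ω → EuclideanSpace ℝ (Fin p)}
  {xs : Fin (m₀ + 1) → ℤ → Ω → EuclideanSpace ℝ (Fin p)} {mf Mf : ℝ}

/-- The score exceeds its threshold with small probability. -/
lemma measure_score_gt_le [IsProbabilityMeasure P]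
    (hε : IsGaussianWhiteNoise ε M.noiseCov P) (hsol : M.IsSolution P ε (xs 0) y)
    (hA : M.AssumptionA1 P ε xs Mf mf) (hmf : 0 < mf) (hMf : 0 < Mf) {k : ℕ}
    (hk : 4 * (Mf / mf) ^ 4 ≤ k) (hk0 : 0 < k)
    (hlong : ∀ j : Fin (m₀ + 1), M.brk j.castSucc + (k + 1) * d ≤ M.brk j.succ)
    (hn : 0 < n) {A K : ℝ} (hA0 : 0 ≤ A) (hK : K = pieceBound (2 * Real.pi * Mf) (Mf / mf)) :
    P {ω | ∃ (a : Fin p) (q : Fin n × Fin d × Fin p),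
        A < |∑ r : Fin n, designMat n d (fun t => y t ω) r q * ε ((d : ℤ) + r) ω a|} ≤
      p * ENNReal.ofReal (Real.exp (-((n + d : ℕ) : ℝ) / 2)) +
        (p * (n * (d * p)) : ℕ) * (2 * ENNReal.ofReal
          (Real.exp (-(A ^ 2 / (2 * (2 * Real.pi * Mf) * (4 * K * (n + d : ℕ))))))) := by
  have hpi := Real.pi_pos
  have hKpos : 0 < K := hK ▸ pieceBound_pos (by positivity) (by positivity)
  have hst := hA.stationary 0
  have hmem := fun i => obs_mem_pastSpan (n := n) hst hsol i
  have hobs : ∀ i, AEMeasurable (obs n d y i) P := fun i =>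
    (hst.memLp_of_mem_pastSpan (hmem i)).1.aemeasurable
  set V : ℝ := 4 * K * (n + d : ℕ) with hV
  have hVpos : 0 < V := by
    have : (0 : ℝ) < (n + d : ℕ) := by exact_mod_cast (by omega : 0 < n + d)
    positivity
  -- `B₁ b`: the square sum of coordinate `b` is too large. `B₂ (a, q)`: an entry of the score is
  -- large although its square sum is under control.
  let B₁ : Fin p → Set Ω := fun b =>
    {ω | V ≤ ∑ t : Fin (n + d), obs n d y (((t : ℕ) : ℤ), b) ω ^ 2}
  let B₂ : Fin p × (Fin n × Fin d × Fin p) → Set Ω := fun aq =>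
    {ω | A ≤ |∑ k ∈ Finset.range n, scoreFactor n d y aq.2 k ω * coord ε ((d : ℤ) + k, aq.1) ω| ∧
      ∑ k ∈ Finset.range n, scoreFactor n d y aq.2 k ω ^ 2 ≤ V}
  have hB₁ : ∀ b, P (B₁ b) ≤ ENNReal.ofReal (Real.exp (-((n + d : ℕ) : ℝ) / 2)) := by
    intro b
    have h := measure_sum_sq_ge_le (P := P)
      (Y := fun t : Fin (n + d) => obs n d y (((t : ℕ) : ℤ), b)) (fun t => hobs _) hKpos
      (fun c => by rw [hK]; exact law_sum_obs hε hsol hA hmf hMf hk hk0 hlong b c)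
    rw [Fintype.card_fin] at h
    exact h
  have hscore : ∀ (q : Fin n × Fin d × Fin p) (k : ℕ),
      scoreFactor n d y q k ∈ pastSpan (xs 0) P ((d : ℤ) + k - 1) := by
    intro q k
    rw [scoreFactor]
    split_ifs
    · exact pastSpan_mono (by simp only; omega) (hmem _)
    · exact Submodule.zero_mem _
  have hB₂ : ∀ aq, P (B₂ aq) ≤ 2 * ENNReal.ofReal
      (Real.exp (-(A ^ 2 / (2 * (2 * Real.pi * Mf) * V)))) := by
    rintro ⟨a, q⟩
    refine measure_abs_martingale_ge_le (by positivity)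
      (fun k => (hst.memLp_of_mem_pastSpan (hscore q k)).1.aemeasurable)
      (e := fun k => coord ε ((d : ℤ) + k, a))
      (fun k => (hε.memLp_coord _).1.aemeasurable)
      (fun k _ => law_innovation hε hA hmf hMf _) (fun k _ => ?_) hA0 hVpos
    -- The earlier factors, the earlier innovations and the current factor as one family, all known
    -- by time `d + k - 1`.
    let g : Fin k ⊕ (Fin k ⊕ Unit) → Ω → ℝ :=
      Sum.elim (fun i => scoreFactor n d y q i)
        (Sum.elim (fun i => coord ε ((d : ℤ) + (i : ℕ), a)) fun _ => scoreFactor n d y q k)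
    have hg : ∀ i, g i ∈ pastSpan (xs 0) P ((d : ℤ) + k - 1) := by
      rintro (i | i | i)
      · exact pastSpan_mono (by omega) (hscore q i)
      · exact pastSpan_mono (by simp only; omega) (hst.innovation_mem_pastSpan _)
      · exact hscore q k
    exact (hst.indepFun_innovation hg a).comp
      (φ := fun w : Fin k ⊕ (Fin k ⊕ Unit) → ℝ =>
        ((fun i : Fin k => (w (Sum.inl i), w (Sum.inr (Sum.inl i)))), w (Sum.inr (Sum.inr ()))))
      (ψ := id) (by fun_prop) measurable_id
  have hsub : {ω | ∃ (a : Fin p) (q : Fin n × Fin d × Fin p),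
      A < |∑ r : Fin n, designMat n d (fun t => y t ω) r q * ε ((d : ℤ) + r) ω a|} ⊆
      (⋃ b, B₁ b) ∪ ⋃ aq, B₂ aq := by
    rintro ω ⟨a, q, h⟩
    by_cases hb : V ≤ ∑ t : Fin (n + d), obs n d y (((t : ℕ) : ℤ), q.2.2) ω ^ 2
    · exact Or.inl (Set.mem_iUnion.mpr ⟨q.2.2, hb⟩)
    · refine Or.inr (Set.mem_iUnion.mpr ⟨(a, q), ?_, ?_⟩)
      · refine h.le.trans (le_of_eq ?_)
        rw [Finset.sum_range]
        congr 1
        refine Finset.sum_congr rfl fun r _ => ?_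
        rw [designMat_eq_scoreFactor]; rfl
      · exact (sum_scoreFactor_sq_le y q ω).trans (not_le.mp hb).le
  refine (measure_mono hsub).trans ((measure_union_le _ _).trans (add_le_add ?_ ?_))
  · refine (measure_iUnion_fintype_le _ _).trans ((Finset.sum_le_sum fun b _ => hB₁ b).trans ?_)
    simp
  · refine (measure_iUnion_fintype_le _ _).trans ((Finset.sum_le_sum fun b _ => hB₂ b).trans ?_)
    simp

/-- Off the event of a large score the oracle inequality holds almost surely. -/
lemma ae_predError_le_or (hn : 0 < n) (hsol : M.IsSolution P ε (xs 0) y) {lam : ℝ} (hlam : 0 ≤ lam)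
    {Θ₁ : Ω → Fin p × (Fin n × Fin d × Fin p) → ℝ}
    (hest : ∀ᵐ ω ∂P, IsEstimate (fun t => y t ω) lam (Θ₁ ω)) {MΦ : ℝ} (hM : 0 ≤ MΦ)
    (hb : ∀ j a lk, |M.row j a lk| ≤ MΦ) :
    ∀ᵐ ω ∂P, predError (fun t => y t ω) (Θ₁ ω) M.theta ≤
        lam * ((m₀ + 1) * (M.maxJumpNnz * MΦ)) ∨
      ∃ (a : Fin p) (q : Fin n × Fin d × Fin p), n * (lam / 2) <
        |∑ r : Fin n, designMat n d (fun t => y t ω) r q * ε ((d : ℤ) + r) ω a| := by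
  have hrec : ∀ᵐ ω ∂P, ∀ (r : Fin n) (a : Fin p), y ((d : ℤ) + r) ω a =
      (∑ lk : Fin d × Fin p, M.coeffAt (d + r) a lk *
        y ((d : ℤ) + r - ((lk.1 : ℤ) + 1)) ω lk.2) + ε ((d : ℤ) + r) ω a := by
    refine ae_all_iff.mpr fun r => ae_all_iff.mpr fun a => ?_
    obtain ⟨j, hj⟩ := exists_regime M.brk_zero (t := d + r) (by rw [M.brk_last]; omega)
    filter_upwards [ae_coord_eq (hsol.recursion j ((d : ℤ) + r) (by exact_mod_cast hj.1)
      (by exact_mod_cast hj.2)) a] with ω hω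
    rw [M.coeffAt_eq_row hj, Fintype.sum_prod_type]
    exact hω
  filter_upwards [hrec, hest] with ω h1 h2
  by_cases h3 : ∃ (a : Fin p) (q : Fin n × Fin d × Fin p), n * (lam / 2) <
      |∑ r : Fin n, designMat n d (fun t => y t ω) r q * ε ((d : ℤ) + r) ω a|
  · exact Or.inr h3
  · left
    push Not at h3
    refine (predError_le M hn hlam (e := fun t => ε t ω) h2 h1 h3).trans ?_
    exact mul_le_mul_of_nonneg_left (M.sum_blockL1_theta_le hM hb) hlam

end Params

/-- A lower bound for the outer measure of a set whose complement is almost surely in a small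
set. -/
lemma one_sub_le_measure_of_ae_or [IsProbabilityMeasure P] {s t : Set Ω} {c : ℝ≥0∞}
    (h : ∀ᵐ ω ∂P, ω ∈ s ∨ ω ∈ t) (ht : P t ≤ c) : 1 - c ≤ P s := by
  rw [tsub_le_iff_right]
  have h1 : (1 : ℝ≥0∞) ≤ P (s ∪ t) := by
    have h2 : P (s ∪ t)ᶜ = 0 := h
    have h3 := measure_univ_le_add_compl (μ := P) (s ∪ t)
    rwa [h2, add_zero, measure_univ] at h3
  exact h1.trans ((measure_union_le _ _).trans (by gcongr))

end Deviation

end BreakVAR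

/-! ### Choice of constants and passage to the limit -/

namespace BreakVAR

lemma rate_nonneg (n p d : ℕ) : 0 ≤ rate n p d := Real.sqrt_nonneg _

/-- The rate is calibrated to the union bound: the right-hand side is the number of entries of the
score. -/
lemma exp_mul_rate_sq {n p d : ℕ} (hn : 0 < n) (hp : 0 < p) (hd : 0 < d) :
    Real.exp (n * rate n p d ^ 2) = (p * (n * (d * p)) : ℕ) := by
  have h : (0 : ℝ) ≤ (Real.log n + 2 * Real.log p + Real.log d) / n := by
    have h1 := Real.log_natCast_nonneg n
    have h2 := Real.log_natCast_nonneg p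
    have h3 := Real.log_natCast_nonneg d
    positivity
  have hn' : (n : ℝ) ≠ 0 := by positivity
  rw [rate, Real.sq_sqrt h, mul_div_cancel₀ _ hn', Real.exp_add, Real.exp_add, two_mul,
    Real.exp_add, Real.exp_log (by positivity), Real.exp_log (by positivity),
    Real.exp_log (by positivity)]
  push_cast
  ring

section Limit

variable {Ω : Type u} [MeasurableSpace Ω] {P : Measure Ω} {n p d m₀ : ℕ}
  {M : Params n p d m₀} {y ε : ℤ → Ω → EuclideanSpace ℝ (Fin p)}
  {xs : Fin (m₀ + 1) → ℤ → Ω → EuclideanSpace ℝ (Fin p)} {mf Mf : ℝ}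

lemma Params.brk_add_le_of_minSegment (hd : 0 < d) {k : ℕ}
    (h : (k : ℝ) ≤ M.minSegment / d) (j : Fin (m₀ + 1)) :
    M.brk j.castSucc + k * d ≤ M.brk j.succ := by
  rw [le_div_iff₀ (by exact_mod_cast hd)] at h
  have h2 : M.minSegment ≤ (M.brk j.succ : ℝ) - (M.brk j.castSucc : ℝ) :=
    ciInf_le (Set.finite_range _).bddBelow j
  have h3 : ((M.brk j.castSucc + k * d : ℕ) : ℝ) ≤ M.brk j.succ := by
    push_cast; linarith
  exact_mod_cast h3

/-- The nonasymptotic form of the oracle inequality. -/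
lemma Params.one_sub_le_measure_predError_le [IsProbabilityMeasure P]
    (hn : 0 < n) (hp : 0 < p) (hd : 0 < d)
    (hε : IsGaussianWhiteNoise ε M.noiseCov P) (hsol : M.IsSolution P ε (xs 0) y)
    (hA : M.AssumptionA1 P ε xs Mf mf) (hmf : 0 < mf) (hMf : 0 < Mf) {k : ℕ}
    (hk : 4 * (Mf / mf) ^ 4 ≤ k) (hk0 : 0 < k)
    (hlong : ∀ j : Fin (m₀ + 1), M.brk j.castSucc + (k + 1) * d ≤ M.brk j.succ)
    {C : ℝ} (hC0 : 0 < C)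
    (hC : 64 * Real.pi * Mf * pieceBound (2 * Real.pi * Mf) (Mf / mf) ≤ C ^ 2)
    (hrate : rate n p d ≤ 1 / 2)
    {Θ₁ : Ω → Fin p × (Fin n × Fin d × Fin p) → ℝ}
    (hest : ∀ᵐ ω ∂P, IsEstimate (fun t => y t ω) (2 * C * rate n p d) (Θ₁ ω))
    {MΦ : ℝ} (hM : 0 ≤ MΦ) (hb : ∀ j a lk, |M.row j a lk| ≤ MΦ)
    {m : ℝ} (hm : (m₀ : ℝ) ≤ m) (hm1 : 1 ≤ m) :
    1 - ENNReal.ofReal (Real.exp (-(n : ℝ) / 4) + 2 / n) ≤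
      P {ω | predError (fun t => y t ω) (Θ₁ ω) M.theta ≤
        4 * C * m * (M.maxJumpNnz : ℝ) * MΦ * rate n p d} := by
  have hr := rate_nonneg n p d
  set K := pieceBound (2 * Real.pi * Mf) (Mf / mf) with hK
  have hKpos : 0 < K := pieceBound_pos (by positivity) (by positivity)
  have hn' : (0 : ℝ) < n := by exact_mod_cast hn
  have hp' : (1 : ℝ) ≤ p := by exact_mod_cast hp
  -- The first segment alone takes at least `2d` of the `n + d` times, as `k ≥ 1`.
  have hdn : d ≤ n := by
    have h1 := hlong 0
    have h2 : M.brk (Fin.succ 0) ≤ M.brk (Fin.last (m₀ + 1)) :=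
      M.brk_strictMono.monotone (Fin.le_last _)
    rw [M.brk_last] at h2
    have h3 : 2 * d ≤ (k + 1) * d := Nat.mul_le_mul_right _ (by omega)
    omega
  have hnd : ((n + d : ℕ) : ℝ) ≤ 2 * n := by
    have : (d : ℝ) ≤ n := by exact_mod_cast hdn
    push_cast; linarith
  have hdims := exp_mul_rate_sq hn hp hd
  set L := (n : ℝ) * rate n p d ^ 2 with hL
  have hLn : L ≤ n / 4 := by
    have h : rate n p d ^ 2 ≤ (1 / 2) ^ 2 := by gcongr
    rw [hL]
    refine (mul_le_mul_of_nonneg_left h hn'.le).trans (le_of_eq ?_)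
    ring
  have hL0 : 0 ≤ L := by positivity
  have hpL : (p : ℝ) ≤ Real.exp L := by
    rw [hdims]
    exact_mod_cast Nat.le_mul_of_pos_right p (by positivity)
  have hnL : (n : ℝ) ≤ Real.exp L := by
    rw [hdims]
    exact_mod_cast (Nat.le_mul_of_pos_right n (by positivity : 0 < d * p)).trans
      (Nat.le_mul_of_pos_left _ hp)
  have hbad : P {ω | ∃ (a : Fin p) (q : Fin n × Fin d × Fin p), n * (2 * C * rate n p d / 2) <
      |∑ r : Fin n, designMat n d (fun t => y t ω) r q * ε ((d : ℤ) + r) ω a|} ≤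
      ENNReal.ofReal (Real.exp (-(n : ℝ) / 4) + 2 / n) := by
    refine (measure_score_gt_le hε hsol hA hmf hMf hk hk0 hlong hn (by positivity) hK).trans ?_
    -- The numerator is `C² n L` and the denominator at most `32 π Mf K n`, which is where the
    -- constant `64 π Mf K` comes from. An exponent of `2L` beats the `exp L` entries of the union
    -- bound and leaves `2 exp(-L) ≤ 2 / n`.
    have hexp : 2 * L ≤ (n * (2 * C * rate n p d / 2)) ^ 2 /
        (2 * (2 * Real.pi * Mf) * (4 * K * (n + d : ℕ))) := by
      have hpi := Real.pi_pos
      have hpos : (0 : ℝ) < (n + d : ℕ) := by exact_mod_cast (by omega : 0 < n + d)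
      rw [le_div_iff₀ (by positivity)]
      calc 2 * L * (2 * (2 * Real.pi * Mf) * (4 * K * (n + d : ℕ)))
          ≤ 2 * L * (2 * (2 * Real.pi * Mf) * (4 * K * (2 * n))) := by gcongr
        _ = (64 * Real.pi * Mf * K) * (n * L) := by ring
        _ ≤ C ^ 2 * (n * L) := by gcongr
        _ = _ := by rw [hL]; ring
    rw [ENNReal.ofReal_add (by positivity) (by positivity)]
    gcongr ?_ + ?_
    · rw [← ENNReal.ofReal_natCast p, ← ENNReal.ofReal_mul (by positivity)]
      refine ENNReal.ofReal_le_ofReal ?_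
      calc (p : ℝ) * Real.exp (-((n + d : ℕ) : ℝ) / 2)
          ≤ Real.exp L * Real.exp (-((n + d : ℕ) : ℝ) / 2) := by gcongr
        _ = Real.exp (L + -((n + d : ℕ) : ℝ) / 2) := (Real.exp_add _ _).symm
        _ ≤ _ := Real.exp_le_exp.mpr (by
          have : (0 : ℝ) ≤ d := Nat.cast_nonneg _
          push_cast; linarith)
    · rw [← ENNReal.ofReal_natCast (p * (n * (d * p))), ← hdims,
        ← ENNReal.ofReal_ofNat, ← ENNReal.ofReal_mul (by positivity),
        ← ENNReal.ofReal_mul (by positivity)]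
      refine ENNReal.ofReal_le_ofReal ?_
      calc Real.exp L * (2 * Real.exp (-((n * (2 * C * rate n p d / 2)) ^ 2 /
            (2 * (2 * Real.pi * Mf) * (4 * K * (n + d : ℕ))))))
          ≤ Real.exp L * (2 * Real.exp (-(2 * L))) := by gcongr
        _ = 2 * (Real.exp L * Real.exp (-(2 * L))) := by ring
        _ = 2 / Real.exp L := by
          rw [← Real.exp_add, show L + -(2 * L) = -L by ring, Real.exp_neg, div_eq_mul_inv]
        _ ≤ 2 / n := by gcongr
  refine (one_sub_le_measure_of_ae_or
    (ae_predError_le_or hn hsol (by positivity) hest hM hb) hbad).trans (measure_mono ?_)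
  intro ω hω
  refine le_trans (show predError (fun t => y t ω) (Θ₁ ω) M.theta ≤
    2 * C * rate n p d * ((m₀ + 1) * (M.maxJumpNnz * MΦ)) from hω) ?_
  have hJ : (0 : ℝ) ≤ M.maxJumpNnz := Nat.cast_nonneg _
  -- Since `m ≥ 1` and `m ≥ m₀`, the number `m₀ + 1` of blocks is at most `2m`; this accounts for
  -- the constant `4C`.
  calc 2 * C * rate n p d * ((m₀ + 1) * (M.maxJumpNnz * MΦ))
      ≤ 2 * C * rate n p d * ((2 * m) * (M.maxJumpNnz * MΦ)) := by
        gcongr; linarith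
    _ = _ := by ring

end Limit

lemma tendsto_one_sub_ofReal_exp_add :
    Tendsto (fun n : ℕ => 1 - ENNReal.ofReal (Real.exp (-(n : ℝ) / 4) + 2 / n)) atTop (𝓝 1) := by
  have h1 : Tendsto (fun n : ℕ => Real.exp (-(n : ℝ) / 4) + 2 / n) atTop (𝓝 (0 + 0)) := by
    refine Tendsto.add ?_ (tendsto_const_div_atTop_nhds_zero_nat 2)
    refine Real.tendsto_exp_atBot.comp ?_
    simp_rw [neg_div]
    exact tendsto_neg_atTop_atBot.comp (tendsto_natCast_atTop_atTop.atTop_div_const (by norm_num))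
  have h2 := ENNReal.tendsto_ofReal h1
  have h3 := ENNReal.Tendsto.sub (tendsto_const_nhds (x := (1 : ℝ≥0∞)) (f := atTop (α := ℕ))) h2
    (Or.inl ENNReal.one_ne_top)
  simpa using h3

/-- If `m ≥ 1` is negligible against `lam⁻¹` then `lam` tends to zero. -/
lemma eventually_abs_le_of_isLittleO_inv {m lam : ℕ → ℝ} (hm : ∀ n, 1 ≤ m n)
    (h : m =o[atTop] fun n => (lam n)⁻¹) {c : ℝ} (hc : 0 < c) :
    ∀ᶠ n in atTop, |lam n| ≤ c := by
  filter_upwards [h.bound hc] with n hn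
  rw [Real.norm_eq_abs, Real.norm_eq_abs, abs_inv, abs_of_pos (by linarith [hm n])] at hn
  rcases (abs_nonneg (lam n)).eq_or_lt with h0 | h0
  · rw [← h0]; exact hc.le
  · rw [← div_eq_mul_inv, le_div_iff₀ h0] at hn
    exact (le_mul_of_one_le_left h0.le (hm n)).trans hn

end BreakVAR

end

theorem theorem1 (Mf mf : ℝ) (hMf : 0 < Mf) (hmf : 0 < mf) :
    ∃ C₀ : ℝ, 0 < C₀ ∧ ∀ C : ℝ, C₀ ≤ C →
    -- the sequence of models
    ∀ (p d m₀ : ℕ → ℕ) (M : ∀ n, BreakVAR.Params n (p n) (d n) (m₀ n))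
      (Ω : ℕ → Type u) [∀ n, MeasurableSpace (Ω n)] (P : ∀ n, Measure (Ω n))
      [∀ n, IsProbabilityMeasure (P n)]
      (ε y : ∀ n, ℤ → Ω n → EuclideanSpace ℝ (Fin (p n)))
      (x : ∀ n, Fin (m₀ n + 1) → ℤ → Ω n → EuclideanSpace ℝ (Fin (p n)))
      (v v' MΦ : ℝ) (m lam : ℕ → ℝ)
      (Θhat : ∀ n, Ω n → (Fin (p n) × (Fin n × Fin (d n) × Fin (p n)) → ℝ)),
    (∀ n, 0 < p n) → (∀ n, 0 < d n) →
    (∀ n, BreakVAR.IsGaussianWhiteNoise (ε n) (M n).noiseCov (P n)) →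
    (∀ n, (M n).IsSolution (P n) (ε n) (x n 0) (y n)) →
    -- the segments are long compared with the order of the autoregression
    Tendsto (fun n => (M n).minSegment / (d n : ℝ)) atTop atTop →
    (∀ n, (M n).AssumptionA1 (P n) (ε n) (x n) Mf mf) →
    0 < v → 0 < v' → 0 < MΦ → BreakVAR.AssumptionA2 M v v' MΦ →
    (∀ n, lam n = 2 * C * BreakVAR.rate n (p n) (d n)) →
    (∀ n, (m₀ n : ℝ) ≤ m n) → (∀ n, 1 ≤ m n) →
    m =o[atTop] (fun n => (lam n)⁻¹) →
    -- the estimator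
    (∀ n, ∀ᵐ ω ∂(P n), BreakVAR.IsEstimate (fun t => y n t ω) (lam n) (Θhat n ω)) →
    Tendsto (fun n => P n {ω |
        BreakVAR.predError (fun t => y n t ω) (Θhat n ω) (M n).theta ≤
          4 * C * m n * ((M n).maxJumpNnz : ℝ) * MΦ * BreakVAR.rate n (p n) (d n)})
      atTop (𝓝 1) := by
  have hpi := Real.pi_pos
  set K := BreakVAR.pieceBound (2 * Real.pi * Mf) (Mf / mf) with hK
  have hKpos : 0 < K := BreakVAR.pieceBound_pos (by positivity) (by positivity)
  refine ⟨Real.sqrt (64 * Real.pi * Mf * K), Real.sqrt_pos.mpr (by positivity), ?_⟩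
  intro C hC p d m₀ M Ω _ P _ ε y x v v' MΦ m lam Θhat hp hd hε hsol hseg hA _ _ hMΦ hA2 hlam hm
    hm1 hmo hest
  have hC0 : 0 < C := (Real.sqrt_pos.mpr (by positivity)).trans_le hC
  have hC2 : 64 * Real.pi * Mf * K ≤ C ^ 2 := (Real.sqrt_le_left hC0.le).mp hC
  -- The number of windows of length `d` needed for the contraction. It depends only on the spectral
  -- bounds, so segments much longer than `d` eventually contain `k + 1` of them.
  set k := max ⌈4 * (Mf / mf) ^ 4⌉₊ 1 with hk
  have hk4 : 4 * (Mf / mf) ^ 4 ≤ k :=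
    (Nat.le_ceil _).trans (by exact_mod_cast le_max_left _ _)
  have hk0 : 0 < k := lt_of_lt_of_le one_pos (le_max_right _ _)
  refine tendsto_of_tendsto_of_tendsto_of_le_of_le' BreakVAR.tendsto_one_sub_ofReal_exp_add
    tendsto_const_nhds ?_ (Eventually.of_forall fun n => prob_le_one)
  filter_upwards [eventually_gt_atTop 0, hseg.eventually_ge_atTop ((k + 1 : ℕ) : ℝ),
    BreakVAR.eventually_abs_le_of_isLittleO_inv hm1 hmo hC0] with n hn hsegn hlamn
  refine (M n).one_sub_le_measure_predError_le hn (hp n) (hd n) (hε n) (hsol n) (hA n) hmf hMf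
    hk4 hk0 ((M n).brk_add_le_of_minSegment (hd n) hsegn) hC0 hC2 ?_ (hlam n ▸ hest n) hMΦ.le
    (hA2.bounded n) (hm n) (hm1 n)
  -- From `m ≥ 1` and `m = o(λ⁻¹)` eventually `λ = 2 C rate ≤ C`, that is `rate ≤ 1/2`.
  have h := (le_abs_self _).trans hlamn
  rw [hlam n] at h
  nlinarith
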